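/- Let $k$ be a field and let $A$ be a dg $k$-algebra (unital, associative, cohomologically $\mathbb{Z}$-graded) which is proper, i.e. $\bigoplus_n H^n(A)$ is a finite dimensional $k$-vector space. Dg modules are right dg modules, $(-)^*$ denotes the graded $k$-linear dual, $A^e = A^{\mathrm{op}}\otimes_k A$, and $\simeq$ between dg bimodules denotes isomorphism in $D(A^e)$ (a zigzag of bimodule quasi-isomorphisms). An $A$-bimodule $X$ is invertible if there is an $A$-bimodule $Y$ with $X\otimes^{\mathbb{L}}_A Y\simeq A\simeq Y\otimes^{\mathbb{L}}_A X$. The algebra $A$ is twisted symmetric if the $A$-bimodule $A^*$ is invertible, and, for $d\in\mathbb{Z}$, it is $d$-symmetric if $A^*\simeq A[d]$ as $A$-bimodules. Let $\mathrm{Perf}\,A$ be the smallest full triangulated subcategory of $D(A)$ which contains $A$ and is closed under direct summands, regarded as a dg category (namely, the full dg category of K-projective dg modules lying in it). For an $A$-bimodule $X$, an $X$-twisted Calabi–Yau structure on $\mathrm{Perf}\,A$ consists of quasi-isomorphisms $$\mathbb{R}\mathrm{Hom}_A(M, L\otimes^{\mathbb{L}}_A X)^* \simeq \mathbb{R}\mathrm{Hom}_A(L,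 M)$$ natural in $L, M\in\mathrm{Perf}\,A$, where naturality is meant in the dg sense: the two sides are related by a zigzag of objectwise quasi-isomorphisms of dg functors $(\mathrm{Perf}\,A)^{\mathrm{op}}\otimes \mathrm{Perf}\,A\to C(k)$, with $C(k)$ the dg category of complexes of $k$-vector spaces. One says that $\mathrm{Perf}\,A$ admits a twisted Calabi–Yau structure if it admits an $X$-twisted one for some invertible bimodule $X$, and that it admits a $d$-Calabi–Yau structure if it admits an $X$-twisted one for $X=A[d]$. Then: 1. $A$ is twisted symmetric if and only if $\mathrm{Perf}\,A$ admits a twisted Calabi–Yau structure. 2. For every $d\in\mathbb{Z}$, $A$ is $d$-symmetric if and only if $\mathrm{Perf}\,A$ admits a $d$-Calabi–Yau structure. -/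

import Mathlib

open CategoryTheory CochainComplex.HomComplex
open scoped TensorProduct

universe u

/-- Dg vector spaces over `k`: cochain complexes of `k`-vector spaces. -/
abbrev DGVect (k : Type u) [Field k] : Type (u + 1) := CochainComplex (ModuleCat.{u} k) ℤ

/-- A dg algebra over `k`: a dg vector space with an associative unital multiplication of degree
zero satisfying the graded Leibniz rule. The product `mul h x y` of `x` of degree `i` and `y` of
degree `j` lies in degree `n`, for any proof `h` of `i + j = n`. -/
structure DGAlgebra (k : Type u) [Field k] where
  V : DGVect k
  one : V.X 0
  mul : ∀ {i j n : ℤ}, i + j = n → (V.X i →ₗ[k] V.X j →ₗ[k] V.X n)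
  one_mul : ∀ {i : ℤ} (x : V.X i), mul (zero_add i) one x = x
  mul_one : ∀ {i : ℤ} (x : V.X i), mul (add_zero i) x one = x
  mul_assoc : ∀ {i j l ij jl n : ℤ} (h₁ : i + j = ij) (h₂ : ij + l = n) (h₃ : j + l = jl)
    (h₄ : i + jl = n) (x : V.X i) (y : V.X j) (z : V.X l),
    mul h₂ (mul h₁ x y) z = mul h₄ x (mul h₃ y z)
  d_mul : ∀ {i j n : ℤ} (h : i + j = n) (x : V.X i) (y : V.X j),
    (V.d n (n + 1)).hom (mul h x y) =
      mul (by omega : (i + 1) + j = n + 1) ((V.d i (i + 1)).hom x) y +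
      i.negOnePow • mul (by omega : i + (j + 1) = n + 1) x ((V.d j (j + 1)).hom y)

/-- A (right) dg module over `A`. -/
structure DGModule {k : Type u} [Field k] (A : DGAlgebra k) where
  V : DGVect k
  ract : ∀ {i j n : ℤ}, i + j = n → (V.X i →ₗ[k] A.V.X j →ₗ[k] V.X n)
  ract_one : ∀ {i : ℤ} (x : V.X i), ract (add_zero i) x A.one = x
  ract_mul : ∀ {i j l ij jl n : ℤ} (h₁ : i + j = ij) (h₂ : ij + l = n) (h₃ : j + l = jl)
    (h₄ : i + jl = n) (x : V.X i) (a : A.V.X j) (b : A.V.X l),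
    ract h₂ (ract h₁ x a) b = ract h₄ x (A.mul h₃ a b)
  d_ract : ∀ {i j n : ℤ} (h : i + j = n) (x : V.X i) (a : A.V.X j),
    (V.d n (n + 1)).hom (ract h x a) =
      ract (by omega : (i + 1) + j = n + 1) ((V.d i (i + 1)).hom x) a +
      i.negOnePow • ract (by omega : i + (j + 1) = n + 1) x ((A.V.d j (j + 1)).hom a)

/-- A dg bimodule over `A`: a right dg module with a commuting structure of a left dg module. -/
structure DGBimodule {k : Type u} [Field k] (A : DGAlgebra k) extends DGModule A where
  lact : ∀ {i j n : ℤ}, i + j = n → (A.V.X i →ₗ[k] V.X j →ₗ[k] V.X n)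
  one_lact : ∀ {i : ℤ} (x : V.X i), lact (zero_add i) A.one x = x
  mul_lact : ∀ {i j l ij jl n : ℤ} (h₁ : i + j = ij) (h₂ : ij + l = n) (h₃ : j + l = jl)
    (h₄ : i + jl = n) (a : A.V.X i) (b : A.V.X j) (x : V.X l),
    lact h₂ (A.mul h₁ a b) x = lact h₄ a (lact h₃ b x)
  d_lact : ∀ {i j n : ℤ} (h : i + j = n) (a : A.V.X i) (x : V.X j),
    (V.d n (n + 1)).hom (lact h a x) =
      lact (by omega : (i + 1) + j = n + 1) ((A.V.d i (i + 1)).hom a) x +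
      i.negOnePow • lact (by omega : i + (j + 1) = n + 1) a ((V.d j (j + 1)).hom x)
  lact_ract : ∀ {i j l ij jl n : ℤ} (h₁ : i + j = ij) (h₂ : ij + l = n) (h₃ : j + l = jl)
    (h₄ : i + jl = n) (a : A.V.X i) (x : V.X j) (b : A.V.X l),
    ract h₂ (lact h₁ a x) b = lact h₄ a (ract h₃ x b)

namespace DGAlgebra

variable {k : Type u} [Field k] (A : DGAlgebra k)

/-- The diagonal bimodule `A`. -/
def diagonal : DGBimodule A where
  V := A.V
  ract := A.mul
  ract_one := A.mul_one
  ract_mul := A.mul_assoc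
  d_ract := A.d_mul
  lact := A.mul
  one_lact := A.one_mul
  mul_lact := A.mul_assoc
  d_lact := A.d_mul
  lact_ract := A.mul_assoc

/-- `A` is proper if its total cohomology is finite dimensional. -/
def IsProper : Prop := Module.Finite k (DirectSum ℤ fun n => A.V.homology n)

end DGAlgebra

namespace DGVect

variable {k : Type u} [Field k]

/-- The differential of the complex with given terms and differentials, on elements. -/
lemma of_d_hom (X : ℤ → ModuleCat.{u} k) (d : ∀ n, X n ⟶ X (n + 1))
    (sq : ∀ n, d n ≫ d (n + 1) = 0) (n : ℤ) :
    ((CochainComplex.of X d sq).d n (n + 1)).hom = (d n).hom := by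
  change (CochainComplex.of.d X d n (n + 1)).hom = _
  rw [CochainComplex.of_d]

lemma d_d (V : DGVect k) {i j l : ℤ} (x : V.X i) : (V.d j l).hom ((V.d i j).hom x) = 0 := by
  rw [← LinearMap.comp_apply, ← ModuleCat.hom_comp, V.d_comp_d]; rfl

/-- The graded linear dual `V^* = Hom_k(V, k)`, with `(V^*)^n = Hom_k(V^{-n}, k)` and differential
`d φ = - (-1)^n φ ∘ d` for `φ` of degree `n`. -/
noncomputable def dual (V : DGVect k) : DGVect k where
  X n := ModuleCat.of k (Module.Dual k (V.X (-n)))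
  d i j := ModuleCat.ofHom (j.negOnePow • (V.d (-j) (-i)).hom.dualMap)
  shape i j h := by
    rw [V.shape (-j) (-i)]
    · ext φ; simp
    · intro h'; apply h; simp at h' ⊢; omega
  d_comp_d' i j l _ _ := by
    ext φ x
    simp [Units.smul_def, d_d]

end DGVect

namespace DGModule

variable {k : Type u} [Field k] {A : DGAlgebra k}

lemma d_ract' (M : DGModule A) {i j n i' j' n' : ℤ} (h : i + j = n) (hi : i + 1 = i')
    (hj : j + 1 = j') (hn : n + 1 = n') (x : M.V.X i) (a : A.V.X j) :
    (M.V.d n n').hom (M.ract h x a) =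
      M.ract (by omega : i' + j = n') ((M.V.d i i').hom x) a +
      i.negOnePow • M.ract (by omega : i + j' = n') x ((A.V.d j j').hom a) := by
  subst hi hj hn
  exact M.d_ract h x a

/-- Build a dg module from its graded pieces and the differentials `d n : X n → X (n + 1)`. -/
noncomputable def ofSucc (X : ℤ → ModuleCat.{u} k) (d : ∀ n, X n ⟶ X (n + 1))
    (sq : ∀ n, d n ≫ d (n + 1) = 0)
    (act : ∀ {i j n : ℤ}, i + j = n → (X i →ₗ[k] A.V.X j →ₗ[k] X n))
    (act_one : ∀ {i : ℤ} (x : X i), act (add_zero i) x A.one = x)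
    (act_mul : ∀ {i j l ij jl n : ℤ} (h₁ : i + j = ij) (h₂ : ij + l = n) (h₃ : j + l = jl)
      (h₄ : i + jl = n) (x : X i) (a : A.V.X j) (b : A.V.X l),
      act h₂ (act h₁ x a) b = act h₄ x (A.mul h₃ a b))
    (d_act : ∀ {i j n : ℤ} (h : i + j = n) (x : X i) (a : A.V.X j),
      (d n).hom (act h x a) = act (by omega : (i + 1) + j = n + 1) ((d i).hom x) a +
        i.negOnePow • act (by omega : i + (j + 1) = n + 1) x ((A.V.d j (j + 1)).hom a)) :
    DGModule A where
  V := CochainComplex.of X d sq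
  ract := act
  ract_one := act_one
  ract_mul := act_mul
  d_ract h x a := by
    rw [DGVect.of_d_hom, DGVect.of_d_hom]
    exact d_act h x a

/-- Morphisms of dg modules: `A`-linear chain maps. -/
@[ext]
structure Hom (M N : DGModule A) where
  f : M.V ⟶ N.V
  map_ract : ∀ {i j n : ℤ} (h : i + j = n) (x : M.V.X i) (a : A.V.X j),
    (f.f n).hom (M.ract h x a) = N.ract h ((f.f i).hom x) a

lemma shift_aux (M : DGModule A) (n : ℤ) {i j l : ℤ} (h : i + j = l) (x : M.V.X (i + n))
    (a : A.V.X j) :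
    n.negOnePow • (M.V.d (l + n) (l + 1 + n)).hom
        (M.ract (by omega : (i + n) + j = l + n) x a) =
      M.ract (by omega : (i + 1 + n) + j = l + 1 + n)
        (n.negOnePow • (M.V.d (i + n) (i + 1 + n)).hom x) a +
      i.negOnePow • M.ract (by omega : (i + n) + (j + 1) = l + 1 + n) x
        ((A.V.d j (j + 1)).hom a) := by
  rw [M.d_ract' _ (by omega : i + n + 1 = i + 1 + n) rfl (by omega)]
  rcases Int.even_or_odd n with hn | hn
  · simp [Int.negOnePow_add, Int.negOnePow_even n hn]
  · simp [Int.negOnePow_add, Int.negOnePow_odd n hn]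

/-- The shift `M[n]`, with `M[n]^i = M^{i+n}` and differential `(-1)^n d`. -/
noncomputable def shift (M : DGModule A) (n : ℤ) : DGModule A where
  V := (CochainComplex.shiftFunctor (ModuleCat.{u} k) n).obj M.V
  ract {i j l} h := M.ract (i := i + n) (j := j) (n := l + n) (by omega)
  ract_one x := M.ract_one x
  ract_mul h₁ h₂ h₃ h₄ x a b := M.ract_mul _ _ h₃ _ x a b
  d_ract h x a := M.shift_aux n h x a

/-- The differential of the mapping cone. -/
noncomputable def coneD {M N : DGModule A} (f : Hom M N) (n : ℤ) :
    (N.V.X n × M.V.X (n + 1)) →ₗ[k] (N.V.X (n + 1) × M.V.X (n + 1 + 1)) :=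
  LinearMap.prod ((N.V.d n (n + 1)).hom.coprod (f.f.f (n + 1)).hom)
    (-(M.V.d (n + 1) (n + 1 + 1)).hom ∘ₗ LinearMap.snd k _ _)

lemma coneD_apply {M N : DGModule A} (f : Hom M N) (n : ℤ) (y : N.V.X n) (x : M.V.X (n + 1)) :
    coneD f n (y, x) = ((N.V.d n (n + 1)).hom y + (f.f.f (n + 1)).hom x,
      -(M.V.d (n + 1) (n + 1 + 1)).hom x) := rfl

lemma coneD_sq {M N : DGModule A} (f : Hom M N) (n : ℤ) : coneD f (n + 1) ∘ₗ coneD f n = 0 := by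
  apply LinearMap.ext
  rintro ⟨y, x⟩
  have h : (N.V.d (n + 1) (n + 1 + 1)).hom ((f.f.f (n + 1)).hom x) =
      (f.f.f (n + 1 + 1)).hom ((M.V.d (n + 1) (n + 1 + 1)).hom x) := by
    rw [← LinearMap.comp_apply, ← ModuleCat.hom_comp, f.f.comm]; rfl
  rw [LinearMap.comp_apply, coneD_apply, coneD_apply]
  simp [DGVect.d_d, h]

/-- The right action on the mapping cone. -/
noncomputable def coneAct (M N : DGModule A) {i j n : ℤ} (h : i + j = n) :
    (N.V.X i × M.V.X (i + 1)) →ₗ[k] A.V.X j →ₗ[k] (N.V.X n × M.V.X (n + 1)) :=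
  LinearMap.mk₂ k (fun z a => (N.ract h z.1 a, M.ract (by omega : i + 1 + j = n + 1) z.2 a))
    (fun z z' a => by simp) (fun c z a => by simp) (fun z a b => by simp) (fun c z a => by simp)

lemma cone_aux {M N : DGModule A} (f : Hom M N) {i j n : ℤ} (h : i + j = n)
    (z : N.V.X i × M.V.X (i + 1)) (a : A.V.X j) :
    coneD f n (coneAct M N h z a) =
      coneAct M N (by omega : i + 1 + j = n + 1) (coneD f i z) a +
      i.negOnePow • coneAct M N (by omega : i + (j + 1) = n + 1) z ((A.V.d j (j + 1)).hom a) := by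
  obtain ⟨y, x⟩ := z
  change coneD f n (N.ract h y a, M.ract (by omega : i + 1 + j = n + 1) x a) =
    (N.ract _ ((N.V.d i (i + 1)).hom y + (f.f.f (i + 1)).hom x) a,
      M.ract _ (-(M.V.d (i + 1) (i + 1 + 1)).hom x) a) +
    i.negOnePow • (N.ract _ y ((A.V.d j (j + 1)).hom a), M.ract _ x ((A.V.d j (j + 1)).hom a))
  rw [coneD_apply, N.d_ract, f.map_ract, M.d_ract' _ rfl rfl rfl]
  ext
  · simp [Units.smul_def]; abel
  · simp [Units.smul_def, Int.negOnePow_succ]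
    exact add_comm _ _

/-- The mapping cone of `f : M → N`: `cone(f)^n = N^n ⊕ M^{n+1}`, with
`d (y, x) = (d y + f x, - d x)`. -/
noncomputable def cone {M N : DGModule A} (f : Hom M N) : DGModule A :=
  ofSucc (fun n => ModuleCat.of k (N.V.X n × M.V.X (n + 1)))
    (fun n => ModuleCat.ofHom (coneD f n))
    (fun n => by rw [← ModuleCat.ofHom_comp, coneD_sq]; rfl)
    (fun h => coneAct M N h)
    (fun z => Prod.ext (N.ract_one z.1) (M.ract_one z.2))
    (fun h₁ h₂ h₃ h₄ z a b =>
      Prod.ext (N.ract_mul h₁ h₂ h₃ h₄ z.1 a b) (M.ract_mul _ _ h₃ _ z.2 a b))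
    (fun h z a => cone_aux f h z a)

/-- The `A`-linear cochains of degree `n` from `M` to `N`: families of linear maps
`f : M^p → N^{p+n}` with `f (x a) = f (x) a`. -/
def linCochain (M N : DGModule A) (n : ℤ) : Submodule k (Cochain M.V N.V n) where
  carrier := {f | ∀ (p q p' q' i : ℤ) (hpq : p + n = q) (hpq' : p' + n = q') (h : p + i = p')
    (x : M.V.X p) (a : A.V.X i), (f.v p' q' hpq').hom (M.ract h x a) =
      N.ract (by omega : q + i = q') ((f.v p q hpq).hom x) a}
  add_mem' hf hg p q p' q' i hpq hpq' h x a := by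
    simp [hf p q p' q' i hpq hpq' h, hg p q p' q' i hpq hpq' h]
  zero_mem' p q p' q' i hpq hpq' h x a := by simp
  smul_mem' c f hf p q p' q' i hpq hpq' h x a := by simp [hf p q p' q' i hpq hpq' h]

lemma comp_mem_linCochain {L M N : DGModule A} {m n l : ℤ} (h : m + n = l)
    {f : Cochain L.V M.V m} (hf : f ∈ linCochain L M m)
    {g : Cochain M.V N.V n} (hg : g ∈ linCochain M N n) : f.comp g h ∈ linCochain L N l := by
  intro p q p' q' i hpq hpq' hp x a
  rw [Cochain.comp_v f g h p' (p' + m) q' rfl (by omega),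
    Cochain.comp_v f g h p (p + m) q rfl (by omega)]
  simp only [ModuleCat.hom_comp, LinearMap.comp_apply]
  rw [hf p _ p' _ i rfl rfl hp, hg (p + m) q (p' + m) q' i (by omega) (by omega) (by omega)]

lemma δ_mem_linCochain {M N : DGModule A} {n : ℤ} {f : Cochain M.V N.V n}
    (hf : f ∈ linCochain M N n) (m : ℤ) : δ n m f ∈ linCochain M N m := by
  by_cases hm : n + 1 = m
  swap
  · rw [δ_shape _ _ hm]; exact Submodule.zero_mem _
  subst hm
  intro p q p' q' i hpq hpq' hp x a
  rw [δ_v n (n + 1) rfl f p' q' hpq' (q' - 1) (p' + 1) rfl rfl,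
    δ_v n (n + 1) rfl f p q hpq (q - 1) (p + 1) rfl rfl]
  have h1 := hf (p) (q - 1) (p') (q' - 1) i (by omega) (by omega) hp x a
  have h2 := hf (p + 1) (q) (p' + 1) (q') i (by omega) (by omega)
    (by omega) ((M.V.d p (p + 1)).hom x) a
  have h3 := hf p (q - 1) (p' + 1) q' (i + 1) (by omega) (by omega)
    (by omega) x ((A.V.d i (i + 1)).hom a)
  have h4 := N.d_ract' (i := q - 1) (i' := q) (j' := i + 1) (n' := q')
    (by omega : q - 1 + i = q' - 1) (by omega) rfl (by omega)
    ((f.v p (q - 1) (by omega)).hom x) a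
  have h5 := M.d_ract' hp rfl rfl rfl x a
  have hq : (q - 1).negOnePow = (p + n).negOnePow := by congr 1; omega
  rw [hq] at h4
  simp only [ModuleCat.hom_add, LinearMap.add_apply, ModuleCat.hom_comp, LinearMap.comp_apply,
    Units.smul_def, ModuleCat.hom_zsmul, LinearMap.smul_apply, h1, h4, h5, map_add, map_zsmul, h2,
    h3, smul_add, smul_smul]
  rcases Int.even_or_odd n with hn | hn <;> rcases Int.even_or_odd p with hp | hp
  all_goals
    simp [Int.negOnePow_add, Int.negOnePow_even, Int.negOnePow_odd, hn, hp]
    abel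

/-- The differential `δ f = d ∘ f - (-1)^i f ∘ d` on `A`-linear cochains of degree `i`. -/
noncomputable def linδ (M N : DGModule A) (i j : ℤ) : linCochain M N i →ₗ[k] linCochain M N j :=
  (δ_hom k M.V N.V i j).restrict fun _ hf => δ_mem_linCochain hf j

lemma linδ_shape (M N : DGModule A) (i j : ℤ) (h : i + 1 ≠ j) : linδ M N i j = 0 :=
  LinearMap.ext fun f => Subtype.ext (δ_shape i j h f.1)

lemma linδ_linδ (M N : DGModule A) (i j l : ℤ) : linδ M N j l ∘ₗ linδ M N i j = 0 :=
  LinearMap.ext fun f => Subtype.ext (δ_δ i j l f.1)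

/-- The complex `Hom_A(M, N)` of `A`-linear cochains. -/
noncomputable def homComplex (M N : DGModule A) : DGVect k where
  X n := ModuleCat.of k (linCochain M N n)
  d i j := ModuleCat.ofHom (linδ M N i j)
  shape i j h := by rw [linδ_shape M N i j h]; rfl
  d_comp_d' i j l _ _ := by rw [← ModuleCat.ofHom_comp, linδ_linδ]; rfl

/-- A dg module `P` is K-projective if `Hom_A(P, -)` preserves acyclicity. For such `P` the complex
`Hom_A(P, N)` computes `RHom_A(P, N)`. -/
def IsKProjective (P : DGModule A) : Prop :=
  ∀ N : DGModule A, N.V.Acyclic → (homComplex P N).Acyclic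

/-- The objects of `Perf A = thick(A)`: the smallest class of dg modules which contains `A`, and is
closed under quasi-isomorphisms (in both directions), shifts, mapping cones and direct summands. -/
inductive IsPerfect : DGModule A → Prop
  | self : IsPerfect A.diagonal.toDGModule
  | of_quasiIso {M N : DGModule A} (f : Hom M N) (hf : QuasiIso f.f) : IsPerfect M → IsPerfect N
  | of_quasiIso' {M N : DGModule A} (f : Hom M N) (hf : QuasiIso f.f) : IsPerfect N → IsPerfect M
  | shift {M : DGModule A} (n : ℤ) : IsPerfect M → IsPerfect (M.shift n)
  | cone {M N : DGModule A} (f : Hom M N) : IsPerfect M → IsPerfect N → IsPerfect (cone f)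
  | summand {M N : DGModule A} (i : Hom M N) (p : Hom N M) (h : i.f ≫ p.f = 𝟙 M.V) :
      IsPerfect N → IsPerfect M

end DGModule

namespace DGBimodule

open DGModule

variable {k : Type u} [Field k] {A : DGAlgebra k}

lemma d_lact' (M : DGBimodule A) {i j n i' j' n' : ℤ} (h : i + j = n) (hi : i + 1 = i')
    (hj : j + 1 = j') (hn : n + 1 = n') (a : A.V.X i) (x : M.V.X j) :
    (M.V.d n n').hom (M.lact h a x) =
      M.lact (by omega : i' + j = n') ((A.V.d i i').hom a) x +
      i.negOnePow • M.lact (by omega : i + j' = n') a ((M.V.d j j').hom x) := by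
  subst hi hj hn
  exact M.d_lact h a x

/-- Morphisms of dg bimodules: bilinear chain maps. -/
@[ext]
structure Hom (M N : DGBimodule A) extends DGModule.Hom M.toDGModule N.toDGModule where
  map_lact : ∀ {i j n : ℤ} (h : i + j = n) (a : A.V.X i) (x : M.V.X j),
    (f.f n).hom (M.lact h a x) = N.lact h a ((f.f j).hom x)

/-- Two bimodules are quasi-isomorphic, `M ≃ N`, if they are related by a zigzag of
quasi-isomorphisms of bimodules, i.e. if they are isomorphic in `D(A^e)`. -/
def QIso : DGBimodule A → DGBimodule A → Prop :=
  Relation.EqvGen fun M N => ∃ f : Hom M N, QuasiIso f.f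

lemma shift_aux (M : DGBimodule A) (n : ℤ) {i j l : ℤ} (h : i + j = l) (a : A.V.X i)
    (x : M.V.X (j + n)) :
    n.negOnePow • (M.V.d (l + n) (l + 1 + n)).hom
        ((n * i).negOnePow • M.lact (by omega : i + (j + n) = l + n) a x) =
      (n * (i + 1)).negOnePow • M.lact (by omega : (i + 1) + (j + n) = l + 1 + n)
        ((A.V.d i (i + 1)).hom a) x +
      i.negOnePow • (n * i).negOnePow • M.lact (by omega : i + (j + 1 + n) = l + 1 + n) a
        (n.negOnePow • (M.V.d (j + n) (j + 1 + n)).hom x) := by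
  have := M.d_lact' (by omega : i + (j + n) = l + n) rfl (by omega : j + n + 1 = j + 1 + n)
    (by omega : l + n + 1 = l + 1 + n) a x
  rcases Int.even_or_odd i with hi | hi <;> rcases Int.even_or_odd n with hn | hn <;>
    simp [Int.negOnePow_add, mul_add, Int.negOnePow_even, Int.negOnePow_odd, hi, hn, this]
  exact add_comm _ _

/-- The shift `M[n]` of a bimodule: the right action is unchanged, the left action is
`a · x = (-1)^{n|a|} a x`. -/
noncomputable def shift (M : DGBimodule A) (n : ℤ) : DGBimodule A where
  toDGModule := M.toDGModule.shift n
  lact {i j l} h := (n * i).negOnePow • M.lact (i := i) (j := j + n) (n := l + n) (by omega)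
  one_lact x := by
    rw [mul_zero, Int.negOnePow_zero, one_smul]
    exact M.one_lact x
  mul_lact {i j l ij jl m} h₁ h₂ h₃ h₄ a b (x : M.V.X (l + n)) := by
    change (n * ij).negOnePow • M.lact (by omega : ij + (l + n) = m + n) (A.mul h₁ a b) x =
      (n * i).negOnePow • M.lact (by omega : i + (jl + n) = m + n) a
        ((n * j).negOnePow • M.lact (by omega : j + (l + n) = jl + n) b x)
    rw [M.mul_lact h₁ _ (by omega : j + (l + n) = jl + n) (by omega),
      (by rw [← h₁, mul_add, Int.negOnePow_add] :
        (n * ij).negOnePow = (n * i).negOnePow * (n * j).negOnePow)]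
    simp [Units.smul_def, smul_smul]
  d_lact h a x := M.shift_aux n h a x
  lact_ract {i j l ij jl m} h₁ h₂ h₃ h₄ a (x : M.V.X (j + n)) b := by
    change M.ract (by omega : ij + n + l = m + n)
        ((n * i).negOnePow • M.lact (by omega : i + (j + n) = ij + n) a x) b =
      (n * i).negOnePow • M.lact (by omega : i + (jl + n) = m + n) a
        (M.ract (by omega : j + n + l = jl + n) x b)
    rw [← M.lact_ract (by omega : i + (j + n) = ij + n) (by omega)]
    simp [Units.smul_def]

/-- The right action `(φ a)(x) = φ (a x)` on the linear dual. -/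
noncomputable def dualRact (M : DGBimodule A) {i j n : ℤ} (h : i + j = n) :
    Module.Dual k (M.V.X (-i)) →ₗ[k] A.V.X j →ₗ[k] Module.Dual k (M.V.X (-n)) :=
  LinearMap.mk₂ k (fun φ a => φ ∘ₗ M.lact (by omega : j + -n = -i) a)
    (by intros; ext; simp) (by intros; ext; simp) (by intros; ext; simp) (by intros; ext; simp)

/-- The left action `(a φ)(x) = (-1)^{|a|} φ (x a)` on the linear dual. -/
noncomputable def dualLact (M : DGBimodule A) {i j n : ℤ} (h : i + j = n) :
    A.V.X i →ₗ[k] Module.Dual k (M.V.X (-j)) →ₗ[k] Module.Dual k (M.V.X (-n)) :=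
  LinearMap.mk₂ k
    (fun a φ => i.negOnePow • φ ∘ₗ (M.ract (by omega : -n + i = -j)).flip a)
    (by intros; ext; simp [Units.smul_def]) (by intros; ext; simp [Units.smul_def]; ring)
    (by intros; ext; simp [Units.smul_def]) (by intros; ext; simp [Units.smul_def]; ring)

lemma dualRact_apply (M : DGBimodule A) {i j n : ℤ} (h : i + j = n)
    (φ : Module.Dual k (M.V.X (-i))) (a : A.V.X j) (x : M.V.X (-n)) :
    M.dualRact h φ a x = φ (M.lact (by omega : j + -n = -i) a x) := rfl

lemma dualLact_apply (M : DGBimodule A) {i j n : ℤ} (h : i + j = n)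
    (a : A.V.X i) (φ : Module.Dual k (M.V.X (-j))) (x : M.V.X (-n)) :
    M.dualLact h a φ x = i.negOnePow • φ (M.ract (by omega : -n + i = -j) x a) := rfl

lemma dual_aux₁ (M : DGBimodule A) {i j n : ℤ} (h : i + j = n)
    (φ : Module.Dual k (M.V.X (-i))) (a : A.V.X j) :
    (M.V.dual.d n (n + 1)).hom (M.dualRact h φ a) =
      M.dualRact (by omega : i + 1 + j = n + 1) ((M.V.dual.d i (i + 1)).hom φ) a +
      i.negOnePow • M.dualRact (by omega : i + (j + 1) = n + 1) φ ((A.V.d j (j + 1)).hom a) := by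
  apply LinearMap.ext
  intro (x : M.V.X (-(n + 1)))
  have h1 := M.d_lact' (by omega : j + -(n + 1) = -(i + 1)) rfl (by omega : -(n + 1) + 1 = -n)
    (by omega : -(i + 1) + 1 = -i) a x
  change (n + 1).negOnePow • φ (M.lact (by omega : j + -n = -i) a
      ((M.V.d (-(n + 1)) (-n)).hom x)) =
    (i + 1).negOnePow • φ ((M.V.d (-(i + 1)) (-i)).hom
      (M.lact (by omega : j + -(n + 1) = -(i + 1)) a x)) +
    i.negOnePow • φ (M.lact (by omega : (j + 1) + -(n + 1) = -i) ((A.V.d j (j + 1)).hom a) x)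
  rw [h1]
  subst h
  rcases Int.even_or_odd i with hi | hi <;> rcases Int.even_or_odd j with hj | hj <;>
    simp [Int.negOnePow_add, Int.negOnePow_even, Int.negOnePow_odd, hi, hj]

lemma dual_aux₂ (M : DGBimodule A) {i j n : ℤ} (h : i + j = n)
    (a : A.V.X i) (φ : Module.Dual k (M.V.X (-j))) :
    (M.V.dual.d n (n + 1)).hom (M.dualLact h a φ) =
      M.dualLact (by omega : i + 1 + j = n + 1) ((A.V.d i (i + 1)).hom a) φ +
      i.negOnePow • M.dualLact (by omega : i + (j + 1) = n + 1) a
        ((M.V.dual.d j (j + 1)).hom φ) := by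
  apply LinearMap.ext
  intro (x : M.V.X (-(n + 1)))
  have h1 := M.d_ract' (by omega : -(n + 1) + i = -(j + 1)) (by omega : -(n + 1) + 1 = -n) rfl
    (by omega : -(j + 1) + 1 = -j) x a
  change (n + 1).negOnePow • i.negOnePow • φ (M.ract (by omega : -n + i = -j)
      ((M.V.d (-(n + 1)) (-n)).hom x) a) =
    (i + 1).negOnePow • φ (M.ract (by omega : -(n + 1) + (i + 1) = -j) x
      ((A.V.d i (i + 1)).hom a)) +
    i.negOnePow • i.negOnePow • (j + 1).negOnePow • φ ((M.V.d (-(j + 1)) (-j)).hom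
      (M.ract (by omega : -(n + 1) + i = -(j + 1)) x a))
  rw [h1]
  subst h
  rcases Int.even_or_odd i with hi | hi <;> rcases Int.even_or_odd j with hj | hj <;>
    simp [Int.negOnePow_add, Int.negOnePow_even, Int.negOnePow_odd, hi, hj]

lemma dual_aux₃ (M : DGBimodule A) {i : ℤ} (φ : Module.Dual k (M.V.X (-i))) :
    M.dualLact (zero_add i) A.one φ = φ :=
  LinearMap.ext fun x => by
    rw [dualLact_apply, M.ract_one, Int.negOnePow_zero, one_smul]

lemma dual_aux₄ (M : DGBimodule A) {i j l ij jl n : ℤ} (h₁ : i + j = ij) (h₂ : ij + l = n)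
    (h₃ : j + l = jl) (h₄ : i + jl = n) (a : A.V.X i) (b : A.V.X j)
    (φ : Module.Dual k (M.V.X (-l))) :
    M.dualLact h₂ (A.mul h₁ a b) φ = M.dualLact h₄ a (M.dualLact h₃ b φ) :=
  LinearMap.ext fun x => by
    rw [dualLact_apply, dualLact_apply, dualLact_apply, smul_smul, ← Int.negOnePow_add, h₁,
      M.ract_mul _ _ h₁]

lemma dual_aux₅ (M : DGBimodule A) {i j l ij jl n : ℤ} (h₁ : i + j = ij) (h₂ : ij + l = n)
    (h₃ : j + l = jl) (h₄ : i + jl = n) (a : A.V.X i) (φ : Module.Dual k (M.V.X (-j)))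
    (b : A.V.X l) :
    M.dualRact h₂ (M.dualLact h₁ a φ) b = M.dualLact h₄ a (M.dualRact h₃ φ b) :=
  LinearMap.ext fun x => by
    rw [dualRact_apply, dualLact_apply, dualLact_apply, dualRact_apply,
      M.lact_ract _ _ (by omega : -n + i = -jl)]

/-- The linear dual `M^*` of a bimodule, with actions `(φ a)(x) = φ (a x)` and
`(a φ)(x) = (-1)^{|a|} φ (x a)`. (The Koszul sign is `|a| (|φ| + |x|)`, where
`|φ| + |x| = - |a|`.) -/
noncomputable def dual (M : DGBimodule A) : DGBimodule A where
  V := M.V.dual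
  ract h := M.dualRact h
  ract_one {i} (φ : Module.Dual k (M.V.X (-i))) := LinearMap.ext fun x =>
    congrArg φ (M.one_lact x)
  ract_mul {i j l ij jl n} h₁ h₂ h₃ h₄ (φ : Module.Dual k (M.V.X (-i))) a b :=
    LinearMap.ext fun x =>
      congrArg φ (M.mul_lact h₃ (by omega : jl + -n = -i) (by omega : l + -n = -ij)
        (by omega) a b x).symm
  d_ract h φ a := M.dual_aux₁ h φ a
  lact h := M.dualLact h
  one_lact {i} (φ : Module.Dual k (M.V.X (-i))) := M.dual_aux₃ φ
  mul_lact h₁ h₂ h₃ h₄ a b φ := M.dual_aux₄ h₁ h₂ h₃ h₄ a b φ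
  d_lact h a φ := M.dual_aux₂ h a φ
  lact_ract h₁ h₂ h₃ h₄ a φ b := M.dual_aux₅ h₁ h₂ h₃ h₄ a φ b

end DGBimodule

namespace DGTensor

variable {k : Type u} [Field k] {A : DGAlgebra k} (L : DGModule A) (X : DGBimodule A)

/-- The degree `n` part of `L ⊗_k X`. -/
abbrev Pre (n : ℤ) : Type u :=
  DirectSum {p : ℤ × ℤ // p.1 + p.2 = n} fun p => L.V.X p.1.1 ⊗[k] X.V.X p.1.2

/-- The pure tensors in `L ⊗_k X`. -/
noncomputable def pretmul {i j n : ℤ} (h : i + j = n) :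
    L.V.X i →ₗ[k] X.V.X j →ₗ[k] Pre L X n :=
  (TensorProduct.mk k (L.V.X i) (X.V.X j)).compr₂
    (DirectSum.lof k {p : ℤ × ℤ // p.1 + p.2 = n} (fun p => L.V.X p.1.1 ⊗[k] X.V.X p.1.2)
      ⟨(i, j), h⟩)

/-- The relations `x a ⊗ y = x ⊗ a y`. -/
def rel (n : ℤ) : Submodule k (Pre L X n) :=
  Submodule.span k {z | ∃ (i j l ij jl : ℤ) (h₁ : i + j = ij) (h₂ : ij + l = n) (h₃ : j + l = jl)
    (h₄ : i + jl = n) (x : L.V.X i) (a : A.V.X j) (y : X.V.X l),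
    z = pretmul L X h₂ (L.ract h₁ x a) y - pretmul L X h₄ x (X.lact h₃ a y)}

/-- The degree `n` part of `L ⊗_A X`. -/
abbrev T (n : ℤ) : Type u := Pre L X n ⧸ rel L X n

/-- The pure tensors in `L ⊗_A X`. -/
noncomputable def tmul {i j n : ℤ} (h : i + j = n) : L.V.X i →ₗ[k] X.V.X j →ₗ[k] T L X n :=
  (pretmul L X h).compr₂ (rel L X n).mkQ

variable {L X}

lemma tmul_balanced {i j l ij jl n : ℤ} (h₁ : i + j = ij) (h₂ : ij + l = n) (h₃ : j + l = jl)
    (h₄ : i + jl = n) (x : L.V.X i) (a : A.V.X j) (y : X.V.X l) :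
    tmul L X h₂ (L.ract h₁ x a) y = tmul L X h₄ x (X.lact h₃ a y) :=
  (Submodule.Quotient.eq _).2
    (Submodule.subset_span ⟨i, j, l, ij, jl, h₁, h₂, h₃, h₄, x, a, y, rfl⟩)

section lift

variable {W : Type u} [AddCommGroup W] [Module k W]

/-- Two linear maps out of `(L ⊗_A X)^n` which agree on pure tensors are equal. -/
lemma hom_ext {n : ℤ} {f g : T L X n →ₗ[k] W}
    (h : ∀ (i j : ℤ) (hij : i + j = n) (x : L.V.X i) (y : X.V.X j),
      f (tmul L X hij x y) = g (tmul L X hij x y)) : f = g := by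
  apply Submodule.linearMap_qext
  apply DirectSum.linearMap_ext
  rintro ⟨⟨i, j⟩, hij⟩
  apply TensorProduct.ext'
  intro x y
  exact h i j hij x y

/-- The linear map out of `(L ⊗_k X)^n` induced by a family of bilinear maps. -/
noncomputable def preLift {n : ℤ} (φ : ∀ i j : ℤ, i + j = n → (L.V.X i →ₗ[k] X.V.X j →ₗ[k] W)) :
    Pre L X n →ₗ[k] W :=
  DirectSum.toModule k _ W fun p => TensorProduct.lift (φ p.1.1 p.1.2 p.2)

lemma preLift_pretmul {n : ℤ} (φ : ∀ i j : ℤ, i + j = n → (L.V.X i →ₗ[k] X.V.X j →ₗ[k] W))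
    {i j : ℤ} (h : i + j = n) (x : L.V.X i) (y : X.V.X j) :
    preLift φ (pretmul L X h x y) = φ i j h x y := by
  unfold preLift pretmul
  rw [LinearMap.compr₂_apply, DirectSum.toModule_lof]
  rfl

/-- The linear map out of `(L ⊗_A X)^n` induced by a balanced family of bilinear maps. -/
noncomputable def lift {n : ℤ} (φ : ∀ i j : ℤ, i + j = n → (L.V.X i →ₗ[k] X.V.X j →ₗ[k] W))
    (hφ : ∀ (i j l ij jl : ℤ) (h₁ : i + j = ij) (h₂ : ij + l = n) (h₃ : j + l = jl)
      (h₄ : i + jl = n) (x : L.V.X i) (a : A.V.X j) (y : X.V.X l),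
      φ ij l h₂ (L.ract h₁ x a) y = φ i jl h₄ x (X.lact h₃ a y)) : T L X n →ₗ[k] W :=
  (rel L X n).liftQ (preLift φ) (by
    apply Submodule.span_le.2
    rintro _ ⟨i, j, l, ij, jl, h₁, h₂, h₃, h₄, x, a, y, rfl⟩
    rw [SetLike.mem_coe, LinearMap.mem_ker, map_sub, preLift_pretmul, preLift_pretmul,
      hφ i j l ij jl h₁ h₂ h₃ h₄, sub_self])

lemma lift_tmul {n : ℤ} (φ : ∀ i j : ℤ, i + j = n → (L.V.X i →ₗ[k] X.V.X j →ₗ[k] W))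
    (hφ : ∀ (i j l ij jl : ℤ) (h₁ : i + j = ij) (h₂ : ij + l = n) (h₃ : j + l = jl)
      (h₄ : i + jl = n) (x : L.V.X i) (a : A.V.X j) (y : X.V.X l),
      φ ij l h₂ (L.ract h₁ x a) y = φ i jl h₄ x (X.lact h₃ a y))
    {i j : ℤ} (h : i + j = n) (x : L.V.X i) (y : X.V.X j) :
    lift φ hφ (tmul L X h x y) = φ i j h x y :=
  preLift_pretmul φ h x y

end lift

variable (L X)

/-- The differential `d (x ⊗ y) = d x ⊗ y + (-1)^{|x|} x ⊗ d y`. -/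
noncomputable def dT (n : ℤ) : T L X n →ₗ[k] T L X (n + 1) :=
  lift (fun i j h =>
      (tmul L X (by omega : i + 1 + j = n + 1)).comp (L.V.d i (i + 1)).hom +
      i.negOnePow • (tmul L X (by omega : i + (j + 1) = n + 1)).compl₂ (X.V.d j (j + 1)).hom)
    (by
      intro i j l ij jl h₁ h₂ h₃ h₄ x a y
      simp only [LinearMap.add_apply, LinearMap.comp_apply, LinearMap.smul_apply,
        LinearMap.compl₂_apply, Units.smul_def]
      rw [L.d_ract' h₁ rfl rfl rfl, X.d_lact' h₃ rfl rfl rfl]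
      simp only [map_add, LinearMap.add_apply, Units.smul_def, map_zsmul, LinearMap.smul_apply,
        smul_add, smul_smul]
      rw [tmul_balanced (by omega : i + 1 + j = ij + 1) _ h₃ (by omega),
        tmul_balanced (by omega : i + (j + 1) = ij + 1) _ (by omega : j + 1 + l = jl + 1) (by omega),
        tmul_balanced h₁ _ (by omega : j + (l + 1) = jl + 1) (by omega)]
      subst h₁
      simp only [Int.negOnePow_add, Units.val_mul]
      abel)

lemma dT_tmul {i j n : ℤ} (h : i + j = n) (x : L.V.X i) (y : X.V.X j) :
    dT L X n (tmul L X h x y) =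
      tmul L X (by omega : i + 1 + j = n + 1) ((L.V.d i (i + 1)).hom x) y +
      i.negOnePow • tmul L X (by omega : i + (j + 1) = n + 1) x ((X.V.d j (j + 1)).hom y) := by
  unfold dT
  rw [lift_tmul]
  rfl

lemma dT_tmul' {i j n i' j' : ℤ} (h : i + j = n) (hi : i + 1 = i') (hj : j + 1 = j')
    (x : L.V.X i) (y : X.V.X j) :
    dT L X n (tmul L X h x y) =
      tmul L X (by omega : i' + j = n + 1) ((L.V.d i i').hom x) y +
      i.negOnePow • tmul L X (by omega : i + j' = n + 1) x ((X.V.d j j').hom y) := by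
  subst hi hj
  exact dT_tmul L X h x y

lemma dT_dT (n : ℤ) : dT L X (n + 1) ∘ₗ dT L X n = 0 := by
  apply hom_ext
  intro i j h x y
  rw [LinearMap.comp_apply, dT_tmul, map_add, Units.smul_def, map_zsmul, dT_tmul, dT_tmul]
  simp [DGVect.d_d, Units.smul_def, Int.negOnePow_succ]

/-- The right action `(x ⊗ y) a = x ⊗ y a`. -/
noncomputable def ractT {m l n : ℤ} (h : m + l = n) : T L X m →ₗ[k] A.V.X l →ₗ[k] T L X n :=
  lift (fun i j hij => LinearMap.mk₂ k
      (fun x y => (tmul L X (by omega : i + (j + l) = n) x).comp (X.ract rfl y))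
      (by intros; ext; simp) (by intros; ext; simp) (by intros; ext; simp) (by intros; ext; simp))
    (by
      intro i j l' ij jl h₁ h₂ h₃ h₄ x a y
      apply LinearMap.ext
      intro b
      change tmul L X _ (L.ract h₁ x a) (X.ract rfl y b) =
        tmul L X _ x (X.ract rfl (X.lact h₃ a y) b)
      rw [tmul_balanced h₁ _ (by omega : j + (l' + l) = jl + l) (by omega),
        X.lact_ract h₃ rfl rfl (by omega)])

lemma ractT_tmul {i j l m n jl : ℤ} (hij : i + j = m) (h : m + l = n) (hjl : j + l = jl)
    (x : L.V.X i) (y : X.V.X j) (a : A.V.X l) :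
    ractT L X h (tmul L X hij x y) a = tmul L X (by omega : i + jl = n) x (X.ract hjl y a) := by
  subst hjl
  unfold ractT
  rw [lift_tmul]
  rfl

end DGTensor

namespace DGModule

open DGTensor

variable {k : Type u} [Field k] {A : DGAlgebra k}

/-- The tensor product `L ⊗_A X` of a dg module with a dg bimodule. -/
noncomputable def tensor (L : DGModule A) (X : DGBimodule A) : DGModule A :=
  ofSucc (fun n => ModuleCat.of k (T L X n)) (fun n => ModuleCat.ofHom (dT L X n))
    (fun n => by rw [← ModuleCat.ofHom_comp, dT_dT]; rfl)
    (fun h => ractT L X h)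
    (fun {i} z => by
      have : (ractT L X (add_zero i)).flip A.one = LinearMap.id := by
        apply hom_ext
        intro p q h x y
        rw [LinearMap.flip_apply, ractT_tmul _ _ _ _ (add_zero q), X.ract_one]
        rfl
      exact LinearMap.congr_fun this z)
    (fun {i j l ij jl n} h₁ h₂ h₃ h₄ z a b => by
      have : (ractT L X h₂).flip b ∘ₗ (ractT L X h₁).flip a =
          (ractT L X h₄).flip (A.mul h₃ a b) := by
        apply hom_ext
        intro p q h x y
        rw [LinearMap.comp_apply, LinearMap.flip_apply, LinearMap.flip_apply,
          LinearMap.flip_apply, ractT_tmul _ _ _ _ rfl, ractT_tmul _ _ _ _ rfl,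
          ractT_tmul _ _ _ _ (by omega : q + jl = q + j + l), X.ract_mul _ _ h₃]
      exact LinearMap.congr_fun this z)
    (fun {i j n} h z a => by
      have : dT L X n ∘ₗ (ractT L X h).flip a =
          (ractT L X (by omega : i + 1 + j = n + 1)).flip a ∘ₗ dT L X i +
          i.negOnePow • (ractT L X (by omega : i + (j + 1) = n + 1)).flip
            ((A.V.d j (j + 1)).hom a) := by
        apply hom_ext
        intro p q hpq x y
        simp only [LinearMap.comp_apply, LinearMap.add_apply, LinearMap.smul_apply,
          LinearMap.flip_apply, Units.smul_def]
        rw [ractT_tmul _ _ _ _ rfl, dT_tmul, dT_tmul, X.d_ract' rfl rfl rfl rfl,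
          ractT_tmul _ _ _ _ (by omega : q + (j + 1) = q + j + 1)]
        simp only [map_add, LinearMap.add_apply, Units.smul_def, map_zsmul, LinearMap.smul_apply,
          smul_add, smul_smul]
        rw [ractT_tmul _ _ _ _ rfl, ractT_tmul _ _ _ _ (by omega : q + 1 + j = q + j + 1)]
        have hi : i.negOnePow = p.negOnePow * q.negOnePow := by rw [← hpq, Int.negOnePow_add]
        simp only [hi, Units.val_mul]
        abel
      exact LinearMap.congr_fun this z)

lemma tensor_d (L : DGModule A) (X : DGBimodule A) (n : ℤ) :
    ((L.tensor X).V.d n (n + 1)).hom = dT L X n :=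
  DGVect.of_d_hom (fun n => ModuleCat.of k (T L X n)) (fun n => ModuleCat.ofHom (dT L X n))
    (fun n => by rw [← ModuleCat.ofHom_comp, dT_dT]; rfl) n

/-- The map `f ⊗ X : L ⊗_A X → L' ⊗_A X` induced by a cochain `f`, `x ⊗ y ↦ f x ⊗ y`, in each
degree. -/
noncomputable def tensorMapT {L L' : DGModule A} (X : DGBimodule A) {n : ℤ}
    (f : linCochain L L' n) {p q : ℤ} (hpq : p + n = q) : T L X p →ₗ[k] T L' X q :=
  lift (fun i j h => (tmul L' X (by omega : i + n + j = q)).comp (f.1.v i (i + n) rfl).hom)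
    (by
      intro i j l ij jl h₁ h₂ h₃ h₄ x a y
      simp only [LinearMap.comp_apply]
      rw [f.2 i (i + n) ij (ij + n) j rfl rfl h₁,
        tmul_balanced (by omega : i + n + j = ij + n) _ h₃ (by omega)])

lemma tensorMapT_tmul {L L' : DGModule A} (X : DGBimodule A) {n : ℤ}
    (f : linCochain L L' n) {p q i i' j : ℤ} (hpq : p + n = q) (h : i + j = p) (hi : i + n = i')
    (x : L.V.X i) (y : X.V.X j) :
    tensorMapT X f hpq (tmul L X h x y) =
      tmul L' X (by omega : i' + j = q) ((f.1.v i i' hi).hom x) y := by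
  subst hi
  unfold tensorMapT
  rw [lift_tmul]
  rfl

/-- The `A`-linear cochain `f ⊗ X : L ⊗_A X → L' ⊗_A X` induced by an `A`-linear cochain `f`. -/
noncomputable def tensorMap {L L' : DGModule A} (X : DGBimodule A) {n : ℤ}
    (f : linCochain L L' n) : linCochain (L.tensor X) (L'.tensor X) n :=
  ⟨Cochain.mk fun p q hpq => ModuleCat.ofHom (tensorMapT X f hpq), by
    intro p q p' q' i hpq hpq' h z a
    have : tensorMapT X f hpq' ∘ₗ (ractT L X h).flip a =
        (ractT L' X (by omega : q + i = q')).flip a ∘ₗ tensorMapT X f hpq := by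
      apply hom_ext
      intro r s hrs x y
      rw [LinearMap.comp_apply, LinearMap.comp_apply, LinearMap.flip_apply, LinearMap.flip_apply,
        ractT_tmul _ _ _ _ rfl, tensorMapT_tmul _ _ _ _ rfl, tensorMapT_tmul _ _ _ _ rfl,
        ractT_tmul _ _ _ _ rfl]
    exact LinearMap.congr_fun this z⟩

end DGModule

namespace DGBimodule

open DGTensor

variable {k : Type u} [Field k] {A : DGAlgebra k}

/-- The left action `a (x ⊗ y) = a x ⊗ y` on `M ⊗_A X`. -/
noncomputable def lactT (M X : DGBimodule A) {l m n : ℤ} (h : l + m = n) :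
    A.V.X l →ₗ[k] T M.toDGModule X m →ₗ[k] T M.toDGModule X n :=
  (lift (L := M.toDGModule) (X := X) (W := A.V.X l →ₗ[k] T M.toDGModule X n)
    (fun i j hij => LinearMap.mk₂ k
      (fun x y => ((tmul M.toDGModule X (by omega : l + i + j = n)).flip y).comp
        ((M.lact rfl).flip x))
      (by intros; ext; simp) (by intros; ext; simp) (by intros; ext; simp) (by intros; ext; simp))
    (by
      intro i j l' ij jl h₁ h₂ h₃ h₄ x a y
      apply LinearMap.ext
      intro b
      change tmul M.toDGModule X _ (M.lact rfl b (M.ract h₁ x a)) y =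
        tmul M.toDGModule X _ (M.lact rfl b x) (X.lact h₃ a y)
      rw [← tmul_balanced (by omega : l + i + j = l + ij) (by omega) h₃,
        M.lact_ract rfl _ h₁ rfl])).flip

lemma lactT_tmul (M X : DGBimodule A) {i j l m n li : ℤ} (hij : i + j = m) (h : l + m = n)
    (hli : l + i = li) (a : A.V.X l) (x : M.V.X i) (y : X.V.X j) :
    lactT M X h a (tmul M.toDGModule X hij x y) =
      tmul M.toDGModule X (by omega : li + j = n) (M.lact hli a x) y := by
  subst hli
  unfold lactT
  rw [LinearMap.flip_apply, lift_tmul]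
  rfl

/-- The tensor product `M ⊗_A X` of dg bimodules. -/
noncomputable def tensor (M X : DGBimodule A) : DGBimodule A where
  toDGModule := M.toDGModule.tensor X
  lact h := lactT M X h
  one_lact {i} z := by
    have : lactT M X (zero_add i) A.one = LinearMap.id := by
      apply hom_ext
      intro p q h x y
      rw [lactT_tmul _ _ _ _ (zero_add p), M.one_lact]
      rfl
    exact LinearMap.congr_fun this z
  mul_lact {i j l ij jl n} h₁ h₂ h₃ h₄ a b z := by
    have : lactT M X h₂ (A.mul h₁ a b) = lactT M X h₄ a ∘ₗ lactT M X h₃ b := by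
      apply hom_ext
      intro p q h x y
      rw [LinearMap.comp_apply, lactT_tmul _ _ _ _ rfl, lactT_tmul _ _ _ _ rfl,
        lactT_tmul _ _ _ _ (by omega : i + (j + p) = ij + p), M.mul_lact h₁ rfl rfl (by omega)]
    exact LinearMap.congr_fun this z
  d_lact {i j n} h a z := by
    have : dT M.toDGModule X n ∘ₗ lactT M X h a =
        lactT M X (by omega : i + 1 + j = n + 1) ((A.V.d i (i + 1)).hom a) +
        i.negOnePow • lactT M X (by omega : i + (j + 1) = n + 1) a ∘ₗ dT M.toDGModule X j := by
      apply hom_ext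
      intro p q hpq x y
      simp only [LinearMap.comp_apply, LinearMap.add_apply, LinearMap.smul_apply, Units.smul_def]
      rw [lactT_tmul _ _ _ _ rfl, lactT_tmul _ _ _ _ (by omega : i + 1 + p = i + p + 1), dT_tmul,
        dT_tmul,
        M.d_lact' rfl rfl rfl rfl]
      simp only [map_add, LinearMap.add_apply, Units.smul_def, map_zsmul, LinearMap.smul_apply,
        smul_add, smul_smul]
      rw [lactT_tmul _ _ _ _ (by omega : i + (p + 1) = i + p + 1), lactT_tmul _ _ _ _ rfl]
      simp only [Int.negOnePow_add, Units.val_mul]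
      abel
    have h' := LinearMap.congr_fun this z
    rw [DGModule.tensor_d, DGModule.tensor_d]
    exact h'
  lact_ract {i j l ij jl n} h₁ h₂ h₃ h₄ a z b := by
    have : (ractT M.toDGModule X h₂).flip b ∘ₗ lactT M X h₁ a =
        lactT M X h₄ a ∘ₗ (ractT M.toDGModule X h₃).flip b := by
      apply hom_ext
      intro p q h x y
      rw [LinearMap.comp_apply, LinearMap.comp_apply, LinearMap.flip_apply, LinearMap.flip_apply,
        lactT_tmul _ _ _ _ rfl, ractT_tmul _ _ _ _ rfl, ractT_tmul _ _ _ _ rfl,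
        lactT_tmul _ _ _ _ rfl]
    exact LinearMap.congr_fun this z

end DGBimodule

/-! ### Invertible bimodules and twisted symmetric dg algebras -/

namespace DGBimodule

variable {k : Type u} [Field k] {A : DGAlgebra k}

/-- `Z` is a derived tensor product `X ⊗^L_A Y` in `D(A^e)`: one has `X' ⊗_A Y ≃ Z` for some
resolution `X' ≃ X` which is K-projective as a right dg module. -/
def IsDerivedTensor (X Y Z : DGBimodule A) : Prop :=
  ∃ X' : DGBimodule A, X'.toDGModule.IsKProjective ∧ QIso X' X ∧ QIso (X'.tensor Y) Z

/-- `X` is invertible: `X ⊗^L_A Y ≃ A ≃ Y ⊗^L_A X` for some bimodule `Y`. -/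
def IsInvertible (X : DGBimodule A) : Prop :=
  ∃ Y : DGBimodule A, IsDerivedTensor X Y A.diagonal ∧ IsDerivedTensor Y X A.diagonal

end DGBimodule

namespace DGAlgebra

variable {k : Type u} [Field k] (A : DGAlgebra k)

/-- `A` is twisted symmetric if `A^*` is an invertible bimodule. -/
def IsTwistedSymmetric : Prop := A.diagonal.dual.IsInvertible

/-- `A` is (derived) `d`-symmetric if `A^* ≃ A[d]` as bimodules. -/
def IsSymmetric (d : ℤ) : Prop := DGBimodule.QIso A.diagonal.dual (A.diagonal.shift d)

end DGAlgebra

/-! ### Dg bifunctors and Calabi-Yau structures -/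

open DGModule

/-- The objects of the dg enhancement of the full subcategory of `D(A)` on the dg modules
satisfying `P`: the K-projective dg modules satisfying `P`. The morphism complexes are the
`homComplex`es. -/
structure DGObj {k : Type u} [Field k] {A : DGAlgebra k} (P : DGModule A → Prop) where
  M : DGModule A
  prop : P M
  kproj : M.IsKProjective

namespace DGModule

variable {k : Type u} [Field k] {A : DGAlgebra k}

/-- The identity cochain. -/
noncomputable def linId (M : DGModule A) : linCochain M M 0 :=
  ⟨Cochain.ofHom (𝟙 M.V), by
    intro p q p' q' i hpq hpq' h x a
    obtain rfl : p = q := by omega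
    obtain rfl : p' = q' := by omega
    simp⟩

lemma linId_v_hom (M : DGModule A) (p : ℤ) (x : M.V.X p) :
    (M.linId.1.v p p (add_zero p)).hom x = x := by
  simp [linId]

/-- The composition `g ∘ f` of `A`-linear cochains, as a bilinear map in `f` and `g`. -/
noncomputable def linComp (L M N : DGModule A) {p q n : ℤ} (h : p + q = n) :
    linCochain L M p →ₗ[k] linCochain M N q →ₗ[k] linCochain L N n :=
  LinearMap.mk₂ k (fun f g => ⟨f.1.comp g.1 h, comp_mem_linCochain h f.2 g.2⟩)
    (by intros; ext1; simp) (by intros; ext1; simp)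
    (by intros; ext1; simp) (by intros; ext1; simp)

lemma linComp_v_hom {L M N : DGModule A} {p q n : ℤ} (h : p + q = n) (f : linCochain L M p)
    (g : linCochain M N q) {i j l : ℤ} (hij : i + p = j) (hjl : j + q = l) (x : L.V.X i) :
    ((linComp L M N h f g).1.v i l (by omega)).hom x =
      (g.1.v j l hjl).hom ((f.1.v i j hij).hom x) := by
  change ((f.1.comp g.1 h).v i l _).hom x = _
  rw [Cochain.comp_v f.1 g.1 h i j l hij hjl]
  rfl

lemma linδ_v_hom {M N : DGModule A} {n : ℤ} (f : linCochain M N n) {p q p' q' : ℤ}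
    (hpq : p + (n + 1) = q) (hp : p + 1 = p') (hq : q' + 1 = q) (x : M.V.X p) :
    ((linδ M N n (n + 1) f).1.v p q hpq).hom x =
      (N.V.d q' q).hom ((f.1.v p q' (by omega)).hom x) +
      (n + 1).negOnePow • (f.1.v p' q (by omega)).hom ((M.V.d p p').hom x) := by
  change ((δ n (n + 1) f.1).v p q _).hom x = _
  rw [δ_v n (n + 1) rfl f.1 p q hpq q' p' (by omega) hp]
  simp [Units.smul_def]

lemma linComp_id {M N : DGModule A} {p : ℤ} (f : linCochain M N p) :
    linComp M N N (add_zero p) f N.linId = f :=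
  Subtype.ext (Cochain.comp_id f.1)

lemma id_linComp {M N : DGModule A} {p : ℤ} (f : linCochain M N p) :
    linComp M M N (zero_add p) M.linId f = f :=
  Subtype.ext (Cochain.id_comp f.1)

lemma linComp_assoc {K L M N : DGModule A} {p q r pq qr n : ℤ} (h₁ : p + q = pq)
    (h₂ : q + r = qr) (h₃ : pq + r = n) (h₄ : p + qr = n) (f : linCochain K L p)
    (g : linCochain L M q) (h : linCochain M N r) :
    linComp K M N h₃ (linComp K L M h₁ f g) h = linComp K L N h₄ f (linComp L M N h₂ g h) :=
  Subtype.ext (Cochain.comp_assoc f.1 g.1 h.1 h₁ h₂ (by omega))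

lemma linδ_linComp {L M N : DGModule A} {p q n : ℤ} (h : p + q = n) (f : linCochain L M p)
    (g : linCochain M N q) :
    linδ L N n (n + 1) (linComp L M N h f g) =
      linComp L M N (by omega : p + (q + 1) = n + 1) f (linδ M N q (q + 1) g) +
      q.negOnePow • linComp L M N (by omega : p + 1 + q = n + 1) (linδ L M p (p + 1) f) g :=
  Subtype.ext (δ_comp f.1 g.1 h (p + 1) (q + 1) (n + 1) rfl rfl rfl)

open DGTensor in
lemma linCochain_tensor_ext {L N : DGModule A} {X : DGBimodule A} {n : ℤ}
    {f g : linCochain (L.tensor X) N n}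
    (h : ∀ (p q i j : ℤ) (hpq : p + n = q) (hij : i + j = p) (x : L.V.X i) (y : X.V.X j),
      (f.1.v p q hpq).hom (tmul L X hij x y) = (g.1.v p q hpq).hom (tmul L X hij x y)) :
    f = g := by
  apply Subtype.ext
  apply Cochain.ext
  intro p q hpq
  apply ModuleCat.hom_ext
  exact hom_ext fun i j hij x y => h p q i j hpq hij x y

open DGTensor in
lemma tensorMap_tmul {L L' : DGModule A} (X : DGBimodule A) {n : ℤ}
    (f : linCochain L L' n) {p q i i' j : ℤ} (hpq : p + n = q) (h : i + j = p) (hi : i + n = i')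
    (x : L.V.X i) (y : X.V.X j) :
    ((tensorMap X f).1.v p q hpq).hom (tmul L X h x y) =
      tmul L' X (by omega : i' + j = q) ((f.1.v i i' hi).hom x) y :=
  tensorMapT_tmul X f hpq h hi x y

/-- `f ⊗ X` as a linear function of `f`. -/
noncomputable def tensorMapₗ {L L' : DGModule A} (X : DGBimodule A) {n : ℤ} :
    linCochain L L' n →ₗ[k] linCochain (L.tensor X) (L'.tensor X) n where
  toFun := tensorMap X
  map_add' f g := linCochain_tensor_ext fun p q i j hpq hij x y => by
    refine (tensorMap_tmul X (f + g) hpq hij rfl x y).trans ?_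
    refine Eq.trans ?_ (congrArg₂ (· + ·) (tensorMap_tmul X f hpq hij rfl x y).symm
      (tensorMap_tmul X g hpq hij rfl x y).symm)
    simp
    rfl
  map_smul' c f := linCochain_tensor_ext fun p q i j hpq hij x y => by
    refine (tensorMap_tmul X (c • f) hpq hij rfl x y).trans ?_
    refine Eq.trans ?_ (congrArg (c • ·) (tensorMap_tmul X f hpq hij rfl x y).symm)
    simp
    rfl

lemma tensorMapₗ_id {L : DGModule A} (X : DGBimodule A) :
    tensorMapₗ X L.linId = (L.tensor X).linId :=
  linCochain_tensor_ext fun p q i j hpq hij x y => by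
    obtain rfl : p = q := by omega
    refine (tensorMap_tmul X L.linId hpq hij (add_zero i) x y).trans ?_
    rw [linId_v_hom L i x]
    exact (linId_v_hom (L.tensor X) p _).symm

lemma tensorMapₗ_comp {L L' L'' : DGModule A} (X : DGBimodule A) {p q n : ℤ} (h : p + q = n)
    (f : linCochain L L' p) (g : linCochain L' L'' q) :
    tensorMapₗ X (linComp L L' L'' h f g) =
      linComp (L.tensor X) (L'.tensor X) (L''.tensor X) h (tensorMapₗ X f) (tensorMapₗ X g) :=
  linCochain_tensor_ext fun r s i j hrs hij x y => by
    refine (tensorMap_tmul X _ hrs hij rfl x y).trans ?_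
    refine Eq.trans ?_ (linComp_v_hom h (tensorMap X f) (tensorMap X g) (rfl : r + p = r + p)
      (by omega : r + p + q = s) _).symm
    rw [linComp_v_hom h f g (rfl : i + p = i + p) (by omega)]
    refine ((congrArg _ (tensorMap_tmul X f rfl hij rfl x y)).trans
      (tensorMap_tmul X g (by omega) (by omega) (by omega) _ y)).symm

open DGTensor in
lemma linδ_tensorMapT_aux {L L' : DGModule A} (X : DGBimodule A) {n : ℤ} (f : linCochain L L' n)
    {p q i j : ℤ} (hpq : p + n = q) (hpq' : p + 1 + n = q + 1) (hij : i + j = p)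
    (x : L.V.X i) (y : X.V.X j) :
    dT L' X q (tensorMapT X f hpq (tmul L X hij x y)) +
      (n + 1).negOnePow • tensorMapT X f hpq' (dT L X p (tmul L X hij x y)) =
    tmul L' X (by omega : i + (n + 1) + j = q + 1)
      (((linδ L L' n (n + 1) f).1.v i (i + (n + 1)) rfl).hom x) y := by
  rw [linδ_v_hom f rfl rfl (by omega : i + n + 1 = i + (n + 1)), dT_tmul, map_add,
    Units.smul_def i.negOnePow, map_zsmul, tensorMapT_tmul _ _ _ _ rfl,
    tensorMapT_tmul _ _ _ _ (by omega : i + 1 + n = i + (n + 1)),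
    tensorMapT_tmul _ _ _ _ rfl, dT_tmul' L' X _ (by omega : i + n + 1 = i + (n + 1)) rfl]
  rcases Int.even_or_odd i with hi | hi <;> rcases Int.even_or_odd n with hn | hn <;>
    simp [Int.negOnePow_add, Int.negOnePow_even, Int.negOnePow_odd, hi, hn] <;> abel

open DGTensor in
lemma linδ_tensorMapₗ {L L' : DGModule A} (X : DGBimodule A) {n : ℤ} (f : linCochain L L' n) :
    linδ (L.tensor X) (L'.tensor X) n (n + 1) (tensorMapₗ X f) =
      tensorMapₗ X (linδ L L' n (n + 1) f) :=
  linCochain_tensor_ext fun p q i j hpq hij x y => by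
    refine Eq.trans ?_ (tensorMap_tmul X _ hpq hij rfl x y).symm
    obtain ⟨q, rfl⟩ : ∃ q', q = q' + 1 := ⟨q - 1, by omega⟩
    refine (linδ_v_hom (tensorMap X f) hpq rfl rfl _).trans ?_
    exact (congrArg₂ (fun φ ψ => φ (tensorMapT X f (by omega : p + n = q) (tmul L X hij x y)) +
      (n + 1).negOnePow • tensorMapT X f (by omega : p + 1 + n = q + 1) (ψ (tmul L X hij x y)))
      (tensor_d L' X q) (tensor_d L X p)).trans (linδ_tensorMapT_aux X f _ _ hij x y)

end DGModule

/-- Dg functors `𝓛ᵒᵖ ⊗ 𝓜 → C(k)`, `(L, M) ↦ F(L, M)`, where `𝓛` and `𝓜` are the dg categories of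
K-projective dg modules satisfying `P` and `Q` respectively. The functoriality is given by a left
action `g x` of cochains `g : M → M'` and a commuting right action `x f` of cochains
`f : L' → L`. -/
structure DGBifunctor {k : Type u} [Field k] {A : DGAlgebra k} (P Q : DGModule A → Prop) where
  obj : DGObj P → DGObj Q → DGVect k
  lact : ∀ {L : DGObj P} {M M' : DGObj Q} {p q n : ℤ}, p + q = n →
    (linCochain M.M M'.M p →ₗ[k] (obj L M).X q →ₗ[k] (obj L M').X n)
  ract : ∀ {L L' : DGObj P} {M : DGObj Q} {p q n : ℤ}, p + q = n →
    ((obj L M).X p →ₗ[k] linCochain L'.M L.M q →ₗ[k] (obj L' M).X n)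
  lact_id : ∀ {L : DGObj P} {M : DGObj Q} {q : ℤ} (x : (obj L M).X q),
    lact (zero_add q) M.M.linId x = x
  ract_id : ∀ {L : DGObj P} {M : DGObj Q} {p : ℤ} (x : (obj L M).X p),
    ract (add_zero p) x L.M.linId = x
  lact_comp : ∀ {L : DGObj P} {M M' M'' : DGObj Q} {p q r pq qr n : ℤ} (h₁ : q + p = pq)
    (h₂ : pq + r = n) (h₃ : q + r = qr) (h₄ : p + qr = n) (g' : linCochain M'.M M''.M p)
    (g : linCochain M.M M'.M q) (x : (obj L M).X r),
    lact h₂ (linComp M.M M'.M M''.M h₁ g g') x = lact h₄ g' (lact h₃ g x)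
  ract_comp : ∀ {L L' L'' : DGObj P} {M : DGObj Q} {p q r pq qr n : ℤ} (h₁ : p + q = pq)
    (h₂ : pq + r = n) (h₃ : r + q = qr) (h₄ : p + qr = n) (x : (obj L M).X p)
    (f : linCochain L'.M L.M q) (f' : linCochain L''.M L'.M r),
    ract h₂ (ract h₁ x f) f' = ract h₄ x (linComp L''.M L'.M L.M h₃ f' f)
  lact_ract : ∀ {L L' : DGObj P} {M M' : DGObj Q} {p q r pq qr n : ℤ} (h₁ : p + q = pq)
    (h₂ : pq + r = n) (h₃ : q + r = qr) (h₄ : p + qr = n) (g : linCochain M.M M'.M p)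
    (x : (obj L M).X q) (f : linCochain L'.M L.M r),
    ract h₂ (lact h₁ g x) f = lact h₄ g (ract h₃ x f)
  d_lact : ∀ {L : DGObj P} {M M' : DGObj Q} {p q n : ℤ} (h : p + q = n)
    (g : linCochain M.M M'.M p) (x : (obj L M).X q),
    ((obj L M').d n (n + 1)).hom (lact h g x) =
      lact (by omega : p + 1 + q = n + 1) (linδ M.M M'.M p (p + 1) g) x +
      p.negOnePow • lact (by omega : p + (q + 1) = n + 1) g (((obj L M).d q (q + 1)).hom x)
  d_ract : ∀ {L L' : DGObj P} {M : DGObj Q} {p q n : ℤ} (h : p + q = n)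
    (x : (obj L M).X p) (f : linCochain L'.M L.M q),
    ((obj L' M).d n (n + 1)).hom (ract h x f) =
      ract (by omega : p + 1 + q = n + 1) (((obj L M).d p (p + 1)).hom x) f +
      p.negOnePow • ract (by omega : p + (q + 1) = n + 1) x (linδ L'.M L.M q (q + 1) f)

namespace DGBifunctor

variable {k : Type u} [Field k] {A : DGAlgebra k} {P Q : DGModule A → Prop}

/-- Natural transformations of dg bifunctors (closed of degree zero). -/
structure Hom (F G : DGBifunctor P Q) where
  app : ∀ (L : DGObj P) (M : DGObj Q), F.obj L M ⟶ G.obj L M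
  map_lact : ∀ {L : DGObj P} {M M' : DGObj Q} {p q n : ℤ} (h : p + q = n)
    (g : linCochain M.M M'.M p) (x : (F.obj L M).X q),
    ((app L M').f n).hom (F.lact h g x) = G.lact h g (((app L M).f q).hom x)
  map_ract : ∀ {L L' : DGObj P} {M : DGObj Q} {p q n : ℤ} (h : p + q = n)
    (x : (F.obj L M).X p) (f : linCochain L'.M L.M q),
    ((app L' M).f n).hom (F.ract h x f) = G.ract h (((app L M).f p).hom x) f

/-- Two dg bifunctors are naturally quasi-isomorphic if they are related by a zigzag of natural
transformations all of whose components are quasi-isomorphisms. -/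
def NatQIso : DGBifunctor P Q → DGBifunctor P Q → Prop :=
  Relation.EqvGen fun F G => ∃ τ : Hom F G, ∀ L M, QuasiIso (τ.app L M)

/-- The bifunctor `(L, M) ↦ RHom_A(L, M)`. -/
noncomputable def rhom (P Q : DGModule A → Prop) : DGBifunctor P Q where
  obj L M := homComplex L.M M.M
  lact {L M M' p q n} h := (linComp L.M M.M M'.M (by omega : q + p = n)).flip
  ract {L L' M p q n} h := (linComp L'.M L.M M.M (by omega : q + p = n)).flip
  lact_id {L M q} (x : linCochain L.M M.M q) := linComp_id x
  ract_id {L M q} (x : linCochain L.M M.M q) := id_linComp x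
  lact_comp {L M M' M'' p q r pq qr n} h₁ h₂ h₃ h₄ g' g (x : linCochain L.M M.M r) :=
    (linComp_assoc (by omega) h₁ (by omega) (by omega) x g g').symm
  ract_comp {L L' L'' M p q r pq qr n} h₁ h₂ h₃ h₄ (x : linCochain L.M M.M p) f f' :=
    (linComp_assoc h₃ (by omega) (by omega) (by omega) f' f x).symm
  lact_ract {L L' M M' p q r pq qr n} h₁ h₂ h₃ h₄ g (x : linCochain L.M M.M q) f :=
    (linComp_assoc (by omega) (by omega) (by omega) (by omega) f x g).symm
  d_lact {L M M' p q n} h g (x : linCochain L.M M.M q) := linδ_linComp _ x g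
  d_ract {L L' M p q n} h (x : linCochain L.M M.M p) f := linδ_linComp _ f x

/-- The bifunctor `(L, M) ↦ RHom_A(L, M_X)`, where `M_X = M ⊗^L_A X`. -/
noncomputable def rhomTwist (P Q : DGModule A → Prop) (X : DGBimodule A) : DGBifunctor P Q where
  obj L M := homComplex L.M (M.M.tensor X)
  lact {L M M' p q n} h :=
    (linComp L.M (M.M.tensor X) (M'.M.tensor X) (by omega : q + p = n)).flip ∘ₗ tensorMapₗ X
  ract {L L' M p q n} h := (linComp L'.M L.M (M.M.tensor X) (by omega : q + p = n)).flip
  lact_id {L M q} (x : linCochain L.M (M.M.tensor X) q) := by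
    refine Eq.trans ?_ (linComp_id x)
    exact congrArg (fun g => linComp L.M (M.M.tensor X) (M.M.tensor X) (add_zero q) x g)
      (tensorMapₗ_id X)
  ract_id {L M q} (x : linCochain L.M (M.M.tensor X) q) := id_linComp x
  lact_comp {L M M' M'' p q r pq qr n} h₁ h₂ h₃ h₄ g' g
      (x : linCochain L.M (M.M.tensor X) r) := by
    refine Eq.trans ?_ (linComp_assoc (by omega) h₁ (by omega) (by omega) x (tensorMapₗ X g)
      (tensorMapₗ X g')).symm
    exact congrArg (fun g => linComp L.M (M.M.tensor X) (M''.M.tensor X) (by omega) x g)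
      (tensorMapₗ_comp X h₁ g g')
  ract_comp {L L' L'' M p q r pq qr n} h₁ h₂ h₃ h₄ (x : linCochain L.M (M.M.tensor X) p) f f' :=
    (linComp_assoc h₃ (by omega) (by omega) (by omega) f' f x).symm
  lact_ract {L L' M M' p q r pq qr n} h₁ h₂ h₃ h₄ g (x : linCochain L.M (M.M.tensor X) q) f :=
    (linComp_assoc (by omega) (by omega) (by omega) (by omega) f x (tensorMapₗ X g)).symm
  d_lact {L M M' p q n} h g (x : linCochain L.M (M.M.tensor X) q) := by
    refine (linδ_linComp (by omega) x (tensorMapₗ X g)).trans ?_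
    rw [linδ_tensorMapₗ]
    rfl
  d_ract {L L' M p q n} h (x : linCochain L.M (M.M.tensor X) p) f := linδ_linComp _ f x

/-- The left action `(g φ)(x) = (-1)^{|g|} φ (x g)` on the linear dual of a bifunctor. -/
noncomputable def dualLact (E : DGBifunctor Q P) {L : DGObj P} {M M' : DGObj Q} {p q n : ℤ}
    (h : p + q = n) : linCochain M.M M'.M p →ₗ[k] Module.Dual k ((E.obj M L).X (-q)) →ₗ[k]
      Module.Dual k ((E.obj M' L).X (-n)) :=
  LinearMap.mk₂ k
    (fun g φ => p.negOnePow • φ ∘ₗ (E.ract (by omega : -n + p = -q)).flip g)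
    (by intros; ext; simp [Units.smul_def]) (by intros; ext; simp [Units.smul_def]; ring)
    (by intros; ext; simp [Units.smul_def]) (by intros; ext; simp [Units.smul_def]; ring)

/-- The right action `(φ f)(x) = φ (f x)` on the linear dual of a bifunctor. -/
noncomputable def dualRact (E : DGBifunctor Q P) {L L' : DGObj P} {M : DGObj Q} {p q n : ℤ}
    (h : p + q = n) : Module.Dual k ((E.obj M L).X (-p)) →ₗ[k] linCochain L'.M L.M q →ₗ[k]
      Module.Dual k ((E.obj M L').X (-n)) :=
  LinearMap.mk₂ k (fun φ f => φ ∘ₗ E.lact (by omega : q + -n = -p) f)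
    (by intros; ext; simp) (by intros; ext; simp) (by intros; ext; simp) (by intros; ext; simp)

lemma dualLact_apply (E : DGBifunctor Q P) {L : DGObj P} {M M' : DGObj Q} {p q n : ℤ}
    (h : p + q = n) (g : linCochain M.M M'.M p) (φ : Module.Dual k ((E.obj M L).X (-q)))
    (x : (E.obj M' L).X (-n)) :
    E.dualLact h g φ x = p.negOnePow • φ (E.ract (by omega : -n + p = -q) x g) := rfl

lemma dualRact_apply (E : DGBifunctor Q P) {L L' : DGObj P} {M : DGObj Q} {p q n : ℤ}
    (h : p + q = n) (φ : Module.Dual k ((E.obj M L).X (-p))) (f : linCochain L'.M L.M q)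
    (x : (E.obj M L').X (-n)) :
    E.dualRact h φ f x = φ (E.lact (by omega : q + -n = -p) f x) := rfl

lemma d_lact' (F : DGBifunctor P Q) {L : DGObj P} {M M' : DGObj Q} {p q n p' q' n' : ℤ}
    (h : p + q = n) (hp : p + 1 = p') (hq : q + 1 = q') (hn : n + 1 = n')
    (g : linCochain M.M M'.M p) (x : (F.obj L M).X q) :
    ((F.obj L M').d n n').hom (F.lact h g x) =
      F.lact (by omega : p' + q = n') (linδ M.M M'.M p p' g) x +
      p.negOnePow • F.lact (by omega : p + q' = n') g (((F.obj L M).d q q').hom x) := by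
  subst hp hq hn
  exact F.d_lact h g x

lemma d_ract' (F : DGBifunctor P Q) {L L' : DGObj P} {M : DGObj Q} {p q n p' q' n' : ℤ}
    (h : p + q = n) (hp : p + 1 = p') (hq : q + 1 = q') (hn : n + 1 = n')
    (x : (F.obj L M).X p) (f : linCochain L'.M L.M q) :
    ((F.obj L' M).d n n').hom (F.ract h x f) =
      F.ract (by omega : p' + q = n') (((F.obj L M).d p p').hom x) f +
      p.negOnePow • F.ract (by omega : p + q' = n') x (linδ L'.M L.M q q' f) := by
  subst hp hq hn
  exact F.d_ract h x f

lemma dual_aux₁ (E : DGBifunctor Q P) {L : DGObj P} {M M' : DGObj Q} {p q n : ℤ}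
    (h : p + q = n) (g : linCochain M.M M'.M p) (φ : Module.Dual k ((E.obj M L).X (-q))) :
    ((E.obj M' L).dual.d n (n + 1)).hom (E.dualLact h g φ) =
      E.dualLact (by omega : p + 1 + q = n + 1) (linδ M.M M'.M p (p + 1) g) φ +
      p.negOnePow • E.dualLact (by omega : p + (q + 1) = n + 1) g
        (((E.obj M L).dual.d q (q + 1)).hom φ) := by
  apply LinearMap.ext
  intro (x : (E.obj M' L).X (-(n + 1)))
  have h1 := E.d_ract' (by omega : -(n + 1) + p = -(q + 1)) (by omega : -(n + 1) + 1 = -n) rfl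
    (by omega : -(q + 1) + 1 = -q) x g
  change (n + 1).negOnePow • p.negOnePow • φ (E.ract (by omega : -n + p = -q)
      (((E.obj M' L).d (-(n + 1)) (-n)).hom x) g) =
    (p + 1).negOnePow • φ (E.ract (by omega : -(n + 1) + (p + 1) = -q) x
      (linδ M.M M'.M p (p + 1) g)) +
    p.negOnePow • p.negOnePow • (q + 1).negOnePow • φ (((E.obj M L).d (-(q + 1)) (-q)).hom
      (E.ract (by omega : -(n + 1) + p = -(q + 1)) x g))
  rw [h1]
  subst h
  rcases Int.even_or_odd p with hi | hi <;> rcases Int.even_or_odd q with hj | hj <;>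
    simp [Int.negOnePow_add, Int.negOnePow_even, Int.negOnePow_odd, hi, hj]

lemma dual_aux₂ (E : DGBifunctor Q P) {L L' : DGObj P} {M : DGObj Q} {p q n : ℤ}
    (h : p + q = n) (φ : Module.Dual k ((E.obj M L).X (-p))) (f : linCochain L'.M L.M q) :
    ((E.obj M L').dual.d n (n + 1)).hom (E.dualRact h φ f) =
      E.dualRact (by omega : p + 1 + q = n + 1) (((E.obj M L).dual.d p (p + 1)).hom φ) f +
      p.negOnePow • E.dualRact (by omega : p + (q + 1) = n + 1) φ
        (linδ L'.M L.M q (q + 1) f) := by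
  apply LinearMap.ext
  intro (x : (E.obj M L').X (-(n + 1)))
  have h1 := E.d_lact' (by omega : q + -(n + 1) = -(p + 1)) rfl (by omega : -(n + 1) + 1 = -n)
    (by omega : -(p + 1) + 1 = -p) f x
  change (n + 1).negOnePow • φ (E.lact (by omega : q + -n = -p) f
      (((E.obj M L').d (-(n + 1)) (-n)).hom x)) =
    (p + 1).negOnePow • φ (((E.obj M L).d (-(p + 1)) (-p)).hom
      (E.lact (by omega : q + -(n + 1) = -(p + 1)) f x)) +
    p.negOnePow • φ (E.lact (by omega : (q + 1) + -(n + 1) = -p) (linδ L'.M L.M q (q + 1) f) x)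
  rw [h1]
  subst h
  rcases Int.even_or_odd p with hi | hi <;> rcases Int.even_or_odd q with hj | hj <;>
    simp [Int.negOnePow_add, Int.negOnePow_even, Int.negOnePow_odd, hi, hj]

lemma dual_aux₃ (E : DGBifunctor Q P) {L : DGObj P} {M : DGObj Q} {q : ℤ}
    (φ : Module.Dual k ((E.obj M L).X (-q))) :
    E.dualLact (zero_add q) M.M.linId φ = φ :=
  LinearMap.ext fun x => by
    rw [dualLact_apply, E.ract_id, Int.negOnePow_zero, one_smul]

lemma dual_aux₄ (E : DGBifunctor Q P) {L : DGObj P} {M M' M'' : DGObj Q} {p q r pq qr n : ℤ}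
    (h₁ : q + p = pq) (h₂ : pq + r = n) (h₃ : q + r = qr) (h₄ : p + qr = n)
    (g' : linCochain M'.M M''.M p) (g : linCochain M.M M'.M q)
    (φ : Module.Dual k ((E.obj M L).X (-r))) :
    E.dualLact h₂ (linComp M.M M'.M M''.M h₁ g g') φ = E.dualLact h₄ g' (E.dualLact h₃ g φ) :=
  LinearMap.ext fun x => by
    rw [dualLact_apply, dualLact_apply, dualLact_apply, smul_smul, ← Int.negOnePow_add,
      add_comm p q, h₁, E.ract_comp _ _ h₁]

lemma dual_aux₅ (E : DGBifunctor Q P) {L L' : DGObj P} {M M' : DGObj Q} {p q r pq qr n : ℤ}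
    (h₁ : p + q = pq) (h₂ : pq + r = n) (h₃ : q + r = qr) (h₄ : p + qr = n)
    (g : linCochain M.M M'.M p) (φ : Module.Dual k ((E.obj M L).X (-q)))
    (f : linCochain L'.M L.M r) :
    E.dualRact h₂ (E.dualLact h₁ g φ) f = E.dualLact h₄ g (E.dualRact h₃ φ f) :=
  LinearMap.ext fun x => by
    rw [dualRact_apply, dualLact_apply, dualLact_apply, dualRact_apply,
      E.lact_ract _ _ (by omega : -n + p = -qr)]

/-- The linear dual `(L, M) ↦ E(M, L)^*` of a dg bifunctor `E`. -/
noncomputable def dual (E : DGBifunctor Q P) : DGBifunctor P Q where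
  obj L M := (E.obj M L).dual
  lact h := E.dualLact h
  ract h := E.dualRact h
  lact_id φ := E.dual_aux₃ φ
  ract_id {L M p} (φ : Module.Dual k ((E.obj M L).X (-p))) := LinearMap.ext fun x =>
    congrArg φ (E.lact_id x)
  lact_comp h₁ h₂ h₃ h₄ g' g φ := E.dual_aux₄ h₁ h₂ h₃ h₄ g' g φ
  ract_comp {L L' L'' M p q r pq qr n} h₁ h₂ h₃ h₄ (φ : Module.Dual k ((E.obj M L).X (-p))) f f' :=
    LinearMap.ext fun x =>
      congrArg φ (E.lact_comp h₃ (by omega : qr + -n = -p) (by omega : r + -n = -pq)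
        (by omega) f f' x).symm
  lact_ract h₁ h₂ h₃ h₄ g φ f := E.dual_aux₅ h₁ h₂ h₃ h₄ g φ f
  d_lact h g φ := E.dual_aux₁ h g φ
  d_ract h φ f := E.dual_aux₂ h φ f

end DGBifunctor

section CalabiYau

variable {k : Type u} [Field k] {A : DGAlgebra k}

/-- The pair `(𝓛, 𝓜)` of full subcategories of `D(A)` has a Calabi-Yau structure twisted by the
bimodule `X`: there are natural quasi-isomorphisms `RHom_A(M, L_X)^* ≃ RHom_A(L, M)` for `L ∈ 𝓛`
and `M ∈ 𝓜`, as dg bifunctors. -/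
def HasTwistedCYBy (𝓛 𝓜 : DGModule A → Prop) (X : DGBimodule A) : Prop :=
  DGBifunctor.NatQIso (DGBifunctor.rhomTwist 𝓜 𝓛 X).dual (DGBifunctor.rhom 𝓛 𝓜)

/-- `𝓛` has a twisted Calabi-Yau structure. -/
def HasTwistedCY (𝓛 : DGModule A → Prop) : Prop :=
  ∃ X : DGBimodule A, X.IsInvertible ∧ HasTwistedCYBy 𝓛 𝓛 X

/-- `𝓛` has an `n`-Calabi-Yau structure. -/
def HasCY (𝓛 : DGModule A → Prop) (n : ℤ) : Prop :=
  HasTwistedCYBy 𝓛 𝓛 (A.diagonal.shift n)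

end CalabiYau

/-! ### Quasi-isomorphisms of complexes, in terms of cocycles -/

namespace DGVect

variable {k : Type u} [Field k]

/-! For proper `A` the bimodule `A^*` is, up to isomorphism in `D(A^e)`, the only possible twist:
`Perf A` always carries an `A^*`-twisted Calabi-Yau structure (`hasTwistedCYBy_dual`), and every `X`
that occurs as a twist satisfies `X ≃ A^*` (`HasTwistedCYBy.qIso_dual`). Both equivalences follow at
once: invertibility depends only on the class in `D(A^e)` (`DGBimodule.IsInvertible.of_qIso`), and a
twisted structure can be transported along `A^* ≃ A[d]`.

Existence. Put `L^∨ = Hom_A(L, A)`. The structure is the span of natural maps `Hom_A(L, M) ← M ⊗_A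
L^∨ → Hom_A(M, L ⊗_A A^*)^*`. The left map is an isomorphism for `M = A`, hence a quasi-isomorphism
for perfect K-projective `M` by dévissage (`quasiIso_veeHom`). The right map is biduality for `M ⊗_A
L^∨`, followed by the dual of `Hom_A(M, L ⊗_A A^*) → Hom_A(M, (L^∨)^*) ≅ (M ⊗_A L^∨)^*`. It is a
quasi-isomorphism (`quasiIso_serreHom`) because the evaluation `L ⊗_A A^* → (L^∨)^*` is one
(`quasiIso_evHom`) and because `M ⊗_A L^∨` has finite dimensional cohomology in each degree.
Properness enters only through such degreewise finiteness: it makes `A → A^{**}` a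
quasi-isomorphism, which gives `L^∨ ≃ (L ⊗_A A^*)^*` by tensor-Hom duality.

Dévissage. Perfect modules are generated through modules that need not be K-projective, so the
induction (`GradedFunctor.of_isPerfect`) requires a functor that preserves all acyclic modules.
Tensoring with `L^∨` is not known to do so. It is therefore replaced by tensoring with the bar
resolution of `L^∨`, which is K-flat (`preservesAcyclic_tensorRight_barRes`). For K-projective `M`
the resolution can be removed again, since K-projective modules are K-flat
(`IsKProjective.quasiIso_ltensorMap`).

Uniqueness. Evaluating the natural quasi-isomorphisms at `L = M = A`, where `A` acts through its
endomorphism algebra `A ≅ Hom_A(A, A)`, yields an isomorphism of bimodules `X^* ≃ A` in `D(A^e)`.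
Hence `X` has degreewise finite cohomology and `X ≃ X^{**} ≃ A^*`. -/

lemma acyclic_iff (V : DGVect k) : V.Acyclic ↔ ∀ (n : ℤ) (x : V.X (n + 1)),
    (V.d (n + 1) (n + 1 + 1)).hom x = 0 → ∃ y : V.X n, (V.d n (n + 1)).hom y = x := by
  have key (n : ℤ) : V.ExactAt (n + 1) ↔ ∀ x : V.X (n + 1),
      (V.d (n + 1) (n + 1 + 1)).hom x = 0 → ∃ y : V.X n, (V.d n (n + 1)).hom y = x := by
    rw [V.exactAt_iff' n (n + 1) (n + 1 + 1) (by simp) (by simp),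
      ShortComplex.moduleCat_exact_iff]
    rfl
  constructor
  · intro h n
    exact (key n).1 (h _)
  · intro h j
    obtain ⟨n, rfl⟩ : ∃ n, j = n + 1 := ⟨j - 1, by omega⟩
    exact (key n).2 (h n)

/-- Degrees are variables tied by equations, so that no casts are needed when the degrees are not
literally successors. -/
lemma exists_d_eq {V : DGVect k} (hV : V.Acyclic) {i j l : ℤ} (hij : i + 1 = j) (hjl : j + 1 = l)
    (x : V.X j) (hx : (V.d j l).hom x = 0) : ∃ y : V.X i, (V.d i j).hom y = x := by
  subst hij hjl
  exact (acyclic_iff V).1 hV _ x hx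

lemma map_d {V W : DGVect k} (f : V ⟶ W) (i j : ℤ) (x : V.X i) :
    (f.f j).hom ((V.d i j).hom x) = (W.d i j).hom ((f.f i).hom x) := by
  rw [← LinearMap.comp_apply, ← ModuleCat.hom_comp, ← f.comm]
  rfl

/-- A chain map is injective on the cohomology in the middle degree of `n, n + 1, n + 2`. -/
def CohInjective {V W : DGVect k} (f : V ⟶ W) : Prop :=
  ∀ (n : ℤ) (x : V.X (n + 1)) (w : W.X n), (V.d (n + 1) (n + 1 + 1)).hom x = 0 →
    (W.d n (n + 1)).hom w = (f.f (n + 1)).hom x → ∃ v : V.X n, (V.d n (n + 1)).hom v = x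

/-- A chain map is surjective on cohomology. -/
def CohSurjective {V W : DGVect k} (f : V ⟶ W) : Prop :=
  ∀ (n : ℤ) (y : W.X (n + 1)), (W.d (n + 1) (n + 1 + 1)).hom y = 0 →
    ∃ (x : V.X (n + 1)) (w : W.X n), (V.d (n + 1) (n + 1 + 1)).hom x = 0 ∧
      y = (f.f (n + 1)).hom x + (W.d n (n + 1)).hom w

/-- In the explicit model of homology as cocycles modulo coboundaries, the two conditions are the
injectivity and the surjectivity of the induced map, unwound on representatives. -/
lemma shortComplex_quasiIso_iff {S T : ShortComplex (ModuleCat.{u} k)} (φ : S ⟶ T) :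
    ShortComplex.QuasiIso φ ↔
      (∀ (x : S.X₂) (w : T.X₁), S.g.hom x = 0 → T.f.hom w = φ.τ₂.hom x →
        ∃ v : S.X₁, S.f.hom v = x) ∧
      (∀ y : T.X₂, T.g.hom y = 0 → ∃ (x : S.X₂) (w : T.X₁), S.g.hom x = 0 ∧
        y = φ.τ₂.hom x + T.f.hom w) := by
  let γ : ShortComplex.LeftHomologyMapData φ S.moduleCatLeftHomologyData
    T.moduleCatLeftHomologyData := default
  have hK (x : LinearMap.ker S.g.hom) :
      Subtype.val (p := fun y => y ∈ LinearMap.ker T.g.hom) (γ.φK.hom x) =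
      φ.τ₂.hom x := by
    have := congrArg (fun f => f.hom x) γ.commi
    exact this
  have hπ (x : LinearMap.ker S.g.hom) : γ.φH.hom ((LinearMap.range S.moduleCatToCycles).mkQ x) =
      (LinearMap.range T.moduleCatToCycles).mkQ (γ.φK.hom x) :=
    congrArg (fun f => f.hom x) γ.commπ
  rw [γ.quasiIso_iff, ConcreteCategory.isIso_iff_bijective]
  refine and_congr ?_ ?_
  · change Function.Injective γ.φH.hom ↔ _
    rw [← LinearMap.ker_eq_bot, LinearMap.ker_eq_bot']
    constructor
    · intro h x w hx hw
      have h1 := h ((LinearMap.range S.moduleCatToCycles).mkQ ⟨x, hx⟩) (by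
        rw [hπ]
        refine (Submodule.Quotient.mk_eq_zero _).2 ⟨w, Subtype.ext ?_⟩
        rw [hK]
        exact hw)
      obtain ⟨v, hv⟩ := (Submodule.Quotient.mk_eq_zero _).1 h1
      exact ⟨v, congrArg Subtype.val hv⟩
    · intro h z hz
      obtain ⟨⟨x, hx⟩, rfl⟩ := (LinearMap.range S.moduleCatToCycles).mkQ_surjective z
      rw [hπ] at hz
      obtain ⟨w, hw⟩ := (Submodule.Quotient.mk_eq_zero _).1 hz
      obtain ⟨v, hv⟩ := h x w hx ((congrArg Subtype.val hw).trans (hK _))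
      exact (Submodule.Quotient.mk_eq_zero _).2 ⟨v, Subtype.ext hv⟩
  · constructor
    · intro h y hy
      obtain ⟨z, hz⟩ := h ((LinearMap.range T.moduleCatToCycles).mkQ ⟨y, hy⟩)
      obtain ⟨⟨x, hx⟩, rfl⟩ := (LinearMap.range S.moduleCatToCycles).mkQ_surjective z
      have h2 := (hπ _).symm.trans hz
      obtain ⟨w, hw⟩ := (Submodule.Quotient.eq _).1 h2.symm
      refine ⟨x, w, hx, ?_⟩
      have h3 := congrArg Subtype.val hw
      have h4 : T.f.hom w = y - φ.τ₂.hom x := h3.trans (congrArg (y - ·) (hK ⟨x, hx⟩))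
      rw [h4]; abel
    · intro h z
      obtain ⟨⟨y, hy⟩, rfl⟩ := (LinearMap.range T.moduleCatToCycles).mkQ_surjective z
      obtain ⟨x, w, hx, hw⟩ := h y hy
      refine ⟨(LinearMap.range S.moduleCatToCycles).mkQ ⟨x, hx⟩, (hπ _).trans ?_⟩
      refine ((Submodule.Quotient.eq _).2 ⟨-w, Subtype.ext ?_⟩)
      change T.f.hom (-w) =
        Subtype.val (p := fun y => y ∈ LinearMap.ker T.g.hom) (γ.φK.hom ⟨x, hx⟩) - y
      rw [hK, hw, map_neg]
      abel

lemma quasiIso_iff {V W : DGVect k} (f : V ⟶ W) :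
    QuasiIso f ↔ CohInjective f ∧ CohSurjective f := by
  have key (n : ℤ) := (quasiIsoAt_iff' f n (n + 1) (n + 1 + 1) (by simp) (by simp)).trans
    (shortComplex_quasiIso_iff _)
  rw [_root_.quasiIso_iff]
  constructor
  · intro h
    exact ⟨fun n => ((key n).1 (h _)).1, fun n => ((key n).1 (h _)).2⟩
  · rintro ⟨h₁, h₂⟩ j
    obtain ⟨n, rfl⟩ : ∃ n, j = n + 1 := ⟨j - 1, by omega⟩
    exact (key n).2 ⟨h₁ n, h₂ n⟩

lemma quasiIso_of_bijective {V W : DGVect k} (f : V ⟶ W)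
    (hf : ∀ n, Function.Bijective (f.f n).hom) : QuasiIso f := by
  rw [quasiIso_iff]
  constructor
  · intro n x w hx hw
    obtain ⟨v, rfl⟩ := (hf n).2 w
    exact ⟨v, (hf (n + 1)).1 ((map_d f _ _ v).trans hw)⟩
  · intro n y hy
    obtain ⟨x, rfl⟩ := (hf (n + 1)).2 y
    refine ⟨x, 0, (hf (n + 1 + 1)).1 ?_, by simp⟩
    rw [map_d, hy, map_zero]

/-- Chain maps from linear maps in each degree. -/
@[simps]
noncomputable def mkHom {V W : DGVect k} (φ : ∀ n, V.X n →ₗ[k] W.X n)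
    (h : ∀ n x, φ (n + 1) ((V.d n (n + 1)).hom x) = (W.d n (n + 1)).hom (φ n x)) : V ⟶ W where
  f n := ModuleCat.ofHom (φ n)
  comm' i j hij := by
    obtain rfl : i + 1 = j := hij
    ext x
    exact (h i x).symm

/-! ### Mapping cones of complexes -/

section cone

variable {V W : DGVect k} (f : V ⟶ W)

/-- The differential of the mapping cone. -/
noncomputable def coneD (n : ℤ) :
    (W.X n × V.X (n + 1)) →ₗ[k] (W.X (n + 1) × V.X (n + 1 + 1)) :=
  LinearMap.prod ((W.d n (n + 1)).hom.coprod (f.f (n + 1)).hom)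
    (-(V.d (n + 1) (n + 1 + 1)).hom ∘ₗ LinearMap.snd k _ _)

lemma coneD_apply (n : ℤ) (y : W.X n) (x : V.X (n + 1)) :
    coneD f n (y, x) = ((W.d n (n + 1)).hom y + (f.f (n + 1)).hom x,
      -(V.d (n + 1) (n + 1 + 1)).hom x) := rfl

lemma coneD_sq (n : ℤ) : coneD f (n + 1) ∘ₗ coneD f n = 0 := by
  apply LinearMap.ext
  rintro ⟨y, x⟩
  rw [LinearMap.comp_apply, coneD_apply, coneD_apply]
  simp [DGVect.d_d, map_d]

/-- The mapping cone of a chain map. -/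
noncomputable def cone : DGVect k :=
  CochainComplex.of (fun n => ModuleCat.of k (W.X n × V.X (n + 1)))
    (fun n => ModuleCat.ofHom (coneD f n))
    (fun n => by rw [← ModuleCat.ofHom_comp, coneD_sq]; rfl)

lemma cone_d (n : ℤ) : ((cone f).d n (n + 1)).hom = coneD f n :=
  of_d_hom (fun n => ModuleCat.of k (W.X n × V.X (n + 1)))
    (fun n => ModuleCat.ofHom (coneD f n))
    (fun n => by rw [← ModuleCat.ofHom_comp, coneD_sq]; rfl) n

/-- The long exact sequence of the cone, argued on elements. A cocycle `(y, x)` records that `f x`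
is the coboundary of `-y`. Injectivity on cohomology makes `x` a coboundary, and surjectivity then
corrects `y`. -/
lemma cone_acyclic_iff : (cone f).Acyclic ↔ QuasiIso f := by
  rw [acyclic_iff, quasiIso_iff]
  have key (n : ℤ) : (∀ x : (cone f).X (n + 1), ((cone f).d (n + 1) (n + 1 + 1)).hom x = 0 →
      ∃ y, ((cone f).d n (n + 1)).hom y = x) ↔
      ∀ x : W.X (n + 1) × V.X (n + 1 + 1), coneD f (n + 1) x = 0 → ∃ y, coneD f n y = x := by
    rw [cone_d, cone_d]
    rfl
  simp only [key]
  constructor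
  · intro h
    constructor
    · intro n x w hx hw
      obtain ⟨m, rfl⟩ : ∃ m, n = m + 1 := ⟨n - 1, by omega⟩
      -- A relation `d w = f x` is the same as a cocycle `(w, -x)` of the cone.
      obtain ⟨⟨y₁, y₂⟩, hy⟩ := h m (w, -x) (by rw [coneD_apply]; simp [hx, hw])
      rw [coneD_apply] at hy
      exact ⟨y₂, neg_injective (congrArg Prod.snd hy)⟩
    · intro n y hy
      obtain ⟨⟨w, x⟩, hz⟩ := h n (y, 0) (by rw [coneD_apply]; simp [hy])
      rw [coneD_apply] at hz
      refine ⟨x, w, neg_eq_zero.1 (congrArg Prod.snd hz), ?_⟩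
      exact (congrArg Prod.fst hz).symm.trans (add_comm _ _)
  · rintro ⟨hi, hs⟩ n ⟨y, x⟩ h
    rw [coneD_apply] at h
    have h1 : (W.d (n + 1) (n + 1 + 1)).hom y + (f.f (n + 1 + 1)).hom x = 0 :=
      congrArg Prod.fst h
    have h2 : (V.d (n + 1 + 1) (n + 1 + 1 + 1)).hom x = 0 := neg_eq_zero.1 (congrArg Prod.snd h)
    -- With `d v = x`, the element `y + f v` is a cocycle. If it equals `f a + d w`, then `(w, a -
    -- v)` bounds `(y, x)`.
    obtain ⟨v, hv⟩ := hi (n + 1) x (-y) h2 (by rw [map_neg]; exact neg_eq_of_add_eq_zero_right h1)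
    obtain ⟨a, w, ha, hw⟩ := hs n (y + (f.f (n + 1)).hom v)
      (by rw [map_add, ← map_d, hv]; exact h1)
    refine ⟨(w, a - v), ?_⟩
    rw [coneD_apply]
    refine Prod.ext ?_ ?_
    · change _ + (f.f (n + 1)).hom (a - v) = y
      rw [map_sub, ← sub_eq_iff_eq_add.2 hw]
      abel
    · change -(V.d (n + 1) (n + 1 + 1)).hom (a - v) = x
      rw [map_sub, ha, hv]
      simp

end cone

lemma quasiIso_comp_iff_right {U V W : DGVect k} (f : U ⟶ V) (g : V ⟶ W) (hf : QuasiIso f) :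
    QuasiIso (f ≫ g) ↔ QuasiIso g := quasiIso_iff_comp_left f g

lemma quasiIso_comp_iff_left {U V W : DGVect k} (f : U ⟶ V) (g : V ⟶ W) (hg : QuasiIso g) :
    QuasiIso (f ≫ g) ↔ QuasiIso f := quasiIso_iff_comp_right f g

end DGVect

/-! ### Linear algebra of duals of three-term complexes -/

section LinearAlgebra

variable {k : Type*} [Field k] {V₁ V₂ V₃ W₁ W₂ W₃ : Type*}
  [AddCommGroup V₁] [AddCommGroup V₂] [AddCommGroup V₃] [AddCommGroup W₁] [AddCommGroup W₂]
  [AddCommGroup W₃] [Module k V₁] [Module k V₂] [Module k V₃] [Module k W₁] [Module k W₂]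
  [Module k W₃]

/-- Injectivity of `k` as a module over itself: a functional that kills `ker D` descends to the
range of `D` and extends from there. Exactness of duality is mostly used in this form. -/
lemma LinearMap.exists_dual_comp_eq (D : V₁ →ₗ[k] V₂) (φ : Module.Dual k V₁)
    (h : ∀ x, D x = 0 → φ x = 0) : ∃ ψ : Module.Dual k V₂, ψ ∘ₗ D = φ := by
  have : φ ∈ LinearMap.range D.dualMap := by
    rw [LinearMap.range_dualMap_eq_dualAnnihilator_ker, Submodule.mem_dualAnnihilator]
    exact fun x hx => h x hx
  exact this

variable (a : V₁ →ₗ[k] V₂) (b : V₂ →ₗ[k] V₃) (a' : W₁ →ₗ[k] W₂) (b' : W₂ →ₗ[k] W₃)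
  (f : V₂ →ₗ[k] W₂)

/-- Injectivity on cohomology says that an element of `ker b` which dies in `W₂ ⧸ range a'` is a
coboundary, hence killed by `φ`. So `φ` restricted to `ker b` factors through that quotient, giving
`ψ`; the difference `φ - ψ ∘ f` vanishes on `ker b` and hence factors through `b`. -/
lemma dual_cohSurjective
    (h : ∀ (x : V₂) (w : W₁), b x = 0 → a' w = f x → ∃ v, a v = x)
    (φ : Module.Dual k V₂) (hφ : φ ∘ₗ a = 0) :
    ∃ (ψ : Module.Dual k W₂) (χ : Module.Dual k V₃), ψ ∘ₗ a' = 0 ∧ φ = ψ ∘ₗ f + χ ∘ₗ b := by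
  obtain ⟨ψ, hψ⟩ := LinearMap.exists_dual_comp_eq
    ((LinearMap.range a').mkQ ∘ₗ f ∘ₗ (LinearMap.ker b).subtype)
    (φ ∘ₗ (LinearMap.ker b).subtype) (by
      rintro ⟨x, hx⟩ h0
      obtain ⟨w, hw⟩ := (Submodule.Quotient.mk_eq_zero _).1 h0
      obtain ⟨v, rfl⟩ := h x w hx hw
      exact LinearMap.congr_fun hφ v)
  obtain ⟨χ, hχ⟩ := LinearMap.exists_dual_comp_eq b (φ - (ψ ∘ₗ (LinearMap.range a').mkQ) ∘ₗ f) (by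
    intro x hx
    have := LinearMap.congr_fun hψ ⟨x, hx⟩
    exact sub_eq_zero.2 this.symm)
  refine ⟨ψ ∘ₗ (LinearMap.range a').mkQ, χ, ?_, by rw [hχ]; abel⟩
  rw [LinearMap.comp_assoc, LinearMap.range_mkQ_comp, LinearMap.comp_zero]

/-- It suffices that `ψ` kill `ker b'`; every element there is `f x + a' w` with `x` a cocycle, and
both summands are killed. -/
lemma dual_cohInjective (hf : ∀ y, b' y = 0 → ∃ (x : V₂) (w : W₁), b x = 0 ∧ y = f x + a' w)
    (ψ : Module.Dual k W₂) (χ : Module.Dual k V₃) (hψ : ψ ∘ₗ a' = 0) (h : χ ∘ₗ b = ψ ∘ₗ f) :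
    ∃ ω : Module.Dual k W₃, ω ∘ₗ b' = ψ := by
  apply LinearMap.exists_dual_comp_eq
  intro y hy
  obtain ⟨x, w, hx, rfl⟩ := hf y hy
  have h1 : ψ (a' w) = 0 := LinearMap.congr_fun hψ w
  have h2 : χ (b x) = ψ (f x) := LinearMap.congr_fun h x
  rw [map_add, h1, ← h2, hx, map_zero, add_zero]

/-- A cocycle `x` that is not a coboundary is separated from `range a` by a functional `φ`. Writing
`φ` as in the hypothesis forces `φ x = 0`. -/
lemma cohInjective_of_dual
    (h : ∀ φ : Module.Dual k V₂, φ ∘ₗ a = 0 →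
      ∃ (ψ : Module.Dual k W₂) (χ : Module.Dual k V₃), ψ ∘ₗ a' = 0 ∧ φ = ψ ∘ₗ f + χ ∘ₗ b)
    (x : V₂) (w : W₁) (hx : b x = 0) (hw : a' w = f x) : ∃ v, a v = x := by
  by_contra! hv
  obtain ⟨φ, hφx, hφ⟩ := Submodule.exists_le_ker_of_notMem (p := LinearMap.range a) (v := x)
    (by rintro ⟨v, hv'⟩; exact hv v hv')
  obtain ⟨ψ, χ, hψ, rfl⟩ := h φ (by ext v; exact hφ ⟨v, rfl⟩)
  apply hφx
  have h1 : ψ (a' w) = 0 := LinearMap.congr_fun hψ w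
  simp [hx, ← hw, h1]

lemma cohSurjective_of_dual
    (h : ∀ (ψ : Module.Dual k W₂) (χ : Module.Dual k V₃), ψ ∘ₗ a' = 0 → χ ∘ₗ b = ψ ∘ₗ f →
      ∃ ω : Module.Dual k W₃, ω ∘ₗ b' = ψ) (y : W₂) (hy : b' y = 0) :
    ∃ (x : V₂) (w : W₁), b x = 0 ∧ y = f x + a' w := by
  by_contra! hv
  obtain ⟨ψ, hψy, hψ⟩ := Submodule.exists_le_ker_of_notMem
    (p := (LinearMap.ker b).map f ⊔ LinearMap.range a') (v := y)
    (by
      intro hy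
      obtain ⟨_, ⟨x, hx, rfl⟩, _, ⟨w, rfl⟩, h⟩ := Submodule.mem_sup.1 hy
      exact hv x w hx h.symm)
  obtain ⟨χ, hχ⟩ := LinearMap.exists_dual_comp_eq b (ψ ∘ₗ f) (by
    intro x hx
    exact hψ (Submodule.mem_sup_left ⟨x, hx, rfl⟩))
  obtain ⟨ω, rfl⟩ := h ψ χ (by ext v; exact hψ (Submodule.mem_sup_right ⟨v, rfl⟩)) hχ
  exact hψy (by simp [hy])

/-- The cohomology of `V₁ → V₂ → V₃`. -/
abbrev Coh : Type _ := LinearMap.ker b ⧸ (LinearMap.range a).comap (LinearMap.ker b).subtype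

/-- The restriction of a cocycle of the dual to the cohomology. -/
noncomputable def cohRestrict :
    LinearMap.ker (LinearMap.lcomp k k a : Module.Dual k V₂ →ₗ[k] Module.Dual k V₁) →ₗ[k]
      Module.Dual k (Coh a b) where
  toFun φ := ((LinearMap.range a).comap (LinearMap.ker b).subtype).liftQ
    (φ.1 ∘ₗ (LinearMap.ker b).subtype) (by
      rintro ⟨_, _⟩ ⟨v, rfl⟩
      exact LinearMap.congr_fun φ.2 v)
  map_add' φ ψ := by ext; rfl
  map_smul' c φ := by ext; rfl

/-- A functional on the cohomology, pulled back to `ker b`, kills `ker b ∩ range a`. It therefore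
factors through the image of `ker b` in `V₂ ⧸ range a`, and extends to that quotient. -/
lemma cohRestrict_surjective : Function.Surjective (cohRestrict a b) := by
  intro η
  obtain ⟨φ, hφ⟩ := LinearMap.exists_dual_comp_eq
    ((LinearMap.range a).mkQ ∘ₗ (LinearMap.ker b).subtype)
    (η ∘ₗ ((LinearMap.range a).comap (LinearMap.ker b).subtype).mkQ) (by
      intro x hx
      have hx' : (Submodule.Quotient.mk x : Coh a b) = 0 :=
        (Submodule.Quotient.mk_eq_zero _).2
          ((Submodule.Quotient.mk_eq_zero (p := LinearMap.range a) (x := x.1)).1 hx)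
      exact (congrArg η hx').trans (map_zero _))
  refine ⟨⟨φ ∘ₗ (LinearMap.range a).mkQ, ?_⟩, ?_⟩
  · change (φ ∘ₗ (LinearMap.range a).mkQ) ∘ₗ a = 0
    rw [LinearMap.comp_assoc, LinearMap.range_mkQ_comp, LinearMap.comp_zero]
  · ext x
    exact LinearMap.congr_fun hφ x

lemma cohRestrict_eq_zero_iff (φ : LinearMap.ker (LinearMap.lcomp k k a)) :
    cohRestrict a b φ = 0 ↔ ∃ χ : Module.Dual k V₃, χ ∘ₗ b = φ.1 := by
  constructor
  · intro h
    apply LinearMap.exists_dual_comp_eq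
    intro x hx
    exact LinearMap.congr_fun h (Submodule.Quotient.mk ⟨x, hx⟩)
  · rintro ⟨χ, hχ⟩
    ext ⟨x, hx⟩
    refine (LinearMap.congr_fun hχ x).symm.trans ?_
    rw [LinearMap.comp_apply, hx, map_zero]
    rfl

/-- The cohomology of the dual is the dual of the cohomology. -/
noncomputable def cohDualEquiv : Coh (LinearMap.lcomp k k b : Module.Dual k V₃ →ₗ[k] _)
      (LinearMap.lcomp k k a : Module.Dual k V₂ →ₗ[k] _) ≃ₗ[k] Module.Dual k (Coh a b) :=
  (Submodule.quotEquivOfEq _ _ (by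
    ext φ
    rw [LinearMap.mem_ker, cohRestrict_eq_zero_iff]
    rfl)).trans ((cohRestrict a b).quotKerEquivOfSurjective (cohRestrict_surjective a b))

/-- For finite dimensional cohomology, a functional on the dual which vanishes on coboundaries is
on cocycles the evaluation at a cocycle. -/
lemma exists_eval_eq [Module.Finite k (Coh a b)] (ψ : Module.Dual k (Module.Dual k V₂))
    (hψ : ∀ χ : Module.Dual k V₃, ψ (χ ∘ₗ b) = 0) :
    ∃ x : V₂, b x = 0 ∧ ∀ φ : Module.Dual k V₂, φ ∘ₗ a = 0 → ψ φ = φ x := by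
  -- Composed with a linear section of the restriction map, `ψ` becomes an element of the double
  -- dual of the cohomology. This is finite dimensional, so it is the evaluation at a class.
  obtain ⟨σ, hσ⟩ := (cohRestrict a b).exists_rightInverse_of_surjective
    (LinearMap.range_eq_top.2 (cohRestrict_surjective a b))
  obtain ⟨z, hz⟩ := (Module.evalEquiv k (Coh a b)).surjective
    (ψ ∘ₗ (LinearMap.ker (LinearMap.lcomp k k a)).subtype ∘ₗ σ)
  obtain ⟨⟨x, hx⟩, rfl⟩ := Submodule.Quotient.mk_surjective _ z
  refine ⟨x, hx, fun φ (hφ : φ ∈ LinearMap.ker (LinearMap.lcomp k k a)) => ?_⟩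
  -- A cocycle `φ` and the section of its restriction differ by a coboundary of the dual, on which
  -- `ψ` vanishes.
  have h1 := ((cohRestrict a b).map_sub ⟨φ, hφ⟩ (σ (cohRestrict a b ⟨φ, hφ⟩))).trans
    (sub_eq_zero.2 (LinearMap.congr_fun hσ (cohRestrict a b ⟨φ, hφ⟩)).symm)
  obtain ⟨χ, hχ⟩ := (cohRestrict_eq_zero_iff a b _).1 h1
  have h2 := hψ χ
  rw [hχ] at h2
  have h3 : ψ φ = ψ (σ (cohRestrict a b ⟨φ, hφ⟩)).1 := by
    refine sub_eq_zero.1 ((ψ.map_sub _ _).symm.trans h2)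
  rw [h3]
  exact (LinearMap.congr_fun hz (cohRestrict a b ⟨φ, hφ⟩)).symm

end LinearAlgebra

/-! ### Graded duals of complexes and biduality -/

namespace DGVect

variable {k : Type u} [Field k]

lemma dual_d_eq (V : DGVect k) (i j : ℤ) (φ : Module.Dual k (V.X (-i))) :
    (V.dual.d i j).hom φ = j.negOnePow • (φ ∘ₗ (V.d (-j) (-i)).hom) := rfl

lemma dual_d_eq_zero_iff (V : DGVect k) (i j : ℤ) (φ : Module.Dual k (V.X (-i))) :
    (V.dual.d i j).hom φ = 0 ↔ φ ∘ₗ (V.d (-j) (-i)).hom = 0 := by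
  rw [dual_d_eq]
  exact smul_eq_zero_iff_eq _

/-- The transpose of a chain map. -/
noncomputable def dualMap {V W : DGVect k} (f : V ⟶ W) : W.dual ⟶ V.dual :=
  mkHom (fun n => (f.f (-n)).hom.dualMap) (fun n (φ : Module.Dual k (W.X (-n))) => by
    rw [dual_d_eq]
    refine LinearMap.ext fun x => ?_
    exact congrArg (fun y => (n + 1).negOnePow • φ y) (map_d f _ _ x).symm)

/-- Meant for negated degrees: the dual in degree `n` involves `V.X (-n)`, and `-(n + 1) + 1` is not
literally `-n`. -/
lemma CohInjective.exists_eq {V W : DGVect k} {f : V ⟶ W} (hf : CohInjective f) {i j l : ℤ}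
    (hij : i + 1 = j) (hjl : j + 1 = l) (x : V.X j) (w : W.X i) (hx : (V.d j l).hom x = 0)
    (hw : (W.d i j).hom w = (f.f j).hom x) : ∃ v : V.X i, (V.d i j).hom v = x := by
  subst hij hjl
  exact hf _ x w hx hw

lemma CohSurjective.exists_eq {V W : DGVect k} {f : V ⟶ W} (hf : CohSurjective f) {i j l : ℤ}
    (hij : i + 1 = j) (hjl : j + 1 = l) (y : W.X j) (hy : (W.d j l).hom y = 0) :
    ∃ (x : V.X j) (w : W.X i), (V.d j l).hom x = 0 ∧ y = (f.f j).hom x + (W.d i j).hom w := by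
  subst hij hjl
  exact hf _ y hy

lemma exists_neg_eq (i : ℤ) : ∃ j : ℤ, i = -j := ⟨-i, by simp⟩

/-- Over a field, duality is exact and reflects exactness, so each half of being a quasi-isomorphism
for `f` is equivalent to the other half for its transpose. The signs of the dual differential are
absorbed in the witnesses. -/
lemma quasiIso_dualMap_iff {V W : DGVect k} (f : V ⟶ W) :
    QuasiIso (dualMap f) ↔ QuasiIso f := by
  rw [quasiIso_iff, quasiIso_iff]
  constructor
  · rintro ⟨hi, hs⟩
    constructor
    · intro n
      suffices ∀ i j l : ℤ, i + 1 = j → j + 1 = l → ∀ (x : V.X j) (w : W.X i),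
          (V.d j l).hom x = 0 → (W.d i j).hom w = (f.f j).hom x →
          ∃ v : V.X i, (V.d i j).hom v = x from this _ _ _ rfl rfl
      intro i j l hij hjl
      -- Writing every degree as a negative makes functionals on `V.X (-j)` elements of the dual in
      -- degree `j`, without casts.
      obtain ⟨i, rfl⟩ := exists_neg_eq i
      obtain ⟨j, rfl⟩ := exists_neg_eq j
      obtain ⟨l, rfl⟩ := exists_neg_eq l
      apply cohInjective_of_dual
      intro φ hφ
      obtain ⟨ψ, χ, h1, h2⟩ := hs.exists_eq (i := l) (j := j) (l := i) (by omega) (by omega) φ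
        ((dual_d_eq_zero_iff V j i φ).2 hφ)
      -- The dual differential into degree `j` is `(-1)^j` times a transpose, so `χ` is rescaled by
      -- the same sign.
      exact ⟨ψ, j.negOnePow • χ, (dual_d_eq_zero_iff W j i ψ).1 h1, h2⟩
    · intro n
      suffices ∀ i j l : ℤ, i + 1 = j → j + 1 = l → ∀ y : W.X j, (W.d j l).hom y = 0 →
          ∃ (x : V.X j) (w : W.X i), (V.d j l).hom x = 0 ∧
            y = (f.f j).hom x + (W.d i j).hom w from this _ _ _ rfl rfl
      intro i j l hij hjl
      obtain ⟨i, rfl⟩ := exists_neg_eq i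
      obtain ⟨j, rfl⟩ := exists_neg_eq j
      obtain ⟨l, rfl⟩ := exists_neg_eq l
      apply cohSurjective_of_dual
      intro ψ χ hψ hχ
      obtain ⟨ω, hω⟩ := hi.exists_eq (i := l) (j := j) (l := i) (by omega) (by omega) ψ
        (j.negOnePow • χ) ((dual_d_eq_zero_iff W j i ψ).2 hψ) (by
          change j.negOnePow • ((j.negOnePow • χ) ∘ₗ (V.d (-j) (-l)).hom) = ψ ∘ₗ (f.f (-j)).hom
          rw [← hχ, LinearMap.smul_comp, smul_smul]
          simp)
      exact ⟨j.negOnePow • ω, hω⟩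
  · rintro ⟨hi, hs⟩
    constructor
    · intro n (ψ : Module.Dual k (W.X (-(n + 1)))) (χ : Module.Dual k (V.X (-n))) hψ hχ
      obtain ⟨ω, hω⟩ := dual_cohInjective (V.d (-(n + 1)) (-n)).hom
        (W.d (-(n + 1 + 1)) (-(n + 1))).hom (W.d (-(n + 1)) (-n)).hom (f.f (-(n + 1))).hom
        (fun y hy => hs.exists_eq (by omega) (by omega) y hy) ψ ((n + 1).negOnePow • χ)
        ((dual_d_eq_zero_iff W _ _ ψ).1 hψ) hχ
      refine ⟨(n + 1).negOnePow • ω, ?_⟩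
      change (n + 1).negOnePow • (((n + 1).negOnePow • ω) ∘ₗ (W.d (-(n + 1)) (-n)).hom) = ψ
      rw [← hω, LinearMap.smul_comp, smul_smul]
      simp
    · intro n (φ : Module.Dual k (V.X (-(n + 1)))) hφ
      obtain ⟨ψ, χ, h1, h2⟩ := dual_cohSurjective (V.d (-(n + 1 + 1)) (-(n + 1))).hom
        (V.d (-(n + 1)) (-n)).hom (W.d (-(n + 1 + 1)) (-(n + 1))).hom (f.f (-(n + 1))).hom
        (fun x w hx hw => hi.exists_eq (by omega) (by omega) x w hx hw) φ
        ((dual_d_eq_zero_iff V _ _ φ).1 hφ)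
      refine ⟨ψ, (n + 1).negOnePow • χ, (dual_d_eq_zero_iff W _ _ ψ).2 h1, ?_⟩
      change φ = ψ ∘ₗ (f.f (-(n + 1))).hom +
        (n + 1).negOnePow • (((n + 1).negOnePow • χ) ∘ₗ (V.d (-(n + 1)) (-n)).hom)
      rw [LinearMap.smul_comp, smul_smul, h2]
      simp

/-- The cohomology is finite dimensional in each degree. -/
def HasFiniteCoh (V : DGVect k) : Prop := ∀ n, Module.Finite k (V.homology n)

lemma hasFiniteCoh_of_quasiIso {V W : DGVect k} (f : V ⟶ W) (hf : QuasiIso f)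
    (hV : V.HasFiniteCoh) : W.HasFiniteCoh := fun n =>
  have := hV n
  Module.Finite.equiv (asIso (HomologicalComplex.homologyMap f n)).toLinearEquiv

lemma hasFiniteCoh_of_quasiIso' {V W : DGVect k} (f : V ⟶ W) (hf : QuasiIso f)
    (hW : W.HasFiniteCoh) : V.HasFiniteCoh := fun n =>
  have := hW n
  Module.Finite.equiv (asIso (HomologicalComplex.homologyMap f n)).toLinearEquiv.symm

lemma finite_homology_iff (V : DGVect k) {i j l : ℤ} (hij : i + 1 = j) (hjl : j + 1 = l) :
    Module.Finite k (V.homology j) ↔ Module.Finite k (Coh (V.d i j).hom (V.d j l).hom) := by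
  let e : V.homology j ≅ (V.sc' i j l).moduleCatLeftHomologyData.H :=
    (ShortComplex.homologyMapIso (V.isoSc' i j l (by simp; omega) (by simp; omega))).trans
      (V.sc' i j l).moduleCatHomologyIso
  have h : LinearMap.range (V.sc' i j l).moduleCatToCycles =
      (LinearMap.range (V.d i j).hom).comap (LinearMap.ker (V.d j l).hom).subtype := by
    ext x
    constructor
    · rintro ⟨y, rfl⟩
      exact ⟨y, rfl⟩
    · rintro ⟨y, hy⟩
      exact ⟨y, Subtype.ext hy⟩
  exact Module.Finite.equiv_iff (e.toLinearEquiv.trans (Submodule.quotEquivOfEq _ _ h))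

lemma range_units_smul {V₁ V₂ : Type u} [AddCommGroup V₁] [AddCommGroup V₂] [Module k V₁]
    [Module k V₂] (a : V₁ →ₗ[k] V₂) (c : ℤˣ) : LinearMap.range (c • a) = LinearMap.range a := by
  rcases Int.units_eq_one_or c with rfl | rfl
  · simp
  · rw [Units.neg_smul, one_smul]
    exact LinearMap.range_neg _

lemma ker_units_smul {V₁ V₂ : Type u} [AddCommGroup V₁] [AddCommGroup V₂] [Module k V₁]
    [Module k V₂] (a : V₁ →ₗ[k] V₂) (c : ℤˣ) : LinearMap.ker (c • a) = LinearMap.ker a := by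
  rcases Int.units_eq_one_or c with rfl | rfl
  · simp
  · rw [Units.neg_smul, one_smul]
    ext
    simp

lemma finite_coh_units_smul_iff {V₁ V₂ V₃ : Type u} [AddCommGroup V₁] [AddCommGroup V₂]
    [AddCommGroup V₃] [Module k V₁] [Module k V₂] [Module k V₃] (a : V₁ →ₗ[k] V₂)
    (b : V₂ →ₗ[k] V₃) (c c' : ℤˣ) :
    Module.Finite k (Coh (c • a) (c' • b)) ↔ Module.Finite k (Coh a b) := by
  unfold Coh
  rw [range_units_smul, ker_units_smul]

/-- The signs in the dual differential change neither kernels nor images, so the cohomology of the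
dual is the dual of the cohomology, and a vector space is finite dimensional exactly when its dual
is. -/
lemma finite_dual_homology_iff (V : DGVect k) (j : ℤ) :
    Module.Finite k (V.dual.homology j) ↔ Module.Finite k (V.homology (-j)) := by
  obtain ⟨i, hij⟩ : ∃ i, i + 1 = j := ⟨j - 1, by omega⟩
  obtain ⟨l, hjl⟩ : ∃ l, j + 1 = l := ⟨_, rfl⟩
  rw [V.dual.finite_homology_iff hij hjl,
    V.finite_homology_iff (by omega : -l + 1 = -j) (by omega : -j + 1 = -i)]
  exact (finite_coh_units_smul_iff (LinearMap.lcomp k k (V.d (-j) (-i)).hom)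
    (LinearMap.lcomp k k (V.d (-l) (-j)).hom) j.negOnePow l.negOnePow).trans
    ((Module.Finite.equiv_iff (cohDualEquiv _ _)).trans (Module.finite_dual_iff k))

lemma hasFiniteCoh_dual_iff (V : DGVect k) : V.dual.HasFiniteCoh ↔ V.HasFiniteCoh := by
  constructor
  · intro h n
    obtain ⟨n, rfl⟩ := exists_neg_eq n
    exact (finite_dual_homology_iff V n).1 (h n)
  · intro h n
    exact (finite_dual_homology_iff V n).2 (h _)

/-- The identification of the terms of a complex in equal degrees. -/
def castX (V : DGVect k) {i j : ℤ} (h : i = j) : V.X i →ₗ[k] V.X j :=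
  h ▸ LinearMap.id

@[simp]
lemma castX_rfl (V : DGVect k) {i : ℤ} (h : i = i) (x : V.X i) : V.castX h x = x := rfl

lemma d_castX (V : DGVect k) {i j i' j' : ℤ} (hi : i = i') (hj : j = j') (x : V.X i) :
    (V.d i' j').hom (V.castX hi x) = V.castX hj ((V.d i j).hom x) := by
  subst hi hj
  rfl

lemma castX_castX (V : DGVect k) {i j l : ℤ} (h : i = j) (h' : j = l) (x : V.X i) :
    V.castX h' (V.castX h x) = V.castX (h.trans h') x := by
  subst h h'
  rfl

/-- The canonical map to the double dual, with the sign `(-1)^|x|`. -/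
noncomputable def toBidual (V : DGVect k) : V ⟶ V.dual.dual :=
  -- The double dual differential out of degree `n` acquires `(-1)^(n+1)` and `(-1)^n` and is thus
  -- minus the double transpose of `d`. The alternating sign turns evaluation into a chain map.
  mkHom (fun n => n.negOnePow • (Module.Dual.eval k _ ∘ₗ V.castX (by omega : n = - -n)))
    (fun n x => by
      refine LinearMap.ext fun (φ : Module.Dual k (V.X (- -(n + 1)))) => ?_
      change (n + 1).negOnePow • φ (V.castX _ ((V.d n (n + 1)).hom x)) =
        (n + 1).negOnePow • n.negOnePow • ((-n).negOnePow •
          φ ((V.d (- -n) (- -(n + 1))).hom (V.castX (by omega : n = - -n) x)))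
      rw [d_castX V _ (by omega : n + 1 = - -(n + 1)), Int.negOnePow_neg, smul_smul n.negOnePow]
      simp)

lemma toBidual_apply (V : DGVect k) (n : ℤ) (x : V.X n) :
    (V.toBidual.f n).hom x = (n.negOnePow • Module.Dual.eval k _
      (V.castX (by omega : n = - -n) x) : Module.Dual k (Module.Dual k (V.X (- -n)))) := rfl

/-- Injectivity on cohomology holds without finiteness, by separating a cocycle from the
coboundaries. Surjectivity is reflexivity of the finite dimensional cohomology, in the form
`exists_eval_eq`. -/
lemma quasiIso_toBidual {V : DGVect k} (hV : V.HasFiniteCoh) : QuasiIso V.toBidual := by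
  rw [quasiIso_iff]
  constructor
  · intro n x (w : Module.Dual k (Module.Dual k (V.X (- -n)))) hx hw
    by_contra! hv
    obtain ⟨φ, hφx, hφ⟩ := Submodule.exists_le_ker_of_notMem
      (p := LinearMap.range (V.d n (n + 1)).hom) (v := x) (by rintro ⟨v, hv'⟩; exact hv v hv')
    apply hφx
    have h1 : (n + 1).negOnePow • w ((-n).negOnePow • ((φ ∘ₗ V.castX
        (by omega : - -(n + 1) = n + 1)) ∘ₗ (V.d (- -n) (- -(n + 1))).hom)) =
        (n + 1).negOnePow • φ (V.castX _ (V.castX _ x)) :=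
      LinearMap.congr_fun hw (φ ∘ₗ V.castX (by omega : - -(n + 1) = n + 1))
    have h2 : (φ ∘ₗ V.castX (by omega : - -(n + 1) = n + 1)) ∘ₗ
        (V.d (- -n) (- -(n + 1))).hom = 0 := by
      ext y
      change φ (V.castX _ ((V.d (- -n) (- -(n + 1))).hom y)) = 0
      rw [← d_castX V (by omega : - -n = n)]
      exact hφ ⟨_, rfl⟩
    rw [h2, smul_zero, map_zero, smul_zero, castX_castX, castX_rfl] at h1
    exact (smul_eq_zero_iff_eq _).1 h1.symm
  · intro n (ψ : Module.Dual k (Module.Dual k (V.X (- -(n + 1))))) hψ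
    have : Module.Finite k (Coh (V.d (- -n) (- -(n + 1))).hom
        (V.d (- -(n + 1)) (- -(n + 1 + 1))).hom) :=
      (V.finite_homology_iff (by omega) (by omega)).1 (hV _)
    have hψ' : ψ ∘ₗ (V.dual.d (-(n + 1 + 1)) (-(n + 1))).hom = 0 :=
      (dual_d_eq_zero_iff V.dual _ _ ψ).1 hψ
    obtain ⟨x, hx, hxψ⟩ := exists_eval_eq (V.d (- -n) (- -(n + 1))).hom
      (V.d (- -(n + 1)) (- -(n + 1 + 1))).hom ψ (fun χ => by
        have h1 : ψ ((-(n + 1)).negOnePow • (((-(n + 1)).negOnePow • χ) ∘ₗ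
            (V.d (- -(n + 1)) (- -(n + 1 + 1))).hom)) = 0 :=
          LinearMap.congr_fun hψ' ((-(n + 1)).negOnePow • χ)
        rw [LinearMap.smul_comp, smul_smul] at h1
        simpa using h1)
    -- `ψ` minus the evaluation at `x` vanishes on the cocycles of the dual, hence factors through
    -- its differential; this exhibits it as a coboundary of the double dual.
    obtain ⟨ω, hω⟩ := LinearMap.exists_dual_comp_eq (V.dual.d (-(n + 1)) (-n)).hom
      (ψ - Module.Dual.eval k _ x) (fun (φ : Module.Dual k (V.X (- -(n + 1)))) hφ =>
        sub_eq_zero.2 (hxψ φ ((dual_d_eq_zero_iff V _ _ φ).1 hφ)))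
    refine ⟨(n + 1).negOnePow • V.castX (by omega : - -(n + 1) = n + 1) x,
      (n + 1).negOnePow • ω, ?_, ?_⟩
    · rw [Units.smul_def, map_zsmul, d_castX V _ (by omega : - -(n + 1 + 1) = n + 1 + 1), hx,
        map_zero, smul_zero]
    · rw [toBidual_apply]
      have h1 : V.castX (by omega : n + 1 = - -(n + 1))
          ((n + 1).negOnePow • V.castX (by omega : - -(n + 1) = n + 1) x) =
          (n + 1).negOnePow • x := by
        rw [Units.smul_def, map_zsmul, castX_castX, castX_rfl, ← Units.smul_def]
      rw [h1]
      have h2 : (V.dual.dual.d n (n + 1)).hom ((n + 1).negOnePow • ω) =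
          ψ - Module.Dual.eval k _ x := by
        refine Eq.trans ?_ hω
        change (n + 1).negOnePow • (((n + 1).negOnePow • ω) ∘ₗ
          (V.dual.d (-(n + 1)) (-n)).hom) = _
        rw [LinearMap.smul_comp, smul_smul]
        simp
      rw [h2, Units.smul_def _ x, map_zsmul, ← Units.smul_def, smul_smul, Int.units_mul_self,
        one_smul]
      exact (add_sub_cancel _ _).symm

end DGVect

/-! ### Left dg modules and their duals -/

/-- A left dg module over `A`. -/
structure DGLeftModule {k : Type u} [Field k] (A : DGAlgebra k) where
  V : DGVect k
  lact : ∀ {i j n : ℤ}, i + j = n → (A.V.X i →ₗ[k] V.X j →ₗ[k] V.X n)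
  one_lact : ∀ {i : ℤ} (x : V.X i), lact (zero_add i) A.one x = x
  mul_lact : ∀ {i j l ij jl n : ℤ} (h₁ : i + j = ij) (h₂ : ij + l = n) (h₃ : j + l = jl)
    (h₄ : i + jl = n) (a : A.V.X i) (b : A.V.X j) (x : V.X l),
    lact h₂ (A.mul h₁ a b) x = lact h₄ a (lact h₃ b x)
  d_lact : ∀ {i j n : ℤ} (h : i + j = n) (a : A.V.X i) (x : V.X j),
    (V.d n (n + 1)).hom (lact h a x) =
      lact (by omega : (i + 1) + j = n + 1) ((A.V.d i (i + 1)).hom a) x +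
      i.negOnePow • lact (by omega : i + (j + 1) = n + 1) a ((V.d j (j + 1)).hom x)

namespace DGLeftModule

variable {k : Type u} [Field k] {A : DGAlgebra k}

/-- Morphisms of left dg modules. -/
structure Hom (M N : DGLeftModule A) where
  f : M.V ⟶ N.V
  map_lact : ∀ {i j n : ℤ} (h : i + j = n) (a : A.V.X i) (x : M.V.X j),
    (f.f n).hom (M.lact h a x) = N.lact h a ((f.f j).hom x)

lemma d_lact' (M : DGLeftModule A) {i j n i' j' n' : ℤ} (h : i + j = n) (hi : i + 1 = i')
    (hj : j + 1 = j') (hn : n + 1 = n') (a : A.V.X i) (x : M.V.X j) :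
    (M.V.d n n').hom (M.lact h a x) =
      M.lact (by omega : i' + j = n') ((A.V.d i i').hom a) x +
      i.negOnePow • M.lact (by omega : i + j' = n') a ((M.V.d j j').hom x) := by
  subst hi hj hn
  exact M.d_lact h a x

/-- The right action `(φ a)(x) = φ (a x)` on the linear dual. -/
noncomputable def dualRact (M : DGLeftModule A) {i j n : ℤ} (h : i + j = n) :
    Module.Dual k (M.V.X (-i)) →ₗ[k] A.V.X j →ₗ[k] Module.Dual k (M.V.X (-n)) :=
  LinearMap.mk₂ k (fun φ a => φ ∘ₗ M.lact (by omega : j + -n = -i) a)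
    (by intros; ext; simp) (by intros; ext; simp) (by intros; ext; simp) (by intros; ext; simp)

lemma dual_aux (M : DGLeftModule A) {i j n : ℤ} (h : i + j = n)
    (φ : Module.Dual k (M.V.X (-i))) (a : A.V.X j) :
    (M.V.dual.d n (n + 1)).hom (M.dualRact h φ a) =
      M.dualRact (by omega : i + 1 + j = n + 1) ((M.V.dual.d i (i + 1)).hom φ) a +
      i.negOnePow • M.dualRact (by omega : i + (j + 1) = n + 1) φ ((A.V.d j (j + 1)).hom a) := by
  apply LinearMap.ext
  intro (x : M.V.X (-(n + 1)))
  have h1 := M.d_lact' (by omega : j + -(n + 1) = -(i + 1)) rfl (by omega : -(n + 1) + 1 = -n)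
    (by omega : -(i + 1) + 1 = -i) a x
  change (n + 1).negOnePow • φ (M.lact (by omega : j + -n = -i) a
      ((M.V.d (-(n + 1)) (-n)).hom x)) =
    (i + 1).negOnePow • φ ((M.V.d (-(i + 1)) (-i)).hom
      (M.lact (by omega : j + -(n + 1) = -(i + 1)) a x)) +
    i.negOnePow • φ (M.lact (by omega : (j + 1) + -(n + 1) = -i) ((A.V.d j (j + 1)).hom a) x)
  rw [h1]
  subst h
  rcases Int.even_or_odd i with hi | hi <;> rcases Int.even_or_odd j with hj | hj <;>
    simp [Int.negOnePow_add, Int.negOnePow_even, Int.negOnePow_odd, hi, hj]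

/-- The linear dual of a left dg module, a right dg module. -/
noncomputable def dual (M : DGLeftModule A) : DGModule A where
  V := M.V.dual
  ract h := M.dualRact h
  ract_one {i} (φ : Module.Dual k (M.V.X (-i))) := LinearMap.ext fun x =>
    congrArg φ (M.one_lact x)
  ract_mul {i j l ij jl n} h₁ h₂ h₃ h₄ (φ : Module.Dual k (M.V.X (-i))) a b :=
    LinearMap.ext fun x =>
      congrArg φ (M.mul_lact h₃ (by omega : jl + -n = -i) (by omega : l + -n = -ij)
        (by omega) a b x).symm
  d_ract h φ a := M.dual_aux h φ a

/-- The transpose of a morphism of left dg modules. -/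
noncomputable def Hom.dual {M N : DGLeftModule A} (g : Hom M N) :
    DGModule.Hom N.dual M.dual where
  f := DGVect.dualMap g.f
  map_ract {i j n} h (φ : Module.Dual k (N.V.X (-i))) a := LinearMap.ext fun x =>
    congrArg φ (g.map_lact (by omega : j + -n = -i) a x).symm

end DGLeftModule

/-- The left dg module underlying a dg bimodule. -/
def DGBimodule.toLeft {k : Type u} [Field k] {A : DGAlgebra k} (X : DGBimodule A) :
    DGLeftModule A where
  V := X.V
  lact := X.lact
  one_lact := X.one_lact
  mul_lact := X.mul_lact
  d_lact := X.d_lact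

/-- The morphism of left dg modules underlying a morphism of dg bimodules. -/
def DGBimodule.Hom.toLeft {k : Type u} [Field k] {A : DGAlgebra k} {X Y : DGBimodule A}
    (g : DGBimodule.Hom X Y) : DGLeftModule.Hom X.toLeft Y.toLeft where
  f := g.f
  map_lact := g.map_lact

/-! ### Tensor products of right and left dg modules -/

namespace DGLeftTensor

variable {k : Type u} [Field k] {A : DGAlgebra k} (L : DGModule A) (X : DGLeftModule A)

/-- The degree `n` part of `L ⊗_k X`. -/
abbrev Pre (n : ℤ) : Type u :=
  DirectSum {p : ℤ × ℤ // p.1 + p.2 = n} fun p => L.V.X p.1.1 ⊗[k] X.V.X p.1.2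

/-- The pure tensors in `L ⊗_k X`. -/
noncomputable def pretmul {i j n : ℤ} (h : i + j = n) :
    L.V.X i →ₗ[k] X.V.X j →ₗ[k] Pre L X n :=
  (TensorProduct.mk k (L.V.X i) (X.V.X j)).compr₂
    (DirectSum.lof k {p : ℤ × ℤ // p.1 + p.2 = n} (fun p => L.V.X p.1.1 ⊗[k] X.V.X p.1.2)
      ⟨(i, j), h⟩)

/-- The relations `x a ⊗ y = x ⊗ a y`. -/
def rel (n : ℤ) : Submodule k (Pre L X n) :=
  Submodule.span k {z | ∃ (i j l ij jl : ℤ) (h₁ : i + j = ij) (h₂ : ij + l = n) (h₃ : j + l = jl)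
    (h₄ : i + jl = n) (x : L.V.X i) (a : A.V.X j) (y : X.V.X l),
    z = pretmul L X h₂ (L.ract h₁ x a) y - pretmul L X h₄ x (X.lact h₃ a y)}

/-- The degree `n` part of `L ⊗_A X`. -/
abbrev T (n : ℤ) : Type u := Pre L X n ⧸ rel L X n

/-- The pure tensors in `L ⊗_A X`. -/
noncomputable def tmul {i j n : ℤ} (h : i + j = n) : L.V.X i →ₗ[k] X.V.X j →ₗ[k] T L X n :=
  (pretmul L X h).compr₂ (rel L X n).mkQ

variable {L X}

lemma tmul_balanced {i j l ij jl n : ℤ} (h₁ : i + j = ij) (h₂ : ij + l = n) (h₃ : j + l = jl)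
    (h₄ : i + jl = n) (x : L.V.X i) (a : A.V.X j) (y : X.V.X l) :
    tmul L X h₂ (L.ract h₁ x a) y = tmul L X h₄ x (X.lact h₃ a y) :=
  (Submodule.Quotient.eq _).2
    (Submodule.subset_span ⟨i, j, l, ij, jl, h₁, h₂, h₃, h₄, x, a, y, rfl⟩)

section lift

variable {W : Type u} [AddCommGroup W] [Module k W]

/-- Two linear maps out of `(L ⊗_A X)^n` which agree on pure tensors are equal. -/
lemma hom_ext {n : ℤ} {f g : T L X n →ₗ[k] W}
    (h : ∀ (i j : ℤ) (hij : i + j = n) (x : L.V.X i) (y : X.V.X j),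
      f (tmul L X hij x y) = g (tmul L X hij x y)) : f = g := by
  apply Submodule.linearMap_qext
  apply DirectSum.linearMap_ext
  rintro ⟨⟨i, j⟩, hij⟩
  apply TensorProduct.ext'
  intro x y
  exact h i j hij x y

/-- Induction on the elements of `L ⊗_A X`. -/
lemma induction {n : ℤ} {p : T L X n → Prop} (z : T L X n) (h0 : p 0)
    (hadd : ∀ x y, p x → p y → p (x + y))
    (h : ∀ (i j : ℤ) (hij : i + j = n) (x : L.V.X i) (y : X.V.X j), p (tmul L X hij x y)) :
    p z := by
  obtain ⟨z, rfl⟩ := Submodule.Quotient.mk_surjective _ z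
  induction z using DirectSum.induction_on with
  | zero => exact h0
  | add x y hx hy => exact hadd _ _ hx hy
  | of ij t =>
    obtain ⟨⟨i, j⟩, hij⟩ := ij
    induction t using TensorProduct.induction_on with
    | zero => rw [map_zero]; exact h0
    | add x y hx hy => rw [map_add]; exact hadd _ _ hx hy
    | tmul x y => exact h i j hij x y

/-- The linear map out of `(L ⊗_k X)^n` induced by a family of bilinear maps. -/
noncomputable def preLift {n : ℤ} (φ : ∀ i j : ℤ, i + j = n → (L.V.X i →ₗ[k] X.V.X j →ₗ[k] W)) :
    Pre L X n →ₗ[k] W :=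
  DirectSum.toModule k _ W fun p => TensorProduct.lift (φ p.1.1 p.1.2 p.2)

lemma preLift_pretmul {n : ℤ} (φ : ∀ i j : ℤ, i + j = n → (L.V.X i →ₗ[k] X.V.X j →ₗ[k] W))
    {i j : ℤ} (h : i + j = n) (x : L.V.X i) (y : X.V.X j) :
    preLift φ (pretmul L X h x y) = φ i j h x y := by
  unfold preLift pretmul
  rw [LinearMap.compr₂_apply, DirectSum.toModule_lof]
  rfl

/-- The linear map out of `(L ⊗_A X)^n` induced by a balanced family of bilinear maps. -/
noncomputable def lift {n : ℤ} (φ : ∀ i j : ℤ, i + j = n → (L.V.X i →ₗ[k] X.V.X j →ₗ[k] W))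
    (hφ : ∀ (i j l ij jl : ℤ) (h₁ : i + j = ij) (h₂ : ij + l = n) (h₃ : j + l = jl)
      (h₄ : i + jl = n) (x : L.V.X i) (a : A.V.X j) (y : X.V.X l),
      φ ij l h₂ (L.ract h₁ x a) y = φ i jl h₄ x (X.lact h₃ a y)) : T L X n →ₗ[k] W :=
  (rel L X n).liftQ (preLift φ) (by
    apply Submodule.span_le.2
    rintro _ ⟨i, j, l, ij, jl, h₁, h₂, h₃, h₄, x, a, y, rfl⟩
    rw [SetLike.mem_coe, LinearMap.mem_ker, map_sub, preLift_pretmul, preLift_pretmul,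
      hφ i j l ij jl h₁ h₂ h₃ h₄, sub_self])

lemma lift_tmul {n : ℤ} (φ : ∀ i j : ℤ, i + j = n → (L.V.X i →ₗ[k] X.V.X j →ₗ[k] W))
    (hφ : ∀ (i j l ij jl : ℤ) (h₁ : i + j = ij) (h₂ : ij + l = n) (h₃ : j + l = jl)
      (h₄ : i + jl = n) (x : L.V.X i) (a : A.V.X j) (y : X.V.X l),
      φ ij l h₂ (L.ract h₁ x a) y = φ i jl h₄ x (X.lact h₃ a y))
    {i j : ℤ} (h : i + j = n) (x : L.V.X i) (y : X.V.X j) :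
    lift φ hφ (tmul L X h x y) = φ i j h x y :=
  preLift_pretmul φ h x y

end lift

variable (L X)

/-- The differential `d (x ⊗ y) = d x ⊗ y + (-1)^{|x|} x ⊗ d y`. -/
noncomputable def dT (n : ℤ) : T L X n →ₗ[k] T L X (n + 1) :=
  lift (fun i j h =>
      (tmul L X (by omega : i + 1 + j = n + 1)).comp (L.V.d i (i + 1)).hom +
      i.negOnePow • (tmul L X (by omega : i + (j + 1) = n + 1)).compl₂ (X.V.d j (j + 1)).hom)
    (by
      intro i j l ij jl h₁ h₂ h₃ h₄ x a y
      simp only [LinearMap.add_apply, LinearMap.comp_apply, LinearMap.smul_apply,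
        LinearMap.compl₂_apply, Units.smul_def]
      rw [L.d_ract' h₁ rfl rfl rfl, X.d_lact' h₃ rfl rfl rfl]
      simp only [map_add, LinearMap.add_apply, Units.smul_def, map_zsmul, LinearMap.smul_apply,
        smul_add, smul_smul]
      rw [tmul_balanced (by omega : i + 1 + j = ij + 1) _ h₃ (by omega),
        tmul_balanced (by omega : i + (j + 1) = ij + 1) _ (by omega : j + 1 + l = jl + 1)
          (by omega),
        tmul_balanced h₁ _ (by omega : j + (l + 1) = jl + 1) (by omega)]
      subst h₁
      simp only [Int.negOnePow_add, Units.val_mul]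
      abel)

lemma dT_tmul {i j n i' j' : ℤ} (h : i + j = n) (hi : i + 1 = i') (hj : j + 1 = j')
    (x : L.V.X i) (y : X.V.X j) :
    dT L X n (tmul L X h x y) =
      tmul L X (by omega : i' + j = n + 1) ((L.V.d i i').hom x) y +
      i.negOnePow • tmul L X (by omega : i + j' = n + 1) x ((X.V.d j j').hom y) := by
  subst hi hj
  unfold dT
  rw [lift_tmul]
  rfl

lemma dT_dT (n : ℤ) : dT L X (n + 1) ∘ₗ dT L X n = 0 := by
  apply hom_ext
  intro i j h x y
  rw [LinearMap.comp_apply, dT_tmul L X h rfl rfl, map_add, Units.smul_def, map_zsmul,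
    dT_tmul L X _ rfl rfl, dT_tmul L X _ rfl rfl]
  simp [DGVect.d_d, Units.smul_def, Int.negOnePow_succ]

end DGLeftTensor

namespace DGModule

open DGLeftTensor

variable {k : Type u} [Field k] {A : DGAlgebra k}

/-- The tensor product `L ⊗_A X` of a right and a left dg module. -/
noncomputable def ltensor (L : DGModule A) (X : DGLeftModule A) : DGVect k :=
  CochainComplex.of (fun n => ModuleCat.of k (T L X n)) (fun n => ModuleCat.ofHom (dT L X n))
    (fun n => by rw [← ModuleCat.ofHom_comp, dT_dT]; rfl)

lemma ltensor_d (L : DGModule A) (X : DGLeftModule A) (n : ℤ) :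
    ((L.ltensor X).d n (n + 1)).hom = dT L X n :=
  DGVect.of_d_hom (fun n => ModuleCat.of k (T L X n)) (fun n => ModuleCat.ofHom (dT L X n))
    (fun n => by rw [← ModuleCat.ofHom_comp, dT_dT]; rfl) n

lemma ltensor_d_tmul (L : DGModule A) (X : DGLeftModule A) {i j n n' i' j' : ℤ} (h : i + j = n)
    (hn : n + 1 = n') (hi : i + 1 = i') (hj : j + 1 = j') (x : L.V.X i) (y : X.V.X j) :
    ((L.ltensor X).d n n').hom (tmul L X h x y) =
      tmul L X (by omega : i' + j = n') ((L.V.d i i').hom x) y +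
      i.negOnePow • tmul L X (by omega : i + j' = n') x ((X.V.d j j').hom y) := by
  subst hn
  rw [ltensor_d]
  exact dT_tmul L X h hi hj x y

/-- Chain maps out of a tensor product are determined by what they do to pure tensors. -/
lemma mkHom_aux {L : DGModule A} {X : DGLeftModule A} {W : DGVect k}
    (φ : ∀ n, T L X n →ₗ[k] W.X n)
    (h : ∀ (n i j : ℤ) (hij : i + j = n) (x : L.V.X i) (y : X.V.X j),
      φ (n + 1) (dT L X n (tmul L X hij x y)) =
        (W.d n (n + 1)).hom (φ n (tmul L X hij x y))) (n : ℤ) (x : T L X n) :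
    φ (n + 1) (((L.ltensor X).d n (n + 1)).hom x) = (W.d n (n + 1)).hom (φ n x) := by
  rw [ltensor_d]
  exact LinearMap.congr_fun (hom_ext (f := φ (n + 1) ∘ₗ dT L X n)
    (g := (W.d n (n + 1)).hom ∘ₗ φ n) (h n)) x

/-- Chain maps between tensor products from linear maps in each degree. -/
noncomputable def ltensorMkHom {L L' : DGModule A} {X X' : DGLeftModule A}
    (φ : ∀ n, T L X n →ₗ[k] T L' X' n)
    (h : ∀ (n i j : ℤ) (hij : i + j = n) (x : L.V.X i) (y : X.V.X j),
      φ (n + 1) (dT L X n (tmul L X hij x y)) = dT L' X' n (φ n (tmul L X hij x y))) :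
    L.ltensor X ⟶ L'.ltensor X' :=
  DGVect.mkHom (V := L.ltensor X) (W := L'.ltensor X') φ
    (mkHom_aux (W := L'.ltensor X') φ fun n i j hij x y =>
      (h n i j hij x y).trans (LinearMap.congr_fun (ltensor_d L' X' n).symm _))

/-- The map `L ⊗ g` in each degree. -/
noncomputable def ltensorMapT (L : DGModule A) {X Y : DGLeftModule A} (g : DGLeftModule.Hom X Y)
    (n : ℤ) : T L X n →ₗ[k] T L Y n :=
  lift (fun i j h => (tmul L Y h).compl₂ (g.f.f j).hom) (by
    intro i j l ij jl h₁ h₂ h₃ h₄ x a y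
    simp only [LinearMap.compl₂_apply]
    rw [tmul_balanced h₁ h₂ h₃ h₄, g.map_lact])

lemma ltensorMapT_tmul (L : DGModule A) {X Y : DGLeftModule A} (g : DGLeftModule.Hom X Y)
    {i j n : ℤ} (h : i + j = n) (x : L.V.X i) (y : X.V.X j) :
    L.ltensorMapT g n (tmul L X h x y) = tmul L Y h x ((g.f.f j).hom y) :=
  lift_tmul _ _ h x y

/-- The chain map `L ⊗ g`. -/
noncomputable def ltensorMap (L : DGModule A) {X Y : DGLeftModule A} (g : DGLeftModule.Hom X Y) :
    L.ltensor X ⟶ L.ltensor Y :=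
  ltensorMkHom (fun n => L.ltensorMapT g n) fun n i j h x y => by
    rw [ltensorMapT_tmul, dT_tmul _ _ _ rfl rfl, dT_tmul _ _ _ rfl rfl, map_add,
      Units.smul_def, map_zsmul, ltensorMapT_tmul, ltensorMapT_tmul, DGVect.map_d,
      Units.smul_def]

end DGModule

/-! ### Complexes of linear cochains out of K-projective modules -/

namespace DGModule

variable {k : Type u} [Field k] {A : DGAlgebra k}

/-- `A`-linear cochains from linear maps in each degree. -/
def mkLin {M N : DGModule A} {n : ℤ} (φ : ∀ p q : ℤ, p + n = q → (M.V.X p →ₗ[k] N.V.X q))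
    (h : ∀ (p q p' q' i : ℤ) (hpq : p + n = q) (hpq' : p' + n = q') (h : p + i = p')
      (x : M.V.X p) (a : A.V.X i), φ p' q' hpq' (M.ract h x a) =
        N.ract (by omega : q + i = q') (φ p q hpq x) a) : linCochain M N n :=
  ⟨Cochain.mk fun p q hpq => ModuleCat.ofHom (φ p q hpq), h⟩

lemma linCochain_ext {M N : DGModule A} {n : ℤ} {f g : linCochain M N n}
    (h : ∀ (p q : ℤ) (hpq : p + n = q) (x : M.V.X p),
      (f.1.v p q hpq).hom x = (g.1.v p q hpq).hom x) : f = g := by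
  apply Subtype.ext
  apply Cochain.ext
  intro p q hpq
  apply ModuleCat.hom_ext
  exact LinearMap.ext (h p q hpq)

lemma add_v_hom {M N : DGModule A} {n : ℤ} (f g : linCochain M N n) (p q : ℤ) (hpq : p + n = q)
    (x : M.V.X p) : ((f + g).1.v p q hpq).hom x = (f.1.v p q hpq).hom x + (g.1.v p q hpq).hom x :=
  rfl

/-- The identity morphism. -/
@[simps]
def Hom.id (M : DGModule A) : Hom M M where
  f := 𝟙 M.V
  map_ract _ _ _ := rfl

/-- The cochain of degree `0` defined by a morphism. -/
noncomputable def Hom.toCochain {M N : DGModule A} (f : Hom M N) : linCochain M N 0 :=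
  ⟨Cochain.ofHom f.f, by
    intro p q p' q' i hpq hpq' h x a
    obtain rfl : p = q := by omega
    obtain rfl : p' = q' := by omega
    simpa using f.map_ract h x a⟩

lemma Hom.toCochain_v_hom {M N : DGModule A} (f : Hom M N) (p : ℤ) (x : M.V.X p) :
    (f.toCochain.1.v p p (add_zero p)).hom x = (f.f.f p).hom x := by
  simp [Hom.toCochain]

lemma Hom.linδ_toCochain {M N : DGModule A} (f : Hom M N) (n : ℤ) :
    linδ M N 0 n f.toCochain = 0 :=
  Subtype.ext (δ_ofHom f.f)

/-- The chain map `Hom_A(P, f)`. -/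
noncomputable def homMap (P : DGModule A) {M N : DGModule A} (f : Hom M N) :
    homComplex P M ⟶ homComplex P N :=
  DGVect.mkHom (V := homComplex P M) (W := homComplex P N)
    (fun n => (linComp P M N (add_zero n)).flip f.toCochain)
    (fun n (x : linCochain P M n) => by
      refine Eq.trans ?_ (linδ_linComp (add_zero n) x f.toCochain).symm
      rw [Hom.linδ_toCochain, map_zero, zero_add, Int.negOnePow_zero, one_smul]
      rfl)

lemma homMap_f_v_hom (P : DGModule A) {M N : DGModule A} (f : Hom M N) {n : ℤ}
    (x : linCochain P M n) {p q : ℤ} (hpq : p + n = q) (y : P.V.X p) :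
    ((linComp P M N (add_zero n) x f.toCochain).1.v p q hpq).hom y =
      (f.f.f q).hom ((x.1.v p q hpq).hom y) := by
  rw [linComp_v_hom (add_zero n) x f.toCochain hpq (add_zero q), Hom.toCochain_v_hom]

lemma cone_d {M N : DGModule A} (f : Hom M N) {n n' : ℤ} (hn : n + 1 = n')
    (y : N.V.X n) (x : M.V.X (n + 1)) :
    ((cone f).V.d n n').hom ((y, x) : N.V.X n × M.V.X (n + 1)) =
      (((N.V.d n n').hom y + (f.f.f n').hom (M.V.castX hn x),
        -(M.V.d (n + 1) (n' + 1)).hom x) : N.V.X n' × M.V.X (n' + 1)) := by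
  subst hn
  exact LinearMap.congr_fun (DGVect.cone_d f.f n) (y, x)

/-- The cochain with values in the cone of `M → N` with given components. -/
noncomputable def conePair (P : DGModule A) {M N : DGModule A} (f : Hom M N) (n : ℤ) :
    (linCochain P N n × linCochain P M (n + 1)) →ₗ[k] linCochain P (cone f) n where
  toFun w := mkLin (N := cone f)
    (fun p q hpq => (LinearMap.prod (w.1.1.v p q hpq).hom (w.2.1.v p (q + 1) (by omega)).hom :
      P.V.X p →ₗ[k] N.V.X q × M.V.X (q + 1)))
    (fun p q p' q' i hpq hpq' h x a => Prod.ext (w.1.2 p q p' q' i hpq hpq' h x a)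
      (w.2.2 p (q + 1) p' (q' + 1) i (by omega) (by omega) h x a))
  map_add' _ _ := rfl
  map_smul' _ _ := rfl

lemma conePair_surjective (P : DGModule A) {M N : DGModule A} (f : Hom M N) (n : ℤ) :
    Function.Surjective (conePair P f n) := by
  intro w
  -- The component in `M` of degree `r` sits in the cone in degree `r - 1`, as an element of degree
  -- `r - 1 + 1`; hence the cast. `hs` shows that it disappears when `r` is literally a successor.
  let s (p r : ℤ) (h : p + (n + 1) = r) : P.V.X p →ₗ[k] M.V.X r :=
    M.V.castX (by omega : r - 1 + 1 = r) ∘ₗ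
      LinearMap.snd k (N.V.X (r - 1)) (M.V.X (r - 1 + 1)) ∘ₗ (w.1.v p (r - 1) (by omega)).hom
  have hs (p q : ℤ) (hpq : p + n = q) (x : P.V.X p) : s p (q + 1) (by omega) x =
      Prod.snd (α := N.V.X q) (β := M.V.X (q + 1)) ((w.1.v p q hpq).hom x) := by
    have key (q' : ℤ) (hq' : q' + 1 = q + 1) : M.V.castX hq'
        (Prod.snd (α := N.V.X q') (β := M.V.X (q' + 1)) ((w.1.v p q' (by omega)).hom x)) =
        Prod.snd (α := N.V.X q) (β := M.V.X (q + 1)) ((w.1.v p q hpq).hom x) := by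
      obtain rfl : q' = q := by omega
      rfl
    exact key (q + 1 - 1) (by omega)
  refine ⟨(mkLin (fun p q hpq => LinearMap.fst k (N.V.X q) (M.V.X (q + 1)) ∘ₗ
      (w.1.v p q hpq).hom)
    (fun p q p' q' i hpq hpq' h x a => congrArg Prod.fst (w.2 p q p' q' i hpq hpq' h x a)),
    mkLin s ?_), ?_⟩
  · intro p r p' r' i hpr hpr' h x a
    obtain ⟨q, rfl⟩ : ∃ q, r = q + 1 := ⟨r - 1, by omega⟩
    obtain ⟨q', rfl⟩ : ∃ q', r' = q' + 1 := ⟨r' - 1, by omega⟩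
    rw [hs p' q' (by omega), hs p q (by omega)]
    exact congrArg Prod.snd (w.2 p q p' q' i (by omega) (by omega) h x a)
  · refine linCochain_ext fun p q hpq x => ?_
    exact Prod.ext rfl (hs p q hpq x)

lemma conePair_injective (P : DGModule A) {M N : DGModule A} (f : Hom M N) (n : ℤ) :
    Function.Injective (conePair P f n) := by
  rintro ⟨u, v⟩ ⟨u', v'⟩ h
  have h' (p q : ℤ) (hpq : p + n = q) (x : P.V.X p) :=
    congrArg (fun w : linCochain P (cone f) n => (w.1.v p q hpq).hom x) h
  refine Prod.ext (linCochain_ext fun p q hpq x => congrArg Prod.fst (h' p q hpq x))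
    (linCochain_ext fun p r hpr x => ?_)
  obtain ⟨q, rfl⟩ : ∃ q, r = q + 1 := ⟨r - 1, by omega⟩
  exact congrArg Prod.snd (h' p q (by omega) x)

/-- Together with the bijectivity of `conePair`, this identifies `Hom_A(P, cone f)` with the cone of
`Hom_A(P, f)`; with the chosen conventions no sign intervenes. -/
lemma linδ_conePair (P : DGModule A) {M N : DGModule A} (f : Hom M N) (n : ℤ)
    (w : linCochain P N n × linCochain P M (n + 1)) :
    linδ P (cone f) n (n + 1) (conePair P f n w) =
      conePair P f (n + 1) (DGVect.coneD (homMap P f) n w) := by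
  obtain ⟨u, v⟩ := w
  change _ = conePair P f (n + 1) (linδ P N n (n + 1) u +
    linComp P M N (add_zero (n + 1)) v f.toCochain, -linδ P M (n + 1) (n + 1 + 1) v)
  refine linCochain_ext fun p q hpq x => ?_
  obtain ⟨q, rfl⟩ : ∃ r, q = r + 1 := ⟨q - 1, by omega⟩
  rw [linδ_v_hom _ hpq rfl rfl]
  have hcd := cone_d f rfl ((u.1.v p q (by omega)).hom x) ((v.1.v p (q + 1) (by omega)).hom x)
  have h1 := linδ_v_hom u hpq rfl rfl x
  have h2 := linδ_v_hom v (by omega : p + (n + 1 + 1) = q + 1 + 1) rfl rfl x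
  have h3 := homMap_f_v_hom P f v hpq x
  refine (congrArg (· + _) hcd).trans ?_
  refine Prod.ext ?_ ?_
  · refine Eq.trans ?_ (congrArg₂ (· + ·) h1 h3).symm
    change (N.V.d q (q + 1)).hom ((u.1.v p q (by omega)).hom x) + (f.f.f (q + 1)).hom _ +
      (n + 1).negOnePow • (u.1.v (p + 1) (q + 1) (by omega)).hom ((P.V.d p (p + 1)).hom x) = _
    rw [DGVect.castX_rfl]
    abel
  · refine Eq.trans ?_ (congrArg Neg.neg h2).symm
    change -(M.V.d (q + 1) (q + 1 + 1)).hom ((v.1.v p (q + 1) (by omega)).hom x) +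
      (n + 1).negOnePow • (v.1.v (p + 1) (q + 1 + 1) (by omega)).hom ((P.V.d p (p + 1)).hom x) = _
    rw [Int.negOnePow_succ (n + 1), Units.neg_smul]
    abel

/-- K-projectivity is applied to the cone of `f`, which is acyclic because `f` is a
quasi-isomorphism; `Hom_A(P, -)` commutes with cones. -/
lemma IsKProjective.quasiIso_homMap {P : DGModule A} (hP : P.IsKProjective) {M N : DGModule A}
    (f : Hom M N) (hf : QuasiIso f.f) : QuasiIso (homMap P f) := by
  have hc : (cone f).V.Acyclic := (DGVect.cone_acyclic_iff f.f).2 hf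
  rw [← DGVect.cone_acyclic_iff]
  let Ψ : DGVect.cone (homMap P f) ⟶ homComplex P (cone f) :=
    DGVect.mkHom (V := DGVect.cone (homMap P f)) (W := homComplex P (cone f))
      (fun n => conePair P f n) (fun n x => by
        rw [DGVect.cone_d]
        exact (linδ_conePair P f n x).symm)
  have hΨ : QuasiIso Ψ := DGVect.quasiIso_of_bijective Ψ fun n =>
    ⟨conePair_injective P f n, conePair_surjective P f n⟩
  intro n
  have h1 := hP _ hc n
  rwa [← exactAt_iff_of_quasiIsoAt Ψ n] at h1

end DGModule

/-! ### Tensor-Hom duality, flatness of K-projective modules, the module `A` -/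

namespace DGModule

open DGLeftTensor

variable {k : Type u} [Field k] {A : DGAlgebra k}

section curry

variable (M : DGModule A) (N : DGLeftModule A)

/-- The cochain `M → N^*` defined by a linear form on `M ⊗_A N`. -/
noncomputable def curryLin (n : ℤ) :
    Module.Dual k (T M N (-n)) →ₗ[k] linCochain M N.dual n where
  toFun ψ := mkLin (N := N.dual)
    (fun p q hpq => ((tmul M N (by omega : p + -q = -n)).compr₂ ψ :
      M.V.X p →ₗ[k] Module.Dual k (N.V.X (-q))))
    (fun p q p' q' i hpq hpq' h x a => LinearMap.ext fun (y : N.V.X (-q')) =>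
      congrArg ψ (tmul_balanced h _ (by omega : i + -q' = -q) (by omega) x a y))
  map_add' _ _ := rfl
  map_smul' _ _ := rfl

lemma curryLin_v_hom {n : ℤ} (ψ : Module.Dual k (T M N (-n))) {p q : ℤ} (hpq : p + n = q)
    (x : M.V.X p) (y : N.V.X (-q)) :
    (show Module.Dual k (N.V.X (-q)) from ((curryLin M N n ψ).1.v p q hpq).hom x) y =
      ψ (tmul M N (by omega : p + -q = -n) x y) := rfl

lemma linδ_curryLin (n : ℤ) (ψ : Module.Dual k (T M N (-n))) :
    linδ M N.dual n (n + 1) (curryLin M N n ψ) =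
      curryLin M N (n + 1) (((M.ltensor N).dual.d n (n + 1)).hom ψ) := by
  refine linCochain_ext fun p q hpq x => ?_
  obtain ⟨q, rfl⟩ : ∃ r, q = r + 1 := ⟨q - 1, by omega⟩
  rw [linδ_v_hom _ hpq rfl rfl]
  refine LinearMap.ext fun (y : N.V.X (-(q + 1))) => ?_
  change (q + 1).negOnePow • ψ (tmul M N (by omega : p + -q = -n) x
      ((N.V.d (-(q + 1)) (-q)).hom y)) +
    (n + 1).negOnePow • ψ (tmul M N (by omega : p + 1 + -(q + 1) = -n)
      ((M.V.d p (p + 1)).hom x) y) =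
    (n + 1).negOnePow • ψ (((M.ltensor N).d (-(n + 1)) (-n)).hom (tmul M N
      (by omega : p + -(q + 1) = -(n + 1)) x y))
  rw [ltensor_d_tmul M N (by omega : p + -(q + 1) = -(n + 1)) (by omega) rfl
    (by omega : -(q + 1) + 1 = -q)]
  have hs : (q + 1).negOnePow = (n + 1).negOnePow * p.negOnePow := by
    rw [← hpq, Int.negOnePow_add p, mul_comm]
  rw [map_add, smul_add, Units.smul_def p.negOnePow, map_zsmul, ← Units.smul_def, smul_smul,
    hs, add_comm]

/-- The isomorphism `(M ⊗_A N)^* ≅ Hom_A(M, N^*)`. -/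
noncomputable def curry : (M.ltensor N).dual ⟶ homComplex M N.dual :=
  DGVect.mkHom (V := (M.ltensor N).dual) (W := homComplex M N.dual) (fun n => curryLin M N n)
    (fun n ψ => (linδ_curryLin M N n ψ).symm)

lemma curryLin_injective (n : ℤ) : Function.Injective (curryLin M N n) := by
  intro ψ ψ' h
  refine hom_ext fun i j hij x y => ?_
  obtain ⟨j, rfl⟩ := DGVect.exists_neg_eq j
  exact congrArg (fun f : linCochain M N.dual n => (show Module.Dual k (N.V.X (-j)) from
    (f.1.v i j (by omega)).hom x) y) h

/-- Replaces `q` by an equal degree simultaneously in the cochain and in its argument. It is needed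
because a degree `j` of `N` occurs in `N^*` only as `- -j`. -/
lemma v_castX {L : DGModule A} {n : ℤ} (f : linCochain L N.dual n) {p q q' : ℤ} (h : p + n = q)
    (hq : q = q') (x : L.V.X p) (y : N.V.X (-q)) :
    (show Module.Dual k (N.V.X (-q')) from (f.1.v p q' (h.trans hq)).hom x)
        (N.V.castX (by rw [hq]) y) =
      (show Module.Dual k (N.V.X (-q)) from (f.1.v p q h).hom x) y := by
  subst hq
  rfl

/-- The linear form on `M ⊗_A N` defined by a cochain `M → N^*`. -/
noncomputable def uncurry {n : ℤ} (f : linCochain M N.dual n) : Module.Dual k (T M N (-n)) :=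
  lift (W := k) (fun i j hij => LinearMap.compl₂ (M := M.V.X i) (N := N.V.X (- -j))
    (f.1.v i (-j) (by omega)).hom (N.V.castX (by omega : j = - -j))) (by
      intro i j l ij jl h₁ h₂ h₃ h₄ x a y
      obtain ⟨l, rfl⟩ := DGVect.exists_neg_eq l
      obtain ⟨jl, rfl⟩ := DGVect.exists_neg_eq jl
      refine (v_castX N f (by omega : ij + n = l) (by omega) (M.ract h₁ x a) y).trans ?_
      refine Eq.trans ?_ (v_castX N f (by omega : i + n = jl) (by omega) x (N.lact h₃ a y)).symm
      exact LinearMap.congr_fun (f.2 i jl ij l j (by omega) (by omega) h₁ x a) y)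

lemma curryLin_uncurry {n : ℤ} (f : linCochain M N.dual n) :
    curryLin M N n (uncurry M N f) = f := by
  refine linCochain_ext fun p q hpq x => LinearMap.ext fun (y : N.V.X (-q)) => ?_
  refine (curryLin_v_hom M N _ hpq x y).trans ?_
  refine (lift_tmul _ _ _ x y).trans ?_
  exact v_castX N f hpq (by omega) x y

lemma quasiIso_curry : QuasiIso (curry M N) :=
  DGVect.quasiIso_of_bijective _ fun n =>
    ⟨curryLin_injective M N n, fun f => ⟨uncurry M N f, curryLin_uncurry M N f⟩⟩

lemma curry_naturality {N N' : DGLeftModule A} (g : DGLeftModule.Hom N N') :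
    curry M N' ≫ homMap M g.dual = DGVect.dualMap (M.ltensorMap g) ≫ curry M N := by
  ext n (ψ : Module.Dual k (T M N' (-n)))
  refine linCochain_ext fun p q hpq x => ?_
  refine (homMap_f_v_hom M g.dual (curryLin M N' n ψ) hpq x).trans ?_
  refine LinearMap.ext fun (y : N.V.X (-q)) => ?_
  exact congrArg ψ (ltensorMapT_tmul M g (by omega : p + -q = -n) x y).symm

end curry

variable {M : DGModule A}

/-- A K-projective module is K-flat. -/
lemma IsKProjective.quasiIso_ltensorMap (hM : M.IsKProjective) {N N' : DGLeftModule A}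
    (g : DGLeftModule.Hom N N') (hg : QuasiIso g.f) : QuasiIso (M.ltensorMap g) := by
  -- Quasi-isomorphisms are detected after dualizing, and currying turns the dual of `M ⊗ g` into
  -- `Hom_A(M, g^*)`, where K-projectivity applies.
  rw [← DGVect.quasiIso_dualMap_iff]
  have h1 : QuasiIso (homMap M g.dual) :=
    hM.quasiIso_homMap g.dual ((DGVect.quasiIso_dualMap_iff g.f).2 hg)
  have h2 := quasiIso_curry M N
  have h3 := quasiIso_curry M N'
  rw [← DGVect.quasiIso_comp_iff_left _ (curry M N) h2, ← curry_naturality,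
    DGVect.quasiIso_comp_iff_right _ _ h3]
  exact h1

/-- The morphism `M ⊗_A g` defined by a morphism of bimodules. -/
noncomputable def tensorHom (M : DGModule A) {X Y : DGBimodule A} (g : DGBimodule.Hom X Y) :
    Hom (M.tensor X) (M.tensor Y) where
  -- The complex underlying `M ⊗_A X` for a bimodule `X` is definitionally the tensor product with
  -- the underlying left module.
  f := M.ltensorMap g.toLeft
  map_ract {i j n} h z a := by
    have : M.ltensorMapT g.toLeft n ∘ₗ (DGTensor.ractT M X h).flip a =
        (DGTensor.ractT M Y h).flip a ∘ₗ M.ltensorMapT g.toLeft i := by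
      refine DGTensor.hom_ext fun p q hpq x y => ?_
      have h1 := DGTensor.ractT_tmul M X hpq h rfl x y a
      have h2 := DGTensor.ractT_tmul M Y hpq h rfl x ((g.f.f q).hom y) a
      refine (congrArg (M.ltensorMapT g.toLeft n) h1).trans ?_
      refine (ltensorMapT_tmul M g.toLeft _ x _).trans ?_
      refine Eq.trans ?_ (congrArg (fun w => DGTensor.ractT M Y h w a)
        (ltensorMapT_tmul M g.toLeft hpq x y)).symm
      refine Eq.trans ?_ h2.symm
      exact congrArg (fun w => DGTensor.tmul M Y _ x w) (g.map_ract rfl y a)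
    exact LinearMap.congr_fun this z

lemma tensorHom_tmul (M : DGModule A) {X Y : DGBimodule A} (g : DGBimodule.Hom X Y)
    {i j n : ℤ} (h : i + j = n) (x : M.V.X i) (y : X.V.X j) :
    ((M.tensorHom g).f.f n).hom (DGTensor.tmul M X h x y) =
      DGTensor.tmul M Y h x ((g.f.f j).hom y) :=
  ltensorMapT_tmul M g.toLeft h x y

lemma IsKProjective.quasiIso_tensorHom (hM : M.IsKProjective) {X Y : DGBimodule A}
    (g : DGBimodule.Hom X Y) (hg : QuasiIso g.f) : QuasiIso (M.tensorHom g).f :=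
  hM.quasiIso_ltensorMap g.toLeft hg

/-- The cochain `a ↦ x a` from the diagonal module. -/
noncomputable def ofElement (N : DGModule A) (n : ℤ) :
    N.V.X n →ₗ[k] linCochain A.diagonal.toDGModule N n where
  toFun x := mkLin (M := A.diagonal.toDGModule) (fun p q hpq => N.ract (by omega : n + p = q) x)
    (fun p q p' q' i hpq hpq' h a b => (N.ract_mul _ _ h _ x a b).symm)
  map_add' x y := linCochain_ext fun p q hpq a =>
    LinearMap.congr_fun (map_add (N.ract (by omega : n + p = q)) x y) a
  map_smul' c x := linCochain_ext fun p q hpq a =>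
    LinearMap.congr_fun (map_smul (N.ract (by omega : n + p = q)) c x) a

/-- The Leibniz rule for `1 · 1 = 1` reads `d 1 = d 1 + d 1`. -/
lemma d_one (A : DGAlgebra k) (i : ℤ) : (A.V.d 0 i).hom A.one = 0 := by
  by_cases hi : 1 = i
  · subst hi
    have h := A.d_mul (add_zero 0) A.one A.one
    have h1 := A.mul_one ((A.V.d 0 (0 + 1)).hom A.one)
    have h2 := A.one_mul ((A.V.d 0 (0 + 1)).hom A.one)
    rw [Int.negOnePow_zero, one_smul, A.mul_one, h1, h2] at h
    exact left_eq_add.1 h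
  · rw [A.V.shape 0 i (by simpa using hi)]
    rfl

lemma linδ_ofElement (N : DGModule A) (n : ℤ) (x : N.V.X n) :
    linδ _ N n (n + 1) (N.ofElement n x) = N.ofElement (n + 1) ((N.V.d n (n + 1)).hom x) := by
  refine linCochain_ext fun p q hpq a => ?_
  obtain ⟨q, rfl⟩ : ∃ r, q = r + 1 := ⟨q - 1, by omega⟩
  rw [linδ_v_hom _ hpq rfl rfl]
  change (N.V.d q (q + 1)).hom (N.ract (by omega : n + p = q) x a) +
    (n + 1).negOnePow • N.ract (by omega : n + (p + 1) = q + 1) x ((A.V.d p (p + 1)).hom a) =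
    N.ract (by omega : n + 1 + p = q + 1) ((N.V.d n (n + 1)).hom x) a
  refine (congrArg (· + _) (N.d_ract (by omega : n + p = q) x a)).trans ?_
  rw [Int.negOnePow_succ, Units.neg_smul, add_assoc]
  exact add_eq_left.2 (add_neg_cancel _)

/-- The isomorphism `N ≅ Hom_A(A, N)`. -/
noncomputable def ofElementHom (N : DGModule A) : N.V ⟶ homComplex A.diagonal.toDGModule N :=
  DGVect.mkHom (W := homComplex A.diagonal.toDGModule N) (fun n => N.ofElement n)
    (fun n x => (N.linδ_ofElement n x).symm)

lemma ofElement_bijective (N : DGModule A) (n : ℤ) : Function.Bijective (N.ofElement n) := by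
  constructor
  · intro x y h
    have := congrArg (fun f : linCochain A.diagonal.toDGModule N n =>
      (f.1.v 0 n (zero_add n)).hom A.one) h
    exact (N.ract_one x).symm.trans (this.trans (N.ract_one y))
  · intro f
    refine ⟨(f.1.v 0 n (zero_add n)).hom A.one, linCochain_ext fun p q hpq a => ?_⟩
    refine (f.2 0 n p q p (zero_add n) hpq (zero_add p) A.one a).symm.trans ?_
    exact congrArg (f.1.v p q hpq).hom (A.one_mul a)

lemma quasiIso_ofElementHom (N : DGModule A) : QuasiIso N.ofElementHom :=
  DGVect.quasiIso_of_bijective _ N.ofElement_bijective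

/-- `Hom_A(A, N)` is isomorphic to `N` itself. -/
lemma isKProjective_diagonal (A : DGAlgebra k) : A.diagonal.toDGModule.IsKProjective := by
  intro N hN n
  have := quasiIso_ofElementHom N
  have h1 := hN n
  rwa [exactAt_iff_of_quasiIsoAt N.ofElementHom n] at h1

end DGModule

/-! ### Cones as degreewise split extensions -/

namespace DGModule

variable {k : Type u} [Field k] {A : DGAlgebra k}

/-- The cochain of degree zero with given components. -/
def linOfMaps {M N : DGModule A} (φ : ∀ p : ℤ, M.V.X p →ₗ[k] N.V.X p)
    (h : ∀ {i j n : ℤ} (h : i + j = n) (x : M.V.X i) (a : A.V.X j),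
      φ n (M.ract h x a) = N.ract h (φ i x) a) : linCochain M N 0 :=
  mkLin (fun p q hpq => N.V.castX (by omega : p = q) ∘ₗ φ p) (by
    intro p q p' q' i hpq hpq' hp x a
    obtain rfl : p = q := by omega
    obtain rfl : p' = q' := by omega
    exact h hp x a)

lemma linCochain_ext_zero {M N : DGModule A} {f g : linCochain M N 0}
    (h : ∀ (p : ℤ) (x : M.V.X p),
      (f.1.v p p (add_zero p)).hom x = (g.1.v p p (add_zero p)).hom x) : f = g := by
  refine linCochain_ext fun p q hpq x => ?_
  obtain rfl : p = q := by omega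
  exact h p x

section cone

variable {M N : DGModule A} (f : Hom M N)

/-- The inclusion of the target in the cone. -/
noncomputable def coneInl : Hom N (cone f) where
  f := DGVect.mkHom (W := (cone f).V) (fun n => LinearMap.inl k (N.V.X n) (M.V.X (n + 1)))
    (fun n x => by
      refine ((cone_d f rfl x 0).trans ?_).symm
      refine Prod.ext ?_ ?_
      · change _ + (f.f.f (n + 1)).hom _ = (N.V.d n (n + 1)).hom x
        rw [DGVect.castX_rfl, map_zero, add_zero]
      · change -(M.V.d (n + 1) (n + 1 + 1)).hom 0 = 0
        rw [map_zero, neg_zero])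
  map_ract h x a := Prod.ext rfl (LinearMap.congr_fun (map_zero (M.ract _)) a).symm

/-- The projection of the cone to the shift of the source. -/
noncomputable def coneProj : Hom (cone f) (M.shift 1) where
  f := DGVect.mkHom (V := (cone f).V) (W := (M.shift 1).V)
    (fun n => LinearMap.snd k (N.V.X n) (M.V.X (n + 1))) (by
      intro n (x : N.V.X n × M.V.X (n + 1))
      refine (congrArg Prod.snd (cone_d f rfl x.1 x.2)).trans ?_
      change -(M.V.d (n + 1) (n + 1 + 1)).hom x.2 =
        (1 : ℤ).negOnePow • (M.V.d (n + 1) (n + 1 + 1)).hom x.2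
      rw [Int.negOnePow_one, Units.neg_smul, one_smul])
  map_ract h x a := rfl

/-- The graded retraction of the cone to the target. -/
noncomputable def coneRetr : linCochain (cone f) N 0 :=
  linOfMaps (M := cone f) (fun n => LinearMap.fst k (N.V.X n) (M.V.X (n + 1))) fun _ _ _ => rfl

/-- The graded section of the projection of the cone. -/
noncomputable def coneSect : linCochain (M.shift 1) (cone f) 0 :=
  linOfMaps (M := M.shift 1) (N := cone f)
    (fun n => LinearMap.inr k (N.V.X n) (M.V.X (n + 1)))
    fun _ _ a => Prod.ext (LinearMap.congr_fun (map_zero (N.ract _)) a).symm rfl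

lemma coneInl_coneRetr :
    linComp N (cone f) N (add_zero 0) (coneInl f).toCochain (coneRetr f) = N.linId := by
  refine linCochain_ext_zero fun p x => ?_
  rw [linComp_v_hom (add_zero 0) _ _ (add_zero p) (add_zero p), Hom.toCochain_v_hom,
    linId_v_hom]
  rfl

lemma coneSect_coneProj :
    linComp (M.shift 1) (cone f) (M.shift 1) (add_zero 0) (coneSect f) (coneProj f).toCochain =
      (M.shift 1).linId := by
  refine linCochain_ext_zero fun p x => ?_
  rw [linComp_v_hom (add_zero 0) _ _ (add_zero p) (add_zero p), Hom.toCochain_v_hom,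
    linId_v_hom]
  rfl

lemma coneInl_coneProj :
    linComp N (cone f) (M.shift 1) (add_zero 0) (coneInl f).toCochain (coneProj f).toCochain =
      0 := by
  refine linCochain_ext_zero fun p x => ?_
  rw [linComp_v_hom (add_zero 0) _ _ (add_zero p) (add_zero p), Hom.toCochain_v_hom,
    Hom.toCochain_v_hom]
  rfl

/-- The retraction and the section are `A`-linear but in general do not commute with the
differentials. For this reason a `GradedFunctor` acts on all linear cochains of degree zero, closed
or not. -/
lemma cone_splitting :
    linComp (cone f) N (cone f) (add_zero 0) (coneRetr f) (coneInl f).toCochain +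
      linComp (cone f) (M.shift 1) (cone f) (add_zero 0) (coneProj f).toCochain (coneSect f) =
      (cone f).linId := by
  refine linCochain_ext_zero fun p x => ?_
  rw [add_v_hom, linComp_v_hom (add_zero 0) _ _ (add_zero p) (add_zero p),
    linComp_v_hom (add_zero 0) _ _ (add_zero p) (add_zero p), Hom.toCochain_v_hom,
    Hom.toCochain_v_hom, linId_v_hom]
  exact Prod.ext (add_zero (Prod.fst (α := N.V.X p) (β := M.V.X (p + 1)) x))
    (zero_add (Prod.snd (α := N.V.X p) (β := M.V.X (p + 1)) x))

end cone

end DGModule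

open DGModule

/-! ### Functors on graded morphisms and their behaviour on cones -/

/-- A functor from the category of dg modules over `A` and graded morphisms of degree zero
to graded vector spaces, with a differential on the values which is preserved by the closed
morphisms. -/
structure GradedFunctor {k : Type u} [Field k] (A : DGAlgebra k) where
  obj : DGModule A → DGVect k
  map : ∀ {M N : DGModule A} (q : ℤ), linCochain M N 0 →ₗ[k] (obj M).X q →ₗ[k] (obj N).X q
  map_id : ∀ (M : DGModule A) (q : ℤ) (x : (obj M).X q), map q M.linId x = x
  map_comp : ∀ {L M N : DGModule A} (q : ℤ) (f : linCochain L M 0) (g : linCochain M N 0)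
    (x : (obj L).X q), map q (linComp L M N (add_zero 0) f g) x = map q g (map q f x)
  map_d : ∀ {M N : DGModule A} (q : ℤ) (f : Hom M N) (x : (obj M).X q),
    map (q + 1) f.toCochain (((obj M).d q (q + 1)).hom x) =
      ((obj N).d q (q + 1)).hom (map q f.toCochain x)

namespace GradedFunctor

variable {k : Type u} [Field k] {A : DGAlgebra k} (F : GradedFunctor A)

/-- The chain map induced by a morphism. -/
noncomputable def mapHom {M N : DGModule A} (f : DGModule.Hom M N) : F.obj M ⟶ F.obj N :=
  DGVect.mkHom (fun q => F.map q f.toCochain) (fun q x => F.map_d q f x)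

lemma mapHom_comp_eq_id {M N : DGModule A} (i : DGModule.Hom M N) (p : DGModule.Hom N M)
    (h : i.f ≫ p.f = 𝟙 M.V) : F.mapHom i ≫ F.mapHom p = 𝟙 (F.obj M) := by
  have h1 : linComp M N M (add_zero 0) i.toCochain p.toCochain = M.linId := by
    refine linCochain_ext_zero fun q x => ?_
    rw [linComp_v_hom (add_zero 0) _ _ (add_zero q) (add_zero q), Hom.toCochain_v_hom,
      Hom.toCochain_v_hom, linId_v_hom]
    exact congrArg (fun g => (g.f q).hom x) h
  ext q x
  refine (F.map_comp q i.toCochain p.toCochain x).symm.trans ?_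
  rw [h1]
  exact F.map_id M q x

/-- The sequence `F N → F (cone f) → F (M[1])`. -/
noncomputable def coneSequence {M N : DGModule A} (f : DGModule.Hom M N) :
    ShortComplex (DGVect k) :=
  ShortComplex.mk (F.mapHom (coneInl f)) (F.mapHom (coneProj f)) (by
    ext q x
    refine (F.map_comp q (coneInl f).toCochain (coneProj f).toCochain x).symm.trans ?_
    rw [coneInl_coneProj, map_zero]
    rfl)

/-- A functor on graded morphisms carries the graded splitting of the cone to a splitting in each
degree. -/
lemma coneSequence_shortExact {M N : DGModule A} (f : DGModule.Hom M N) :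
    (F.coneSequence f).ShortExact := by
  apply HomologicalComplex.shortExact_of_degreewise_shortExact
  intro q
  refine ShortComplex.Splitting.shortExact
    { r := ModuleCat.ofHom (F.map q (coneRetr f))
      s := ModuleCat.ofHom (F.map q (coneSect f))
      f_r := ?_
      s_g := ?_
      id := ?_ }
  · ext x
    refine (F.map_comp q (coneInl f).toCochain (coneRetr f) x).symm.trans ?_
    rw [coneInl_coneRetr]
    exact F.map_id _ q x
  · ext x
    refine (F.map_comp q (coneSect f) (coneProj f).toCochain x).symm.trans ?_
    rw [coneSect_coneProj]
    exact F.map_id _ q x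
  · ext x
    refine Eq.trans (congrArg₂ (· + ·) (F.map_comp q (coneRetr f) (coneInl f).toCochain x).symm
      (F.map_comp q (coneProj f).toCochain (coneSect f) x).symm) ?_
    refine (LinearMap.congr_fun (map_add (F.map q) _ _) x).symm.trans ?_
    rw [cone_splitting]
    exact F.map_id _ q x

/-- The functor preserves acyclicity. -/
def PreservesAcyclic : Prop := ∀ M : DGModule A, M.V.Acyclic → (F.obj M).Acyclic

/-- A property of vector spaces that passes to the middle of exact sequences. -/
structure IsThick (R : ModuleCat.{u} k → Prop) : Prop where
  of_isZero : ∀ X, Limits.IsZero X → R X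
  of_exact : ∀ S : ShortComplex (ModuleCat.{u} k), S.Exact → R S.X₁ → R S.X₃ → R S.X₂

/-- For a monomorphism `X → Y` the sequence `0 → X → Y` is exact, so `X` is itself a middle term. -/
lemma IsThick.of_mono {R : ModuleCat.{u} k → Prop} (hR : IsThick R) {X Y : ModuleCat.{u} k}
    (f : X ⟶ Y) [Mono f] (hY : R Y) : R X :=
  hR.of_exact (ShortComplex.mk (0 : ModuleCat.of k PUnit.{u + 1} ⟶ X) f (by simp))
    ((ShortComplex.exact_iff_mono _ rfl).2 inferInstance)
    (hR.of_isZero _ (ModuleCat.isZero_of_subsingleton _)) hY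

variable {F}

/-- The cone of `f` is acyclic, and so is its image under `F`. The long exact sequence then controls
the cohomology of `F N` by that of `F (M[1])` in the preceding degree, and conversely. -/
lemma shift_one_iff_of_quasiIso (hF : F.PreservesAcyclic) {R : ModuleCat.{u} k → Prop}
    (hR : IsThick R) {M N : DGModule A} (f : DGModule.Hom M N) (hf : QuasiIso f.f) :
    (∀ n, R ((F.obj (M.shift 1)).homology n)) ↔ ∀ n, R ((F.obj N).homology n) := by
  have hS := F.coneSequence_shortExact f
  have hc : (F.obj (cone f)).Acyclic := hF _ ((DGVect.cone_acyclic_iff f.f).2 hf)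
  have hc' (n : ℤ) : R ((F.obj (cone f)).homology n) := hR.of_isZero _ (hc n).isZero_homology
  constructor
  · intro h n
    exact hR.of_exact _ (hS.homology_exact₁ (n - 1) n (by simp)) (h (n - 1)) (hc' n)
  · intro h n
    exact hR.of_exact _ (hS.homology_exact₃ n (n + 1) (by simp)) (hc' n) (h (n + 1))

/-- Both `N` and `M` are compared with `M[1]`, by means of the cones of `f` and of the identity. -/
lemma iff_of_quasiIso (hF : F.PreservesAcyclic) {R : ModuleCat.{u} k → Prop}
    (hR : IsThick R) {M N : DGModule A} (f : DGModule.Hom M N) (hf : QuasiIso f.f) :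
    (∀ n, R ((F.obj M).homology n)) ↔ ∀ n, R ((F.obj N).homology n) := by
  rw [← shift_one_iff_of_quasiIso hF hR f hf,
    shift_one_iff_of_quasiIso hF hR (DGModule.Hom.id M) (by rw [Hom.id_f]; infer_instance)]

lemma shift_one_iff (hF : F.PreservesAcyclic) {R : ModuleCat.{u} k → Prop}
    (hR : IsThick R) (M : DGModule A) :
    (∀ n, R ((F.obj (M.shift 1)).homology n)) ↔ ∀ n, R ((F.obj M).homology n) :=
  shift_one_iff_of_quasiIso hF hR (DGModule.Hom.id M) (by rw [Hom.id_f]; infer_instance)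

end GradedFunctor

/-! ### Composition of shifts -/

namespace DGModule

variable {k : Type u} [Field k] {A : DGAlgebra k}

lemma ract_castX (M : DGModule A) {i i' j n n' : ℤ} (hi : i = i') (hn : n = n') (h : i + j = n)
    (x : M.V.X i) (a : A.V.X j) :
    M.ract (by omega : i' + j = n') (M.V.castX hi x) a = M.V.castX hn (M.ract h x a) := by
  subst hi hn
  rfl

lemma castX_bijective (V : DGVect k) {i j : ℤ} (h : i = j) : Function.Bijective (V.castX h) := by
  subst h
  exact Function.bijective_id

/-- The isomorphism `M[n][1] ≅ M[n + 1]`. -/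
noncomputable def shiftShift (M : DGModule A) (n : ℤ) :
    Hom ((M.shift n).shift 1) (M.shift (n + 1)) where
  f := DGVect.mkHom (V := ((M.shift n).shift 1).V) (W := (M.shift (n + 1)).V)
    (fun i => M.V.castX (by omega : i + 1 + n = i + (n + 1))) (by
      intro i (x : M.V.X (i + 1 + n))
      change M.V.castX _ ((1 : ℤ).negOnePow • n.negOnePow •
          (M.V.d (i + 1 + n) (i + 1 + 1 + n)).hom x) =
        (n + 1).negOnePow • (M.V.d (i + (n + 1)) (i + 1 + (n + 1))).hom (M.V.castX _ x)
      rw [DGVect.d_castX M.V (by omega : i + 1 + n = i + (n + 1))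
        (by omega : i + 1 + 1 + n = i + 1 + (n + 1)), smul_smul, ← Int.negOnePow_add,
        Units.smul_def, map_zsmul, ← Units.smul_def, add_comm 1 n])
  map_ract h x a := (M.ract_castX (by omega) (by omega) _ x a).symm

/-- The isomorphism `M[0] ≅ M`. -/
noncomputable def shiftZero (M : DGModule A) : Hom (M.shift 0) M where
  f := DGVect.mkHom (V := (M.shift 0).V) (fun i => M.V.castX (by omega : i + 0 = i)) (by
      intro i (x : M.V.X (i + 0))
      change M.V.castX _ ((0 : ℤ).negOnePow • (M.V.d (i + 0) (i + 1 + 0)).hom x) =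
        (M.V.d i (i + 1)).hom (M.V.castX _ x)
      rw [DGVect.d_castX M.V (by omega : i + 0 = i) (by omega : i + 1 + 0 = i + 1),
        Int.negOnePow_zero, one_smul])
  map_ract h x a := (M.ract_castX (by omega) (by omega) _ x a).symm

end DGModule

/-! ### Dévissage along perfect modules -/

namespace GradedFunctor

variable {k : Type u} [Field k] {A : DGAlgebra k} {F : GradedFunctor A}

lemma shift_iff (hF : F.PreservesAcyclic) {R : ModuleCat.{u} k → Prop} (hR : IsThick R)
    (M : DGModule A) (m : ℤ) :
    (∀ n, R ((F.obj (M.shift m)).homology n)) ↔ ∀ n, R ((F.obj M).homology n) := by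
  have step (m : ℤ) : (∀ n, R ((F.obj (M.shift (m + 1))).homology n)) ↔
      ∀ n, R ((F.obj (M.shift m)).homology n) := by
    rw [← shift_one_iff hF hR (M.shift m), iff_of_quasiIso hF hR (M.shiftShift m)]
    exact DGVect.quasiIso_of_bijective _ fun i => castX_bijective M.V _
  induction m using Int.induction_on with
  | zero =>
    exact iff_of_quasiIso hF hR M.shiftZero
      (DGVect.quasiIso_of_bijective _ fun i => castX_bijective M.V _)
  | succ m ih => exact (step m).trans ih
  | pred m ih =>
    have h := step (-m - 1)
    rw [sub_add_cancel] at h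
    exact h.symm.trans ih

/-- A property of the cohomology of a functor which holds for `A` holds for perfect modules. -/
theorem of_isPerfect (hF : F.PreservesAcyclic) {R : ModuleCat.{u} k → Prop} (hR : IsThick R)
    (hA : ∀ n, R ((F.obj A.diagonal.toDGModule).homology n)) {M : DGModule A} (hM : M.IsPerfect) :
    ∀ n, R ((F.obj M).homology n) := by
  -- The modules met in the induction are arbitrary, so the quasi-isomorphism cases rest on `F`
  -- preserving every acyclic module, not only K-projective ones.
  induction hM with
  | self => exact hA
  | of_quasiIso f hf _ ih => exact (iff_of_quasiIso hF hR f hf).1 ih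
  | of_quasiIso' f hf _ ih => exact (iff_of_quasiIso hF hR f hf).2 ih
  | shift m _ ih => exact (shift_iff hF hR _ m).2 ih
  | cone f _ _ ih₁ ih₂ =>
    intro n
    exact hR.of_exact _ ((F.coneSequence_shortExact f).homology_exact₂ n) (ih₂ n)
      ((shift_one_iff hF hR _).2 ih₁ n)
  | summand i p h _ ih =>
    intro n
    -- The cohomology of a summand is a retract, so it embeds in that of the whole.
    have h1 : HomologicalComplex.homologyMap (F.mapHom i) n ≫
        HomologicalComplex.homologyMap (F.mapHom p) n = 𝟙 _ := by
      rw [← HomologicalComplex.homologyMap_comp, F.mapHom_comp_eq_id i p h,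
        HomologicalComplex.homologyMap_id]
    have : Mono (HomologicalComplex.homologyMap (F.mapHom i) n) :=
      mono_of_mono_fac h1
    exact hR.of_mono (HomologicalComplex.homologyMap (F.mapHom i) n) (ih n)

lemma isThick_isZero : IsThick (fun X : ModuleCat.{u} k => Limits.IsZero X) where
  of_isZero _ h := h
  of_exact _ hS h₁ h₃ := hS.isZero_X₂ (h₁.eq_of_src _ _) (h₃.eq_of_tgt _ _)

lemma isThick_finite : IsThick (fun X : ModuleCat.{u} k => Module.Finite k X) where
  of_isZero X h := by
    have := ModuleCat.subsingleton_of_isZero h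
    infer_instance
  of_exact S hS h₁ _ := by
    have : Module.Finite k (S.X₂ ⧸ LinearMap.ker S.g.hom) :=
      Module.Finite.equiv (S.g.hom.quotKerEquivRange).symm
    have h : Module.Finite k (LinearMap.ker S.g.hom) := by
      rw [← hS.moduleCat_range_eq_ker]
      infer_instance
    exact Module.Finite.of_submodule_quotient (LinearMap.ker S.g.hom)

theorem hasFiniteCoh_of_isPerfect (hF : F.PreservesAcyclic)
    (hA : (F.obj A.diagonal.toDGModule).HasFiniteCoh) {M : DGModule A} (hM : M.IsPerfect) :
    (F.obj M).HasFiniteCoh :=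
  of_isPerfect hF isThick_finite hA hM

theorem acyclic_of_isPerfect (hF : F.PreservesAcyclic)
    (hA : (F.obj A.diagonal.toDGModule).Acyclic) {M : DGModule A} (hM : M.IsPerfect) :
    (F.obj M).Acyclic := fun n => by
  rw [HomologicalComplex.exactAt_iff_isZero_homology]
  exact of_isPerfect hF isThick_isZero (fun n => (hA n).isZero_homology) hM n

/-- A natural transformation with respect to closed morphisms. -/
structure Hom (F G : GradedFunctor A) where
  app : ∀ M : DGModule A, F.obj M ⟶ G.obj M
  naturality : ∀ {M N : DGModule A} (q : ℤ) (f : DGModule.Hom M N) (x : (F.obj M).X q),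
    ((app N).f q).hom (F.map q f.toCochain x) = G.map q f.toCochain (((app M).f q).hom x)

/-- The cone of a natural transformation. -/
noncomputable def cone {F G : GradedFunctor A} (τ : Hom F G) : GradedFunctor A where
  obj M := DGVect.cone (τ.app M)
  map {M N} q := LinearMap.mk₂ k
    (fun f (x : (G.obj M).X q × (F.obj M).X (q + 1)) =>
      ((G.map q f x.1, F.map (q + 1) f x.2) : (G.obj N).X q × (F.obj N).X (q + 1)))
    (fun f g x => Prod.ext (LinearMap.congr_fun (map_add (G.map q) f g) _)
      (LinearMap.congr_fun (map_add (F.map (q + 1)) f g) _))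
    (fun c f x => Prod.ext (LinearMap.congr_fun (map_smul (G.map q) c f) _)
      (LinearMap.congr_fun (map_smul (F.map (q + 1)) c f) _))
    (fun f _ _ => Prod.ext (map_add (G.map q f) _ _) (map_add (F.map (q + 1) f) _ _))
    (fun c f _ => Prod.ext (map_smul (G.map q f) c _) (map_smul (F.map (q + 1) f) c _))
  map_id M q x := Prod.ext (G.map_id M q _) (F.map_id M (q + 1) _)
  map_comp q f g x := Prod.ext (G.map_comp q f g _) (F.map_comp (q + 1) f g _)
  map_d {M N} q f := by
    intro (x : (G.obj M).X q × (F.obj M).X (q + 1))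
    rw [DGVect.cone_d, DGVect.cone_d]
    refine Prod.ext ?_ ?_
    · change G.map (q + 1) f.toCochain (((G.obj M).d q (q + 1)).hom x.1 +
          ((τ.app M).f (q + 1)).hom x.2) =
        ((G.obj N).d q (q + 1)).hom (G.map q f.toCochain x.1) +
          ((τ.app N).f (q + 1)).hom (F.map (q + 1) f.toCochain x.2)
      rw [map_add, G.map_d, τ.naturality]
    · change F.map (q + 1 + 1) f.toCochain (-((F.obj M).d (q + 1) (q + 1 + 1)).hom x.2) =
        -((F.obj N).d (q + 1) (q + 1 + 1)).hom (F.map (q + 1) f.toCochain x.2)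
      rw [map_neg, F.map_d]

/-- The cone of `τ` is again such a functor. It preserves acyclicity, because any chain map between
acyclic complexes is a quasi-isomorphism, and its value at `A` is acyclic; dévissage makes it
acyclic on all perfect modules. -/
theorem quasiIso_of_isPerfect {F G : GradedFunctor A} (hF : F.PreservesAcyclic)
    (hG : G.PreservesAcyclic) (τ : Hom F G) (hA : QuasiIso (τ.app A.diagonal.toDGModule))
    {M : DGModule A} (hM : M.IsPerfect) : QuasiIso (τ.app M) := by
  rw [← DGVect.cone_acyclic_iff] at hA ⊢
  refine acyclic_of_isPerfect (F := cone τ) (fun N hN => ?_) hA hM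
  refine (DGVect.cone_acyclic_iff _).2 ?_
  rw [_root_.quasiIso_iff]
  intro n
  exact (quasiIsoAt_iff_exactAt _ n (hF N hN n)).2 (hG N hN n)

end GradedFunctor

/-! ### Tensor products and Hom complexes as functors of a right module -/

namespace DGModule

open DGLeftTensor

variable {k : Type u} [Field k] {A : DGAlgebra k} {M M' M'' : DGModule A} (N : DGLeftModule A)

/-- The evaluation of cochains at an element. -/
def evalLin (M' : DGModule A) {p i j : ℤ} (h : i + p = j) (x : M.V.X i) :
    linCochain M M' p →ₗ[k] M'.V.X j where
  toFun f := (f.1.v i j h).hom x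
  map_add' _ _ := rfl
  map_smul' _ _ := rfl

/-- The action `g (x ⊗ y) = g x ⊗ y` of cochains on a tensor product. -/
noncomputable def lactT {p q n : ℤ} (h : p + q = n) :
    linCochain M M' p →ₗ[k] T M N q →ₗ[k] T M' N n :=
  (lift (L := M) (X := N) (W := linCochain M M' p →ₗ[k] T M' N n)
    (fun i j hij => LinearMap.mk₂ k
      (fun x y => ((tmul M' N (by omega : i + p + j = n)).flip y).comp (evalLin M' rfl x))
      (fun x x' y => LinearMap.ext fun f => by simp [evalLin]; rfl)
      (fun c x y => LinearMap.ext fun f => by simp [evalLin]; rfl)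
      (fun x y y' => LinearMap.ext fun f => by simp) (fun c x y => LinearMap.ext fun f => by simp))
    (by
      intro i j l ij jl h₁ h₂ h₃ h₄ x a y
      apply LinearMap.ext
      intro f
      change tmul M' N _ ((f.1.v ij _ rfl).hom (M.ract h₁ x a)) y =
        tmul M' N _ ((f.1.v i _ rfl).hom x) (N.lact h₃ a y)
      rw [f.2 i _ ij _ j rfl rfl h₁, tmul_balanced _ _ h₃])).flip

lemma lactT_tmul {p q n i j i' : ℤ} (h : p + q = n) (hij : i + j = q) (hi : i + p = i')
    (g : linCochain M M' p) (x : M.V.X i) (y : N.V.X j) :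
    lactT N h g (tmul M N hij x y) =
      tmul M' N (by omega : i' + j = n) ((g.1.v i i' hi).hom x) y := by
  subst hi
  unfold lactT
  rw [LinearMap.flip_apply, lift_tmul]
  rfl

lemma lactT_id {q : ℤ} (z : T M N q) : lactT N (zero_add q) M.linId z = z := by
  have : lactT N (zero_add q) M.linId = LinearMap.id := by
    refine hom_ext fun i j hij x y => ?_
    rw [lactT_tmul N _ hij (add_zero i), linId_v_hom]
    rfl
  exact LinearMap.congr_fun this z

lemma lactT_comp {p q r pq qr n : ℤ} (h₁ : q + p = pq) (h₂ : pq + r = n) (h₃ : q + r = qr)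
    (h₄ : p + qr = n) (g' : linCochain M' M'' p) (g : linCochain M M' q) (z : T M N r) :
    lactT N h₂ (linComp M M' M'' h₁ g g') z = lactT N h₄ g' (lactT N h₃ g z) := by
  have : lactT N h₂ (linComp M M' M'' h₁ g g') = lactT N h₄ g' ∘ₗ lactT N h₃ g := by
    refine hom_ext fun i j hij x y => ?_
    rw [LinearMap.comp_apply, lactT_tmul N h₃ hij rfl, lactT_tmul N h₄ _ rfl,
      lactT_tmul N h₂ hij (by omega : i + pq = i + q + p),
      linComp_v_hom h₁ g g' rfl rfl]
  exact LinearMap.congr_fun this z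

lemma dT_lactT {p q n : ℤ} (h : p + q = n) (g : linCochain M M' p) (z : T M N q) :
    dT M' N n (lactT N h g z) = lactT N (by omega : p + 1 + q = n + 1) (linδ M M' p (p + 1) g) z +
      p.negOnePow • lactT N (by omega : p + (q + 1) = n + 1) g (dT M N q z) := by
  have : dT M' N n ∘ₗ lactT N h g =
      lactT N (by omega : p + 1 + q = n + 1) (linδ M M' p (p + 1) g) +
      p.negOnePow • lactT N (by omega : p + (q + 1) = n + 1) g ∘ₗ dT M N q := by
    refine hom_ext fun i j hij x y => ?_
    simp only [LinearMap.comp_apply, LinearMap.add_apply, LinearMap.smul_apply, Units.smul_def]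
    rw [lactT_tmul N h hij rfl, lactT_tmul N _ hij (by omega : i + (p + 1) = i + p + 1),
      linδ_v_hom g _ rfl rfl, dT_tmul _ _ hij rfl rfl, dT_tmul _ _ _ rfl rfl]
    simp only [map_add, LinearMap.add_apply, Units.smul_def, map_zsmul, LinearMap.smul_apply,
      smul_add, smul_smul]
    rw [lactT_tmul N _ _ (by omega : i + 1 + p = i + p + 1), lactT_tmul N _ _ rfl]
    simp only [Int.negOnePow_add, Units.val_mul, Int.negOnePow_one, Units.val_neg,
      mul_neg, mul_one, neg_smul]
    rw [mul_comm i.negOnePow.1 p.negOnePow.1]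
    abel
  exact LinearMap.congr_fun this z

end DGModule

namespace GradedFunctor

open DGModule

variable {k : Type u} [Field k] {A : DGAlgebra k}

/-- The functor `M ↦ M ⊗_A N`. -/
noncomputable def tensorRight (N : DGLeftModule A) : GradedFunctor A where
  obj M := M.ltensor N
  map q := lactT N (zero_add q)
  map_id M q z := lactT_id N z
  map_comp q f g z := lactT_comp N (add_zero 0) (zero_add q) (zero_add q) (zero_add q) g f z
  map_d {M M'} q f z := by
    rw [ltensor_d, ltensor_d]
    refine Eq.trans ?_ (dT_lactT N (zero_add q) f.toCochain z).symm
    rw [Hom.linδ_toCochain, map_zero, Int.negOnePow_zero, one_smul]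
    exact (zero_add _).symm

/-- The functor `M ↦ Hom_A(L, M)`. -/
noncomputable def homLeft (L : DGModule A) : GradedFunctor A where
  obj M := homComplex L M
  map {M N} q := (linComp L M N (add_zero q)).flip
  map_id M q (x : linCochain L M q) := linComp_id x
  map_comp q f g (x : linCochain L _ q) :=
    (linComp_assoc (add_zero q) (add_zero 0) (add_zero q) (add_zero q) x f g).symm
  map_d q f (x : linCochain L _ q) := by
    refine Eq.trans ?_ (linδ_linComp (add_zero q) x f.toCochain).symm
    rw [Hom.linδ_toCochain, map_zero, zero_add, Int.negOnePow_zero, one_smul]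
    rfl

lemma preservesAcyclic_homLeft {L : DGModule A} (hL : L.IsKProjective) :
    (homLeft L).PreservesAcyclic := hL

end GradedFunctor

lemma DGAlgebra.d_mul' {k : Type u} [Field k] (A : DGAlgebra k) {i j n i' j' n' : ℤ}
    (h : i + j = n) (hi : i + 1 = i') (hj : j + 1 = j') (hn : n + 1 = n') (x : A.V.X i)
    (y : A.V.X j) :
    (A.V.d n n').hom (A.mul h x y) =
      A.mul (by omega : i' + j = n') ((A.V.d i i').hom x) y +
      i.negOnePow • A.mul (by omega : i + j' = n') x ((A.V.d j j').hom y) := by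
  subst hi hj hn
  exact A.d_mul h x y

/-- Build a left dg module from its graded pieces and the differentials `d n : X n → X (n + 1)`. -/
noncomputable def DGLeftModule.ofSucc {k : Type u} [Field k] {A : DGAlgebra k}
    (X : ℤ → ModuleCat.{u} k) (d : ∀ n, X n ⟶ X (n + 1)) (sq : ∀ n, d n ≫ d (n + 1) = 0)
    (act : ∀ {i j n : ℤ}, i + j = n → (A.V.X i →ₗ[k] X j →ₗ[k] X n))
    (one_act : ∀ {i : ℤ} (x : X i), act (zero_add i) A.one x = x)
    (mul_act : ∀ {i j l ij jl n : ℤ} (h₁ : i + j = ij) (h₂ : ij + l = n) (h₃ : j + l = jl)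
      (h₄ : i + jl = n) (a : A.V.X i) (b : A.V.X j) (x : X l),
      act h₂ (A.mul h₁ a b) x = act h₄ a (act h₃ b x))
    (d_act : ∀ {i j n : ℤ} (h : i + j = n) (a : A.V.X i) (x : X j),
      (d n).hom (act h a x) = act (by omega : (i + 1) + j = n + 1) ((A.V.d i (i + 1)).hom a) x +
        i.negOnePow • act (by omega : i + (j + 1) = n + 1) a ((d j).hom x)) :
    DGLeftModule A where
  V := CochainComplex.of X d sq
  lact := act
  one_lact := one_act
  mul_lact := mul_act
  d_lact h a x := by
    rw [DGVect.of_d_hom, DGVect.of_d_hom]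
    exact d_act h a x

/-! ### Free left dg modules -/

namespace DGFree

variable {k : Type u} [Field k] (A : DGAlgebra k) (K : DGVect k)

/-- The degree `n` part of `A ⊗_k K`. -/
abbrev X (n : ℤ) : Type u :=
  DirectSum {p : ℤ × ℤ // p.1 + p.2 = n} fun p => A.V.X p.1.1 ⊗[k] K.X p.1.2

/-- The pure tensors in `A ⊗_k K`. -/
noncomputable def tmul {i j n : ℤ} (h : i + j = n) : A.V.X i →ₗ[k] K.X j →ₗ[k] X A K n :=
  (TensorProduct.mk k (A.V.X i) (K.X j)).compr₂
    (DirectSum.lof k {p : ℤ × ℤ // p.1 + p.2 = n} (fun p => A.V.X p.1.1 ⊗[k] K.X p.1.2)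
      ⟨(i, j), h⟩)

variable {A K}

section lift

variable {W : Type u} [AddCommGroup W] [Module k W]

lemma hom_ext {n : ℤ} {f g : X A K n →ₗ[k] W}
    (h : ∀ (i j : ℤ) (hij : i + j = n) (a : A.V.X i) (x : K.X j),
      f (tmul A K hij a x) = g (tmul A K hij a x)) : f = g := by
  apply DirectSum.linearMap_ext
  rintro ⟨⟨i, j⟩, hij⟩
  apply TensorProduct.ext'
  intro a x
  exact h i j hij a x

/-- The linear map induced by a family of bilinear maps. -/
noncomputable def lift {n : ℤ} (φ : ∀ i j : ℤ, i + j = n → (A.V.X i →ₗ[k] K.X j →ₗ[k] W)) :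
    X A K n →ₗ[k] W :=
  DirectSum.toModule k _ W fun p => TensorProduct.lift (φ p.1.1 p.1.2 p.2)

lemma lift_tmul {n : ℤ} (φ : ∀ i j : ℤ, i + j = n → (A.V.X i →ₗ[k] K.X j →ₗ[k] W))
    {i j : ℤ} (h : i + j = n) (a : A.V.X i) (x : K.X j) :
    lift φ (tmul A K h a x) = φ i j h a x := by
  unfold lift tmul
  rw [LinearMap.compr₂_apply, DirectSum.toModule_lof]
  rfl

end lift

variable (A K)

/-- The differential `d (a ⊗ x) = d a ⊗ x + (-1)^{|a|} a ⊗ d x`. -/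
noncomputable def diff (n : ℤ) : X A K n →ₗ[k] X A K (n + 1) :=
  lift fun i j h =>
    (tmul A K (by omega : i + 1 + j = n + 1)).comp (A.V.d i (i + 1)).hom +
      i.negOnePow • (tmul A K (by omega : i + (j + 1) = n + 1)).compl₂ (K.d j (j + 1)).hom

lemma diff_tmul {i j n i' j' : ℤ} (h : i + j = n) (hi : i + 1 = i') (hj : j + 1 = j')
    (a : A.V.X i) (x : K.X j) :
    diff A K n (tmul A K h a x) =
      tmul A K (by omega : i' + j = n + 1) ((A.V.d i i').hom a) x +
      i.negOnePow • tmul A K (by omega : i + j' = n + 1) a ((K.d j j').hom x) := by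
  subst hi hj
  unfold diff
  rw [lift_tmul]
  rfl

lemma diff_diff (n : ℤ) : diff A K (n + 1) ∘ₗ diff A K n = 0 := by
  apply hom_ext
  intro i j h a x
  rw [LinearMap.comp_apply, diff_tmul A K h rfl rfl, map_add, Units.smul_def, map_zsmul,
    diff_tmul A K _ rfl rfl, diff_tmul A K _ rfl rfl]
  simp [DGVect.d_d, Units.smul_def, Int.negOnePow_succ]

/-- The action `a (b ⊗ x) = a b ⊗ x`. -/
noncomputable def lact {l m n : ℤ} (h : l + m = n) : A.V.X l →ₗ[k] X A K m →ₗ[k] X A K n :=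
  (lift (W := A.V.X l →ₗ[k] X A K n)
    (fun i j hij => LinearMap.mk₂ k
      (fun b x => ((tmul A K (by omega : l + i + j = n)).flip x).comp ((A.mul rfl).flip b))
      (by intros; ext; simp) (by intros; ext; simp) (by intros; ext; simp)
      (by intros; ext; simp))).flip

lemma lact_tmul {i j l m n li : ℤ} (hij : i + j = m) (h : l + m = n) (hli : l + i = li)
    (a : A.V.X l) (b : A.V.X i) (x : K.X j) :
    lact A K h a (tmul A K hij b x) = tmul A K (by omega : li + j = n) (A.mul hli a b) x := by
  subst hli
  unfold lact
  rw [LinearMap.flip_apply, lift_tmul]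
  rfl

lemma diff_lact {i j n : ℤ} (h : i + j = n) (a : A.V.X i) (z : X A K j) :
    diff A K n (lact A K h a z) = lact A K (by omega : i + 1 + j = n + 1)
        ((A.V.d i (i + 1)).hom a) z +
      i.negOnePow • lact A K (by omega : i + (j + 1) = n + 1) a (diff A K j z) := by
  have : diff A K n ∘ₗ lact A K h a = lact A K (by omega : i + 1 + j = n + 1)
        ((A.V.d i (i + 1)).hom a) +
      i.negOnePow • lact A K (by omega : i + (j + 1) = n + 1) a ∘ₗ diff A K j := by
    apply hom_ext
    intro p q hpq b x
    simp only [LinearMap.comp_apply, LinearMap.add_apply, LinearMap.smul_apply, Units.smul_def]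
    rw [lact_tmul A K _ _ rfl, lact_tmul A K _ _ rfl,
      diff_tmul A K _ (by omega : i + p + 1 = i + 1 + p) rfl, diff_tmul A K _ rfl rfl,
      A.d_mul' _ rfl rfl (by omega)]
    simp only [map_add, LinearMap.add_apply, Units.smul_def, map_zsmul, LinearMap.smul_apply,
      smul_add, smul_smul]
    rw [lact_tmul A K _ _ (by omega : i + (p + 1) = i + 1 + p), lact_tmul A K _ _ rfl]
    simp only [Int.negOnePow_add, Units.val_mul]
    abel
  exact LinearMap.congr_fun this z

/-- The free left dg module `A ⊗_k K`. -/
noncomputable def _root_.DGLeftModule.free : DGLeftModule A :=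
  DGLeftModule.ofSucc (fun n => ModuleCat.of k (X A K n)) (fun n => ModuleCat.ofHom (diff A K n))
    (fun n => by rw [← ModuleCat.ofHom_comp, diff_diff]; rfl)
    (fun h => lact A K h)
    (fun {i} z => by
      have : lact A K (zero_add i) A.one = LinearMap.id := by
        apply hom_ext
        intro p q h b x
        rw [lact_tmul A K _ _ (zero_add p), A.one_mul]
        rfl
      exact LinearMap.congr_fun this z)
    (fun {i j l ij jl n} h₁ h₂ h₃ h₄ a b z => by
      have : lact A K h₂ (A.mul h₁ a b) = lact A K h₄ a ∘ₗ lact A K h₃ b := by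
        apply hom_ext
        intro p q h c x
        rw [LinearMap.comp_apply, lact_tmul A K _ _ rfl, lact_tmul A K _ _ rfl,
          lact_tmul A K _ _ (by omega : i + (j + p) = ij + p), A.mul_assoc h₁ rfl rfl (by omega)]
      exact LinearMap.congr_fun this z)
    (fun h a z => diff_lact A K h a z)

lemma free_d (n : ℤ) : ((DGLeftModule.free A K).V.d n (n + 1)).hom = diff A K n :=
  DGVect.of_d_hom (fun n => ModuleCat.of k (X A K n)) (fun n => ModuleCat.ofHom (diff A K n))
    (fun n => by rw [← ModuleCat.ofHom_comp, diff_diff]; rfl) n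

/-- The inclusion of the generators, `x ↦ 1 ⊗ x`. -/
noncomputable def unit : K ⟶ (DGLeftModule.free A K).V :=
  DGVect.mkHom (W := (DGLeftModule.free A K).V) (fun n => tmul A K (zero_add n) A.one)
    (fun n x => by
      rw [free_d]
      refine Eq.trans ?_ (diff_tmul A K (zero_add n) rfl rfl A.one x).symm
      rw [DGModule.d_one, map_zero, LinearMap.zero_apply, zero_add, Int.negOnePow_zero, one_smul]
      rfl)

lemma lact_unit {i j n : ℤ} (h : i + j = n) (a : A.V.X i) (x : K.X j) :
    (DGLeftModule.free A K).lact h a (((unit A K).f j).hom x) = tmul A K h a x := by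
  refine (lact_tmul A K (zero_add j) h (add_zero i) a A.one x).trans ?_
  rw [A.mul_one]

variable {A K}

/-- The map `a ⊗ x ↦ a φ(x)` in each degree. -/
noncomputable def descT {L : DGLeftModule A} (φ : K ⟶ L.V) (n : ℤ) : X A K n →ₗ[k] L.V.X n :=
  lift fun _ j h => (L.lact h).compl₂ (φ.f j).hom

lemma descT_tmul {L : DGLeftModule A} (φ : K ⟶ L.V) {i j n : ℤ} (h : i + j = n) (a : A.V.X i)
    (x : K.X j) : descT φ n (tmul A K h a x) = L.lact h a ((φ.f j).hom x) := by
  unfold descT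
  rw [lift_tmul]
  rfl

lemma descT_diff {L : DGLeftModule A} (φ : K ⟶ L.V) (n : ℤ) (z : X A K n) :
    descT φ (n + 1) (diff A K n z) = (L.V.d n (n + 1)).hom (descT φ n z) := by
  refine LinearMap.congr_fun (f := descT φ (n + 1) ∘ₗ diff A K n)
    (g := (L.V.d n (n + 1)).hom ∘ₗ descT φ n) (hom_ext fun i j h a x => ?_) z
  rw [LinearMap.comp_apply, LinearMap.comp_apply, diff_tmul A K h rfl rfl, map_add,
    Units.smul_def, map_zsmul, descT_tmul, descT_tmul, descT_tmul, L.d_lact, DGVect.map_d,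
    Units.smul_def]

lemma descT_lact {L : DGLeftModule A} (φ : K ⟶ L.V) {i j n : ℤ} (h : i + j = n) (a : A.V.X i)
    (z : X A K j) : descT φ n (lact A K h a z) = L.lact h a (descT φ j z) := by
  refine LinearMap.congr_fun (f := descT φ n ∘ₗ lact A K h a)
    (g := (L.lact h a) ∘ₗ descT φ j) (hom_ext fun p q hpq b x => ?_) z
  rw [LinearMap.comp_apply, LinearMap.comp_apply, lact_tmul A K hpq h rfl, descT_tmul, descT_tmul,
    L.mul_lact rfl _ hpq h]

/-- The morphism of left modules `a ⊗ x ↦ a φ(x)`. -/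
noncomputable def desc {L : DGLeftModule A} (φ : K ⟶ L.V) :
    DGLeftModule.Hom (DGLeftModule.free A K) L where
  f := DGVect.mkHom (V := (DGLeftModule.free A K).V) (fun n => descT φ n) (fun n z => by
    rw [free_d]
    exact descT_diff φ n z)
  map_lact h a z := descT_lact φ h a z

lemma desc_tmul {L : DGLeftModule A} (φ : K ⟶ L.V) {i j n : ℤ} (h : i + j = n) (a : A.V.X i)
    (x : K.X j) : ((desc φ).f.f n).hom (tmul A K h a x) = L.lact h a ((φ.f j).hom x) :=
  descT_tmul φ h a x

lemma desc_unit {L : DGLeftModule A} (φ : K ⟶ L.V) {n : ℤ} (x : K.X n) :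
    ((desc φ).f.f n).hom (((unit A K).f n).hom x) = (φ.f n).hom x :=
  (desc_tmul φ (zero_add n) A.one x).trans (L.one_lact _)

end DGFree

/-! ### The bar complex of a left dg module -/

namespace DGLeftModule

variable {k : Type u} [Field k] {A : DGAlgebra k} (N : DGLeftModule A)

/-- The iterated free modules `A ⊗ ⋯ ⊗ A ⊗ N`. -/
noncomputable def barStage : ℕ → DGLeftModule A
  | 0 => N
  | i + 1 => free A (barStage i).V

/-- The step in the construction of the bar differentials. -/
noncomputable def barDSucc {K : DGVect k} {P : DGLeftModule A} (f : (free A K).V ⟶ P.V)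
    (g : P.V ⟶ (free A K).V) : Hom (free A (free A K).V) (free A K) :=
  DGFree.desc (𝟙 (free A K).V - f ≫ g)

/-- The bar differentials `∂`, determined by `∂ (1 ⊗ x) = x - 1 ⊗ ∂ x`. -/
noncomputable def barD : ∀ i : ℕ, Hom (barStage N (i + 1)) (barStage N i)
  | 0 => DGFree.desc (𝟙 N.V)
  | i + 1 => barDSucc (barD i).f (DGFree.unit A (barStage N i).V)

/-- The contraction `x ↦ 1 ⊗ x`. -/
noncomputable def barS (i : ℕ) : (barStage N i).V ⟶ (barStage N (i + 1)).V :=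
  DGFree.unit A (barStage N i).V

lemma barD_barS_zero {n : ℤ} (x : N.V.X n) :
    ((barD N 0).f.f n).hom (((barS N 0).f n).hom x) = x :=
  DGFree.desc_unit (𝟙 N.V) x

/-- This is the contraction identity `∂ s + s ∂ = 1`. It serves as the definition of `∂` on the
generators `1 ⊗ x`, so that exactness of the augmented bar complex is built in. -/
lemma barD_barS_succ (i : ℕ) {n : ℤ} (x : (barStage N (i + 1)).V.X n) :
    ((barD N (i + 1)).f.f n).hom (((barS N (i + 1)).f n).hom x) =
      x - ((barS N i).f n).hom (((barD N i).f.f n).hom x) :=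
  DGFree.desc_unit _ x

/-- Each stage after the zeroth is spanned by the products `a · s x`, being free on the previous
one. -/
lemma barStage_hom_ext {W : Type u} [AddCommGroup W] [Module k W] {i : ℕ} {n : ℤ}
    {f g : (barStage N (i + 1)).V.X n →ₗ[k] W}
    (h : ∀ (p q : ℤ) (hpq : p + q = n) (a : A.V.X p) (x : (barStage N i).V.X q),
      f ((barStage N (i + 1)).lact hpq a (((barS N i).f q).hom x)) =
        g ((barStage N (i + 1)).lact hpq a (((barS N i).f q).hom x))) : f = g := by
  refine DGFree.hom_ext fun p q hpq a x => ?_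
  have h1 := h p q hpq a x
  rwa [show (barStage N (i + 1)).lact hpq a (((barS N i).f q).hom x) = _ from
    DGFree.lact_unit A (barStage N i).V hpq a x] at h1

/-- By `A`-linearity it is enough to test on `s y`, where `∂ ∂ s y = ∂ y - ∂ s ∂ y`. The contraction
identity one stage lower rewrites the second term as `∂ y - s ∂ ∂ y`, and induction applies. -/
lemma barD_barD (i : ℕ) {n : ℤ} (x : (barStage N (i + 1 + 1)).V.X n) :
    ((barD N i).f.f n).hom (((barD N (i + 1)).f.f n).hom x) = 0 := by
  refine LinearMap.congr_fun (f := ((barD N i).f.f n).hom ∘ₗ ((barD N (i + 1)).f.f n).hom)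
    (g := 0) (barStage_hom_ext N fun p q hpq a y => ?_) x
  rw [LinearMap.comp_apply, (barD N (i + 1)).map_lact, (barD N i).map_lact, barD_barS_succ,
    LinearMap.zero_apply, map_sub]
  cases i with
  | zero =>
    refine (congrArg (N.lact hpq a) (sub_eq_zero.2 ?_)).trans (map_zero _)
    exact (barD_barS_zero N _).symm
  | succ i => rw [barD_barS_succ, barD_barD i, map_zero, sub_zero, sub_self, map_zero]

end DGLeftModule

/-! ### Total complexes of complexes of left dg modules -/

namespace DGTot

variable {k : Type u} [Field k] {A : DGAlgebra k} (Q : ℕ → DGLeftModule A)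
  (D : ∀ i, DGLeftModule.Hom (Q (i + 1)) (Q i))

/-- The degree `n` part of the total complex of `⋯ → Q 1 → Q 0`. -/
abbrev X (n : ℤ) : Type u :=
  DirectSum {s : ℕ × ℤ // s.2 - s.1 = n} fun s => (Q s.1.1).V.X s.1.2

/-- The inclusions in the total complex. -/
noncomputable def ι (i : ℕ) {q n : ℤ} (h : q - i = n) : (Q i).V.X q →ₗ[k] X Q n :=
  DirectSum.lof k {s : ℕ × ℤ // s.2 - s.1 = n} (fun s => (Q s.1.1).V.X s.1.2) ⟨(i, q), h⟩

variable {Q}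

section lift

variable {W : Type u} [AddCommGroup W] [Module k W]

lemma hom_ext {n : ℤ} {f g : X Q n →ₗ[k] W}
    (hfg : ∀ (i : ℕ) (q : ℤ) (h : q - i = n) (x : (Q i).V.X q), f (ι Q i h x) = g (ι Q i h x)) :
    f = g := by
  apply DirectSum.linearMap_ext
  rintro ⟨⟨i, q⟩, hi⟩
  apply LinearMap.ext
  intro x
  exact hfg i q hi x

/-- Linear maps out of the total complex. -/
noncomputable def lift {n : ℤ} (φ : ∀ (i : ℕ) (q : ℤ), q - i = n → ((Q i).V.X q →ₗ[k] W)) :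
    X Q n →ₗ[k] W :=
  DirectSum.toModule k _ W fun s => φ s.1.1 s.1.2 s.2

lemma lift_ι {n : ℤ} (φ : ∀ (i : ℕ) (q : ℤ), q - i = n → ((Q i).V.X q →ₗ[k] W)) (i : ℕ) {q : ℤ}
    (h : q - i = n) (x : (Q i).V.X q) : lift φ (ι Q i h x) = φ i q h x :=
  DirectSum.toModule_lof _ _ _

end lift

/-- The horizontal part of the differential. -/
noncomputable def low : ∀ (i : ℕ) {q n : ℤ}, q - i = n → ((Q i).V.X q →ₗ[k] X Q (n + 1))
  | 0, _, _, _ => 0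
  | i + 1, q, n, h =>
    q.negOnePow • ι Q i (by push_cast at h; omega : q - i = n + 1) ∘ₗ ((D i).f.f q).hom

lemma low_zero {q n : ℤ} (h : q - (0 : ℕ) = n) (x : (Q 0).V.X q) : low D 0 h x = 0 := rfl

lemma low_succ (i : ℕ) {q n : ℤ} (h : q - (i + 1 : ℕ) = n) (x : (Q (i + 1)).V.X q) :
    low D (i + 1) h x = q.negOnePow • ι Q i (by push_cast at h; omega : q - i = n + 1)
      (((D i).f.f q).hom x) := rfl

/-- The differential of the total complex. -/
noncomputable def diff (n : ℤ) : X Q n →ₗ[k] X Q (n + 1) :=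
  lift fun i q h => ι Q i (by omega : q + 1 - i = n + 1) ∘ₗ ((Q i).V.d q (q + 1)).hom + low D i h

lemma diff_ι (i : ℕ) {q q' n : ℤ} (h : q - i = n) (hq : q + 1 = q') (x : (Q i).V.X q) :
    diff D n (ι Q i h x) =
      ι Q i (by omega : q' - i = n + 1) (((Q i).V.d q q').hom x) + low D i h x := by
  subst hq
  exact lift_ι _ i h x

/-- The sign `(-1)^q` of the horizontal part, with `q` the internal degree, flips when the internal
differential is applied first; thus the mixed terms cancel. -/
lemma diff_diff (hD : ∀ (i : ℕ) (n : ℤ) (x : (Q (i + 1 + 1)).V.X n),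
    ((D i).f.f n).hom (((D (i + 1)).f.f n).hom x) = 0) (n : ℤ) :
    diff D (n + 1) ∘ₗ diff D n = 0 := by
  refine hom_ext fun i q h x => ?_
  rw [LinearMap.comp_apply, diff_ι D i h rfl, map_add, diff_ι D i _ rfl, DGVect.d_d, map_zero,
    zero_add, LinearMap.zero_apply]
  cases i with
  | zero => rw [low_zero, low_zero, map_zero, zero_add]
  | succ i =>
    rw [low_succ, low_succ, Units.smul_def q.negOnePow, map_zsmul, diff_ι D i _ rfl,
      DGVect.map_d, Int.negOnePow_succ, Units.neg_smul, Units.smul_def, smul_add]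
    cases i with
    | zero => rw [low_zero, smul_zero, add_zero, neg_add_cancel]
    | succ i => rw [low_succ, hD, map_zero, smul_zero, smul_zero, add_zero, neg_add_cancel]

/-- The action of `A` on the total complex. -/
noncomputable def lact {l m n : ℤ} (h : l + m = n) : A.V.X l →ₗ[k] X Q m →ₗ[k] X Q n :=
  (lift (W := A.V.X l →ₗ[k] X Q n) fun i q hq =>
    ((Q i).lact (rfl : l + q = l + q)).flip.compr₂ (ι Q i (by omega : l + q - i = n))).flip

lemma lact_ι {i : ℕ} {l m n q lq : ℤ} (hq : q - i = m) (h : l + m = n) (hlq : l + q = lq)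
    (a : A.V.X l) (x : (Q i).V.X q) :
    lact h a (ι Q i hq x) = ι Q i (by omega : lq - i = n) ((Q i).lact hlq a x) := by
  subst hlq
  unfold lact
  rw [LinearMap.flip_apply, lift_ι]
  rfl

/-- Acting by `a` of degree `l` raises the internal degree by `l`, so the sign `(-1)^q` of the
horizontal part changes by the Leibniz sign `(-1)^l`. The action on the total complex therefore
carries no sign. -/
lemma low_lact {i : ℕ} {l m n q lq : ℤ} (hq : q - i = m) (h : l + m = n) (hlq : l + q = lq)
    (a : A.V.X l) (x : (Q i).V.X q) :
    low D i (by omega : lq - i = n) ((Q i).lact hlq a x) =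
      l.negOnePow • lact (by omega : l + (m + 1) = n + 1) a (low D i hq x) := by
  cases i with
  | zero => rw [low_zero, low_zero, map_zero, smul_zero]
  | succ i =>
    rw [low_succ, low_succ, (D i).map_lact, Units.smul_def q.negOnePow, map_zsmul,
      lact_ι _ _ hlq, ← Units.smul_def, smul_smul, ← Int.negOnePow_add, hlq]

lemma diff_lact {i j n : ℤ} (h : i + j = n) (a : A.V.X i) (z : X Q j) :
    diff D n (lact h a z) = lact (by omega : i + 1 + j = n + 1) ((A.V.d i (i + 1)).hom a) z +
      i.negOnePow • lact (by omega : i + (j + 1) = n + 1) a (diff D j z) := by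
  have : diff D n ∘ₗ lact h a = lact (by omega : i + 1 + j = n + 1) ((A.V.d i (i + 1)).hom a) +
      i.negOnePow • lact (by omega : i + (j + 1) = n + 1) a ∘ₗ diff D j := by
    refine hom_ext fun s q hq x => ?_
    simp only [LinearMap.comp_apply, LinearMap.add_apply, LinearMap.smul_apply]
    rw [lact_ι hq h rfl, diff_ι D s _ (rfl : i + q + 1 = i + q + 1), low_lact D hq h rfl,
      diff_ι D s hq rfl, (Q s).d_lact' rfl rfl rfl rfl, map_add, map_add, smul_add,
      lact_ι _ _ (by omega : i + 1 + q = i + q + 1),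
      lact_ι _ _ (by omega : i + (q + 1) = i + q + 1),
      Units.smul_def i.negOnePow, map_zsmul, ← Units.smul_def, add_assoc]
  exact LinearMap.congr_fun this z

/-- The total left dg module of a complex of left dg modules. -/
noncomputable def tot (hD : ∀ (i : ℕ) (n : ℤ) (x : (Q (i + 1 + 1)).V.X n),
    ((D i).f.f n).hom (((D (i + 1)).f.f n).hom x) = 0) : DGLeftModule A :=
  DGLeftModule.ofSucc (fun n => ModuleCat.of k (X Q n)) (fun n => ModuleCat.ofHom (diff D n))
    (fun n => by rw [← ModuleCat.ofHom_comp, diff_diff D hD]; rfl)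
    (fun h => lact h)
    (fun {i} z => by
      have : lact (Q := Q) (zero_add i) A.one = LinearMap.id := by
        refine hom_ext fun s q hq x => ?_
        rw [lact_ι _ _ (zero_add q), (Q s).one_lact]
        rfl
      exact LinearMap.congr_fun this z)
    (fun {i j l ij jl n} h₁ h₂ h₃ h₄ a b z => by
      have : lact (Q := Q) h₂ (A.mul h₁ a b) = lact h₄ a ∘ₗ lact h₃ b := by
        refine hom_ext fun s q hq x => ?_
        rw [LinearMap.comp_apply, lact_ι _ _ rfl, lact_ι _ _ rfl,
          lact_ι _ _ (by omega : i + (j + q) = ij + q), (Q s).mul_lact h₁ rfl rfl (by omega)]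
      exact LinearMap.congr_fun this z)
    (fun h a z => diff_lact D h a z)

lemma tot_d (hD : ∀ (i : ℕ) (n : ℤ) (x : (Q (i + 1 + 1)).V.X n),
    ((D i).f.f n).hom (((D (i + 1)).f.f n).hom x) = 0) (n : ℤ) :
    ((tot D hD).V.d n (n + 1)).hom = diff D n :=
  DGVect.of_d_hom (fun n => ModuleCat.of k (X Q n)) (fun n => ModuleCat.ofHom (diff D n))
    (fun n => by rw [← ModuleCat.ofHom_comp, diff_diff D hD]; rfl) n

end DGTot

/-! ### The bar resolution -/

namespace DGLeftModule

open DGTot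

variable {k : Type u} [Field k] {A : DGAlgebra k} (N : DGLeftModule A)

/-- The bar resolution of a left dg module. -/
noncomputable def barRes : DGLeftModule A :=
  tot (Q := fun i => barStage N (i + 1)) (fun i => barD N (i + 1))
    fun i _ x => barD_barD N (i + 1) x

/-- The terms of the bar resolution. -/
noncomputable abbrev barQ (i : ℕ) : DGLeftModule A := barStage N (i + 1)

/-- The augmentation of the bar resolution in each degree. -/
noncomputable def barAugT (n : ℤ) : X (barQ N) n →ₗ[k] N.V.X n :=
  lift fun i => match i with
    | 0 => fun q h => ((barD N 0).f.f n).hom ∘ₗ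
        (barQ N 0).V.castX (by simpa using h : q = n)
    | _ + 1 => fun _ _ => 0

lemma barAugT_ι_zero {n : ℤ} (h : n - (0 : ℕ) = n) (x : (barQ N 0).V.X n) :
    barAugT N n (ι (barQ N) 0 h x) = ((barD N 0).f.f n).hom x :=
  lift_ι _ 0 h x

lemma barAugT_ι_succ (i : ℕ) {q n : ℤ} (h : q - (i + 1 : ℕ) = n) (x : (barQ N (i + 1)).V.X q) :
    barAugT N n (ι (barQ N) (i + 1) h x) = 0 :=
  lift_ι _ (i + 1) h x

lemma barAugT_diff (n : ℤ) (z : X (barQ N) n) :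
    barAugT N (n + 1) (diff (Q := barQ N) (fun i => barD N (i + 1)) n z) =
      (N.V.d n (n + 1)).hom (barAugT N n z) := by
  refine LinearMap.congr_fun (f := barAugT N (n + 1) ∘ₗ
      diff (Q := barQ N) (fun i => barD N (i + 1)) n)
    (g := (N.V.d n (n + 1)).hom ∘ₗ barAugT N n) (hom_ext fun i q h x => ?_) z
  rw [LinearMap.comp_apply, LinearMap.comp_apply, diff_ι _ i h rfl, map_add]
  match i with
  | 0 =>
    obtain rfl : q = n := by simpa using h
    rw [low_zero, map_zero, add_zero, barAugT_ι_zero, barAugT_ι_zero]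
    exact DGVect.map_d _ _ _ _
  -- Only here does the horizontal part reach the augmented column; its image is killed since `∂ ∂ =
  -- 0`.
  | 1 =>
    obtain rfl : q = n + 1 := by simp at h; omega
    rw [barAugT_ι_succ, barAugT_ι_succ, low_succ, Units.smul_def, map_zsmul, map_zero, zero_add]
    refine (congrArg _ (barAugT_ι_zero N _ _)).trans ?_
    exact (congrArg _ (barD_barD N 0 _)).trans (zsmul_zero _)
  | i + 2 =>
    rw [barAugT_ι_succ, barAugT_ι_succ, low_succ, Units.smul_def, map_zsmul, map_zero, zero_add]
    exact (congrArg _ (barAugT_ι_succ N i _ _)).trans (smul_zero _)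

lemma barAugT_lact {i j n : ℤ} (h : i + j = n) (a : A.V.X i) (z : X (barQ N) j) :
    barAugT N n (DGTot.lact h a z) = N.lact h a (barAugT N j z) := by
  refine LinearMap.congr_fun (f := barAugT N n ∘ₗ DGTot.lact h a)
    (g := N.lact h a ∘ₗ barAugT N j) (hom_ext fun s q hq x => ?_) z
  rw [LinearMap.comp_apply, LinearMap.comp_apply, lact_ι hq h rfl]
  match s with
  | 0 =>
    obtain rfl : q = j := by simpa using hq
    subst h
    rw [barAugT_ι_zero, barAugT_ι_zero]
    exact (barD N 0).map_lact rfl a x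
  | s + 1 => rw [barAugT_ι_succ, barAugT_ι_succ, map_zero]

lemma barRes_d (n : ℤ) :
    ((barRes N).V.d n (n + 1)).hom = diff (Q := barQ N) (fun i => barD N (i + 1)) n :=
  tot_d (Q := barQ N) _ _ n

/-- The augmentation of the bar resolution. -/
noncomputable def barAug : Hom (barRes N) N where
  f := DGVect.mkHom (V := (barRes N).V) (fun n => barAugT N n) (fun n z => by
    rw [barRes_d]
    exact barAugT_diff N n z)
  map_lact h a z := barAugT_lact N h a z

/-- The contracting homotopy of the bar resolution. -/
noncomputable def barHtpy {n n' : ℤ} (hn : n' + 1 = n) : X (barQ N) n →ₗ[k] X (barQ N) n' :=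
  lift fun i q h => q.negOnePow • ι (barQ N) (i + 1) (by push_cast; omega : q - (i + 1 : ℕ) = n') ∘ₗ
    ((barS N (i + 1)).f q).hom

lemma barHtpy_ι {n n' : ℤ} (hn : n' + 1 = n) (i : ℕ) {q : ℤ} (h : q - i = n)
    (x : (barQ N i).V.X q) :
    barHtpy N hn (ι (barQ N) i h x) = q.negOnePow •
      ι (barQ N) (i + 1) (by push_cast; omega : q - (i + 1 : ℕ) = n')
        (((barS N (i + 1)).f q).hom x) :=
  lift_ι _ i h x

/-- The graded section of the augmentation of the bar resolution. -/
noncomputable def barIncl (n : ℤ) : N.V.X n →ₗ[k] X (barQ N) n :=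
  ι (barQ N) 0 (by simp) ∘ₗ ((DGFree.unit A N.V).f n).hom

lemma barAugT_barIncl (n : ℤ) (y : N.V.X n) : barAugT N n (barIncl N n y) = y :=
  (barAugT_ι_zero N _ _).trans (barD_barS_zero N y)

lemma diff_barIncl (n : ℤ) (y : N.V.X n) :
    diff (Q := barQ N) (fun i => barD N (i + 1)) n (barIncl N n y) =
      barIncl N (n + 1) ((N.V.d n (n + 1)).hom y) := by
  refine (diff_ι (Q := barQ N) _ 0 _ rfl _).trans ((add_zero _).trans ?_)
  exact congrArg (ι (barQ N) 0 (by simp)) (DGVect.map_d (DGFree.unit A N.V) n (n + 1) y).symm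

lemma barIncl_barAugT (n : ℤ) (h : n - (0 : ℕ) = n) (x : (barQ N 0).V.X n) :
    ι (barQ N) 0 h (((barD N 1).f.f n).hom (((barS N 1).f n).hom x)) =
      ι (barQ N) 0 h x - barIncl N n (barAugT N n (ι (barQ N) 0 h x)) := by
  refine (congrArg _ (barD_barS_succ N 0 x)).trans ((map_sub _ _ _).trans (congrArg _ ?_))
  rw [barAugT_ι_zero]
  rfl

/-- The contraction of the bar complex, with sign `(-1)^q`, anticommutes with the internal
differential. Hence it is a homotopy from the identity to the composite of augmentation and
`barIncl`. Neither the homotopy nor `barIncl` needs to be `A`-linear. -/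
lemma barHtpy_diff (n : ℤ) (z : X (barQ N) (n + 1)) :
    diff (Q := barQ N) (fun i => barD N (i + 1)) n (barHtpy N rfl z) +
      barHtpy N rfl (diff (Q := barQ N) (fun i => barD N (i + 1)) (n + 1) z) =
      z - barIncl N (n + 1) (barAugT N (n + 1) z) := by
  refine LinearMap.congr_fun
    (f := diff (Q := barQ N) (fun i => barD N (i + 1)) n ∘ₗ barHtpy N rfl +
      barHtpy N rfl ∘ₗ diff (Q := barQ N) (fun i => barD N (i + 1)) (n + 1))
    (g := LinearMap.id - barIncl N (n + 1) ∘ₗ barAugT N (n + 1)) (hom_ext fun i q h x => ?_) z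
  simp only [LinearMap.add_apply, LinearMap.sub_apply, LinearMap.comp_apply, LinearMap.id_apply]
  rw [barHtpy_ι, diff_ι _ i h rfl, map_add, barHtpy_ι, Units.smul_def q.negOnePow, map_zsmul,
    diff_ι _ (i + 1) _ rfl, low_succ, DGVect.map_d]
  have hs (y : X (barQ N) (n + 1)) : (q.negOnePow : ℤ) • q.negOnePow • y = y := by
    rw [← Units.smul_def, smul_smul, ← Int.negOnePow_add, Int.negOnePow_even _ ⟨q, rfl⟩, one_smul]
  rw [smul_add, hs, Int.negOnePow_succ, Units.neg_smul, Units.smul_def]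
  match i with
  | 0 =>
    obtain rfl : q = n + 1 := by simpa using h
    rw [low_zero, map_zero, add_zero]
    refine (add_right_comm _ _ _).trans ?_
    refine (congrArg (· + _) (add_neg_cancel _)).trans ((zero_add _).trans ?_)
    exact barIncl_barAugT N (n + 1) h x
  | i + 1 =>
    rw [barAugT_ι_succ, low_succ, Units.smul_def q.negOnePow, map_zsmul, barHtpy_ι, hs,
      barD_barS_succ, map_sub, map_zero]
    abel

/-- The bar resolution is a resolution. -/
lemma quasiIso_barAug : QuasiIso (barAug N).f := by
  rw [DGVect.quasiIso_iff]
  constructor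
  · intro n (x : X (barQ N) (n + 1)) w hx hw
    rw [barRes_d] at hx ⊢
    have h := barHtpy_diff N n x
    -- For a cocycle `x` the homotopy formula gives `d h x = x - incl (aug x)`, and `aug x = d w`.
    refine ⟨barIncl N n w + barHtpy N rfl x, ?_⟩
    refine (map_add (diff (Q := barQ N) (fun i => barD N (i + 1)) n) _ _).trans ?_
    have hx' : diff (Q := barQ N) (fun i => barD N (i + 1)) (n + 1) x = 0 := hx
    have hw' : (N.V.d n (n + 1)).hom w = barAugT N (n + 1) x := hw
    rw [hx', map_zero, add_zero] at h
    rw [h, diff_barIncl, hw']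
    exact add_sub_cancel _ _
  · intro n y hy
    refine ⟨barIncl N (n + 1) y, 0, ?_, ?_⟩
    · rw [barRes_d]
      refine (diff_barIncl N (n + 1) y).trans ?_
      rw [hy, map_zero]
      rfl
    · rw [map_zero, add_zero]
      exact (barAugT_barIncl N (n + 1) y).symm

end DGLeftModule

/-! ### Contractions of acyclic complexes over a field -/

lemma LinearMap.exists_pseudoinverse {k V W : Type*} [Field k] [AddCommGroup V] [Module k V]
    [AddCommGroup W] [Module k W] (f : V →ₗ[k] W) : ∃ g : W →ₗ[k] V, ∀ x, f (g (f x)) = f x := by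
  obtain ⟨r, hr⟩ := f.rangeRestrict.exists_rightInverse_of_surjective f.range_rangeRestrict
  obtain ⟨g, hg⟩ := r.exists_extend
  refine ⟨g, fun x => ?_⟩
  have h1 : g (f x) = r (f.rangeRestrict x) := LinearMap.congr_fun hg (f.rangeRestrict x)
  rw [h1]
  exact congrArg Subtype.val (LinearMap.congr_fun hr (f.rangeRestrict x))

/-- With pseudoinverses `g` of the differentials, put `s = g (1 - g d)`. Then `s d x = g d x`, while
`x - g d x` is a cocycle, hence a coboundary, and is fixed by `d g`. The map `s` is indexed by all
pairs of degrees to avoid casts; only the pairs that differ by one matter. -/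
lemma DGVect.exists_contraction {k : Type u} [Field k] {V : DGVect k} (hV : V.Acyclic) :
    ∃ s : ∀ p p' : ℤ, V.X p →ₗ[k] V.X p', ∀ {p p' p'' : ℤ}, p' + 1 = p → p + 1 = p'' →
      ∀ x : V.X p, (V.d p' p).hom (s p p' x) + s p'' p ((V.d p p'').hom x) = x := by
  choose g hg using fun p p' : ℤ => LinearMap.exists_pseudoinverse (V.d p' p).hom
  refine ⟨fun p p' => g p p' ∘ₗ (LinearMap.id - g (p + 1) p ∘ₗ (V.d p (p + 1)).hom), ?_⟩
  rintro p p' _ h rfl x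
  simp only [LinearMap.comp_apply, LinearMap.sub_apply, LinearMap.id_apply]
  rw [DGVect.d_d, map_zero, sub_zero]
  obtain ⟨w, hw⟩ := DGVect.exists_d_eq hV h rfl (x - g (p + 1) p ((V.d p (p + 1)).hom x)) (by
    rw [map_sub, hg, sub_self])
  rw [← hw, hg, hw, sub_add_cancel]

/-! ### K-flatness of the bar resolution -/

namespace DGLeftModule

open DGLeftTensor

variable {k : Type u} [Field k] {A : DGAlgebra k} (M : DGModule A) (N : DGLeftModule A)

/-- The pure tensors in the tensor product with the bar resolution. -/
noncomputable def barTmul {p r n : ℤ} (h : p + r = n) :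
    M.V.X p →ₗ[k] DGTot.X (barQ N) r →ₗ[k] T M (barRes N) n :=
  tmul M (barRes N) h

/-- The elements `x ⊗ ι (1 ⊗ y)` of the tensor product with the bar resolution. -/
noncomputable def barGen (i : ℕ) {p q n : ℤ} (h : p + (q - i) = n) :
    M.V.X p →ₗ[k] (barStage N i).V.X q →ₗ[k] T M (barRes N) n :=
  (barTmul M N h).compl₂ (DGTot.ι (barQ N) i rfl ∘ₗ ((barS N i).f q).hom)

variable {M N}

lemma barTmul_ι_barS {i : ℕ} {p q r n : ℤ} (h : p + r = n) (hq : q - i = r) (x : M.V.X p)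
    (y : (barStage N i).V.X q) :
    barTmul M N h x (DGTot.ι (barQ N) i hq (((barS N i).f q).hom y)) =
      barGen M N i (by omega) x y := by
  subst hq
  rfl

/-- Moving the coefficient across the tensor sign realizes `M ⊗_A (A ⊗_k K) ≅ M ⊗_k K` in each
column, so the elements `barGen` span. -/
lemma tmul_ι_lact {i : ℕ} {p q r s n ps rs: ℤ} (h : p + r = n) (hq : q - i = r) (hs : s + rs = q)
    (hps : p + s = ps) (x : M.V.X p) (a : A.V.X s) (y : (barStage N i).V.X rs) :
    barTmul M N h x (DGTot.ι (barQ N) i hq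
      ((barStage N (i + 1)).lact hs a (((barS N i).f rs).hom y))) =
    barGen M N i (by omega : ps + (rs - i) = n) (M.ract hps x a) y := by
  refine (congrArg _ (DGTot.lact_ι (Q := barQ N) rfl (by omega) hs a _).symm).trans ?_
  exact (tmul_balanced (X := barRes N) hps _ (by omega : s + (rs - i) = r) _ _ _ _).symm

/-- The extension of a graded map `s` on `M` to the tensor product with the bar resolution,
by `x ⊗ ι (1 ⊗ y) ↦ s x ⊗ ι (1 ⊗ y)`, as a function of the second argument. -/
noncomputable def barExtAux (s : ∀ p p' : ℤ, M.V.X p →ₗ[k] M.V.X p') {n n' p r : ℤ}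
    (h : p + r = n) : DGTot.X (barQ N) r →ₗ[k] M.V.X p →ₗ[k] T M (barRes N) n' :=
  DGTot.lift (Q := barQ N) (W := M.V.X p →ₗ[k] T M (barRes N) n') fun i q hq =>
    (DGFree.lift (A := A) (K := (barStage N i).V) (W := M.V.X p →ₗ[k] T M (barRes N) n')
      fun a b hab => LinearMap.mk₂ k
        (fun u y => (barGen M N i (by omega : n' - n + p + a + (b - i) = n')).flip y ∘ₗ
          s (p + a) (n' - n + p + a) ∘ₗ (M.ract rfl).flip u)
        (fun _ _ _ => LinearMap.ext fun _ => by simp)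
        (fun _ _ _ => LinearMap.ext fun _ => by simp)
        (fun _ _ _ => LinearMap.ext fun _ => by simp)
        (fun _ _ _ => LinearMap.ext fun _ => by simp))

lemma barExtAux_ι_lact (s : ∀ p p' : ℤ, M.V.X p →ₗ[k] M.V.X p') {n n' p r q a b pa pa' : ℤ}
    {i : ℕ} (h : p + r = n) (hq : q - i = r) (hab : a + b = q) (hpa : p + a = pa)
    (hpa' : pa' + (b - i) = n') (x : M.V.X p) (u : A.V.X a) (y : (barStage N i).V.X b) :
    barExtAux (N := N) s h (DGTot.ι (barQ N) i hq
      ((barStage N (i + 1)).lact hab u (((barS N i).f b).hom y))) x =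
      barGen M N i hpa' (s pa pa' (M.ract hpa x u)) y := by
  obtain rfl : pa' = n' - n + p + a := by omega
  subst hpa
  have h1 := DGFree.lact_unit A (barStage N i).V hab u y
  refine LinearMap.congr_fun (?_ : _ = (barGen M N i hpa').flip y ∘ₗ
          s (p + a) (n' - n + p + a) ∘ₗ (M.ract rfl).flip u) x
  refine (congrArg (fun w => barExtAux (N := N) s h (DGTot.ι (barQ N) i hq w)) h1).trans ?_
  refine (DGTot.lift_ι (Q := barQ N) _ i hq _).trans ?_
  exact DGFree.lift_tmul _ hab u y

/-- Although `s` is not `A`-linear, the extension is well defined: it sends `x ⊗ u (1 ⊗ y)` to `s (x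
u) ⊗ (1 ⊗ y)`, which depends only on the product `x u`. -/
lemma barExtAux_balanced (s : ∀ p p' : ℤ, M.V.X p →ₗ[k] M.V.X p') {n n' : ℤ} {i j l ij jl : ℤ}
    (h₁ : i + j = ij) (h₂ : ij + l = n) (h₃ : j + l = jl) (h₄ : i + jl = n) (x : M.V.X i)
    (a : A.V.X j) (y : DGTot.X (barQ N) l) :
    barExtAux (n' := n') s h₂ y (M.ract h₁ x a) = barExtAux s h₄ (DGTot.lact h₃ a y) x := by
  refine LinearMap.congr_fun (f := (barExtAux (n' := n') s h₂).flip (M.ract h₁ x a))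
    (g := (barExtAux s h₄).flip x ∘ₗ DGTot.lact h₃ a) (DGTot.hom_ext fun r q hq y => ?_) y
  refine LinearMap.congr_fun (f := (barExtAux (n' := n') s h₂).flip (M.ract h₁ x a) ∘ₗ
      DGTot.ι (barQ N) r hq)
    (g := ((barExtAux s h₄).flip x ∘ₗ DGTot.lact h₃ a) ∘ₗ DGTot.ι (barQ N) r hq)
    (barStage_hom_ext N fun b t hbt u z => ?_) y
  simp only [LinearMap.comp_apply, LinearMap.flip_apply]
  rw [barExtAux_ι_lact s h₂ hq hbt rfl (by omega : n' + r - t + (t - r) = n'),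
    DGTot.lact_ι hq h₃ rfl]
  refine Eq.trans ?_ (congrArg (fun w => barExtAux (N := N) s h₄ (DGTot.ι (barQ N) r _ w) x)
    ((barStage N (r + 1)).mul_lact rfl (by omega : j + b + t = j + q) hbt rfl a u _))
  refine Eq.trans ?_ (barExtAux_ι_lact s h₄ _ _ (by omega : i + (j + b) = ij + b)
    (by omega : n' + r - t + (t - r) = n') x _ z).symm
  rw [M.ract_mul h₁ _ rfl]

/-- The extension of a graded map `s` on `M` to the tensor product with the bar resolution,
by `x ⊗ ι (1 ⊗ y) ↦ s x ⊗ ι (1 ⊗ y)`. -/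
noncomputable def barExt (N : DGLeftModule A) (s : ∀ p p' : ℤ, M.V.X p →ₗ[k] M.V.X p')
    (n n' : ℤ) : T M (barRes N) n →ₗ[k] T M (barRes N) n' :=
  lift (W := T M (barRes N) n') (fun _ _ h => (barExtAux (N := N) s h).flip)
    (fun _ _ _ _ _ h₁ h₂ h₃ h₄ x a y => barExtAux_balanced s h₁ h₂ h₃ h₄ x a y)

lemma barExt_tmul (s : ∀ p p' : ℤ, M.V.X p →ₗ[k] M.V.X p') {n n' p r q a b pa pa' : ℤ}
    {i : ℕ} (h : p + r = n) (hq : q - i = r) (hab : a + b = q) (hpa : p + a = pa)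
    (hpa' : pa' + (b - i) = n') (x : M.V.X p) (u : A.V.X a) (y : (barStage N i).V.X b) :
    barExt N s n n' (barTmul M N h x (DGTot.ι (barQ N) i hq
      ((barStage N (i + 1)).lact hab u (((barS N i).f b).hom y)))) =
      barGen M N i hpa' (s pa pa' (M.ract hpa x u)) y :=
  (lift_tmul _ _ h x _).trans (barExtAux_ι_lact s h hq hab hpa hpa' x u y)

lemma barExt_barGen (s : ∀ p p' : ℤ, M.V.X p →ₗ[k] M.V.X p') {n n' p p' q : ℤ} {i : ℕ}
    (h : p + (q - i) = n) (h' : p' + (q - i) = n') (x : M.V.X p) (y : (barStage N i).V.X q) :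
    barExt N s n n' (barGen M N i h x y) = barGen M N i h' (s p p' x) y := by
  have h1 := tmul_ι_lact h rfl (zero_add q) (add_zero p) x A.one y
  have h2 := barExt_tmul s h rfl (zero_add q) (add_zero p) h' x A.one y
  rw [M.ract_one] at h1 h2
  exact (congrArg _ h1).symm.trans h2

/-- The filtration of the tensor product with the bar resolution. -/
noncomputable def barFil (M : DGModule A) (N : DGLeftModule A) (m : ℕ) (n : ℤ) :
    Submodule k (T M (barRes N) n) :=
  Submodule.span k {w | ∃ (i : ℕ) (_ : i < m) (p q : ℤ) (h : p + (q - i) = n) (x : M.V.X p)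
    (y : (barStage N i).V.X q), w = barGen M N i h x y}

lemma barFil_mono {m m' : ℕ} (h : m ≤ m') (n : ℤ) : barFil M N m n ≤ barFil M N m' n :=
  Submodule.span_mono fun _ ⟨i, hi, hw⟩ => ⟨i, hi.trans_le h, hw⟩

lemma tmul_ι_mem_barFil {m i : ℕ} (hi : i < m) {p q r n : ℤ} (h : p + r = n) (hq : q - i = r)
    (x : M.V.X p) (y : (barQ N i).V.X q) :
    barTmul M N h x (DGTot.ι (barQ N) i hq y) ∈ barFil M N m n := by
  rw [← Submodule.Quotient.mk_eq_zero]
  refine LinearMap.congr_fun (f := (barFil M N m n).mkQ ∘ₗ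
    barTmul M N h x ∘ₗ DGTot.ι (barQ N) i hq) (g := 0)
    (barStage_hom_ext N fun s t hst a z => ?_) y
  refine (Submodule.Quotient.mk_eq_zero _).2 ?_
  rw [LinearMap.comp_apply, tmul_ι_lact h hq hst rfl x a z]
  exact Submodule.subset_span ⟨i, hi, _, _, _, _, _, rfl⟩

lemma exists_mem_barFil {n : ℤ} (z : T M (barRes N) n) : ∃ m, z ∈ barFil M N m n := by
  have hadd (x y : T M (barRes N) n) (hx : ∃ m, x ∈ barFil M N m n)
      (hy : ∃ m, y ∈ barFil M N m n) : ∃ m, x + y ∈ barFil M N m n := by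
    obtain ⟨a, ha⟩ := hx
    obtain ⟨b, hb⟩ := hy
    exact ⟨max a b, add_mem (barFil_mono (le_max_left _ _) n ha)
      (barFil_mono (le_max_right _ _) n hb)⟩
  have h0 : ∃ m, (0 : T M (barRes N) n) ∈ barFil M N m n := ⟨0, zero_mem _⟩
  have key {p r : ℤ} (h : p + r = n) (x : M.V.X p) (y : DGTot.X (barQ N) r) :
      ∃ m, barTmul M N h x y ∈ barFil M N m n := by
    induction y using DirectSum.induction_on with
    | zero => rwa [map_zero]
    | add y y' hy hy' =>
      rw [map_add]
      exact hadd _ _ hy hy'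
    | of s y => exact ⟨s.1.1 + 1, tmul_ι_mem_barFil (Nat.lt_succ_self _) h s.2 x y⟩
  exact induction z h0 hadd fun p r h x y => key h x y

lemma barExt_mem_barFil (s : ∀ p p' : ℤ, M.V.X p →ₗ[k] M.V.X p') {n n' : ℤ} {m : ℕ}
    {z : T M (barRes N) n} (hz : z ∈ barFil M N m n) : barExt N s n n' z ∈ barFil M N m n' := by
  refine (Submodule.span_le.2 ?_ : barFil M N m n ≤ (barFil M N m n').comap (barExt N s n n')) hz
  rintro _ ⟨i, hi, p, q, h, x, y, rfl⟩
  refine (congrArg (· ∈ barFil M N m n')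
    (barExt_barGen s h (by omega : n' - n + p + (q - i) = n') x y)).mpr ?_
  exact Submodule.subset_span ⟨i, hi, _, _, _, _, _, rfl⟩

/-- The horizontal part of the differential strictly lowers the filtration, so it is invisible on
the graded pieces `M ⊗_k barStage N i`. -/
lemma low_mem_barFil {i : ℕ} {p q r n : ℤ} (h : p + (r + 1) = n) (hq : q - i = r)
    (x : M.V.X p) (y : (barQ N i).V.X q) :
    barTmul M N h x (DGTot.low (Q := barQ N) (fun i => barD N (i + 1)) i hq y) ∈
      barFil M N i n := by
  cases i with
  | zero =>
    rw [DGTot.low_zero, map_zero]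
    exact zero_mem _
  | succ i =>
    rw [DGTot.low_succ, Units.smul_def, map_zsmul]
    exact zsmul_mem (tmul_ι_mem_barFil (Nat.lt_succ_self i) h _ x _) _

lemma dT_barGen {i : ℕ} {p q n p' q' : ℤ} (h : p + (q - i) = n) (hp : p + 1 = p') (hq : q + 1 = q')
    (x : M.V.X p) (y : (barStage N i).V.X q) :
    dT M (barRes N) n (barGen M N i h x y) =
      barGen M N i (by omega : p' + (q - i) = n + 1) ((M.V.d p p').hom x) y +
      p.negOnePow • (barGen M N i (by omega : p + (q' - i) = n + 1) x
          (((barStage N i).V.d q q').hom y) +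
        barTmul M N (by omega : p + (q - i + 1) = n + 1) x
          (DGTot.low (Q := barQ N) (fun i => barD N (i + 1)) i rfl
            (((barS N i).f q).hom y))) := by
  subst hp hq
  refine (dT_tmul M (barRes N) h rfl rfl x _).trans ?_
  have h1 := DGTot.diff_ι (Q := barQ N) (fun i => barD N (i + 1)) i (rfl : q - i = q - i) rfl
    (((barS N i).f q).hom y)
  rw [← DGVect.map_d] at h1
  have h2 := congrArg (barTmul M N (by omega : p + (q - i + 1) = n + 1) x) h1
  rw [map_add, barTmul_ι_barS] at h2
  rw [barRes_d]
  exact congrArg (fun w : T M (barRes N) (n + 1) =>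
    barGen M N i (by omega : p + 1 + (q - i) = n + 1)
    ((M.V.d p (p + 1)).hom x) y + p.negOnePow • w) h2

/-- On each graded piece the extension of a contraction of `M` is a contraction. The horizontal
differential spoils the identity only by terms of lower filtration. -/
lemma barExt_homotopy {s : ∀ p p' : ℤ, M.V.X p →ₗ[k] M.V.X p'}
    (hs : ∀ {p p' p'' : ℤ}, p' + 1 = p → p + 1 = p'' →
      ∀ x : M.V.X p, (M.V.d p' p).hom (s p p' x) + s p'' p ((M.V.d p p'').hom x) = x)
    {m : ℕ} {n : ℤ} {z : T M (barRes N) (n + 1)} (hz : z ∈ barFil M N (m + 1) (n + 1)) :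
    dT M (barRes N) n (barExt N s (n + 1) n z) +
      barExt N s (n + 1 + 1) (n + 1) (dT M (barRes N) (n + 1) z) - z ∈ barFil M N m (n + 1) := by
  refine (Submodule.span_le.2 ?_ : barFil M N (m + 1) (n + 1) ≤ (barFil M N m (n + 1)).comap
    (dT M (barRes N) n ∘ₗ barExt N s (n + 1) n +
      barExt N s (n + 1 + 1) (n + 1) ∘ₗ dT M (barRes N) (n + 1) - LinearMap.id)) hz
  rintro _ ⟨i, hi, p, q, h, x, y, rfl⟩
  change dT M (barRes N) n (barExt N s (n + 1) n (barGen M N i h x y)) +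
    barExt N s (n + 1 + 1) (n + 1) (dT M (barRes N) (n + 1) (barGen M N i h x y)) -
      barGen M N i h x y ∈ barFil M N m (n + 1)
  obtain ⟨p, rfl⟩ : ∃ r, p = r + 1 := ⟨p - 1, by omega⟩
  have hle : barFil M N i (n + 1) ≤ barFil M N m (n + 1) := barFil_mono (by omega) _
  have hx := hs rfl rfl x
  have h1 := low_mem_barFil (M := M) (by omega : p + (q - i + 1) = n + 1) rfl
    (s (p + 1) p x) (((barS N i).f q).hom y)
  have h2 := barExt_mem_barFil s (n' := n + 1) (low_mem_barFil (M := M)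
    (by omega : p + 1 + (q - i + 1) = n + 1 + 1) rfl x (((barS N i).f q).hom y))
  rw [barExt_barGen s h (by omega : p + (q - i) = n), dT_barGen _ rfl rfl, dT_barGen _ rfl rfl,
    map_add, Units.smul_def (p + 1).negOnePow, map_zsmul, map_add,
    barExt_barGen s _ (by omega : p + 1 + (q - i) = n + 1),
    barExt_barGen s _ (by omega : p + (q + 1 - i) = n + 1), ← Units.smul_def, Int.negOnePow_succ,
    Units.neg_smul, smul_add, smul_add]
  have h3 : barGen M N i h ((M.V.d p (p + 1)).hom (s (p + 1) p x)) y +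
      barGen M N i h (s (p + 1 + 1) (p + 1) ((M.V.d (p + 1) (p + 1 + 1)).hom x)) y =
      barGen M N i h x y := by
    rw [← LinearMap.add_apply, ← map_add, hx]
  rw [← h3]
  -- The internal differential terms cancel because `s` changes the degree of `x` by one and so
  -- flips the Koszul sign. What is left is the difference of the horizontal terms `h1` and `h2`.
  refine (congrArg (· ∈ barFil M N m (n + 1)) ?_).mpr (hle (sub_mem
    (zsmul_mem h1 p.negOnePow.1) (zsmul_mem h2 p.negOnePow.1)))
  rw [← Units.smul_def, ← Units.smul_def]
  abel

/-- Up to sign, subtracting the coboundary of the extended contraction of `z` leaves a cocycle one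
step lower in the filtration, so induction applies. The filtration starts at zero and is exhaustive
(`exists_mem_barFil`). -/
lemma exists_dT_eq_of_mem_barFil {s : ∀ p p' : ℤ, M.V.X p →ₗ[k] M.V.X p'}
    (hs : ∀ {p p' p'' : ℤ}, p' + 1 = p → p + 1 = p'' →
      ∀ x : M.V.X p, (M.V.d p' p).hom (s p p' x) + s p'' p ((M.V.d p p'').hom x) = x)
    (m : ℕ) {n : ℤ} {z : T M (barRes N) (n + 1)} (hz : z ∈ barFil M N m (n + 1))
    (hd : dT M (barRes N) (n + 1) z = 0) : ∃ u, dT M (barRes N) n u = z := by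
  induction m generalizing z with
  | zero =>
    have h0 : barFil M N 0 (n + 1) ≤ ⊥ :=
      Submodule.span_le.2 fun w ⟨i, hi, _⟩ => absurd hi (Nat.not_lt_zero i)
    exact ⟨0, (map_zero _).trans ((Submodule.mem_bot k).1 (h0 hz)).symm⟩
  | succ m ih =>
    have h1 := barExt_homotopy hs hz
    rw [hd, map_zero, add_zero] at h1
    obtain ⟨u, hu⟩ := ih h1 (by
      rw [map_sub, hd, sub_zero]
      exact LinearMap.congr_fun (dT_dT M (barRes N) n) _)
    exact ⟨barExt N s (n + 1) n z - u, by rw [map_sub, hu, sub_sub_cancel]⟩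

/-- The bar resolution is K-flat. -/
theorem preservesAcyclic_tensorRight_barRes (N : DGLeftModule A) :
    (GradedFunctor.tensorRight (barRes N)).PreservesAcyclic := by
  intro M hM
  -- An acyclic `M` is contractible over the field, in general not `A`-linearly; a `k`-linear
  -- contraction suffices, since each column is tensored over `k`.
  obtain ⟨s, hs⟩ := DGVect.exists_contraction hM
  refine (DGVect.acyclic_iff (M.ltensor (barRes N))).2 fun n z hz => ?_
  rw [DGModule.ltensor_d] at hz ⊢
  obtain ⟨m, hm⟩ := exists_mem_barFil z
  exact exists_dT_eq_of_mem_barFil hs m hm hz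

end DGLeftModule

/-! ### The dual `L^∨` and the map from `M ⊗_A L^∨` to `Hom_A(L, M)` -/

namespace DGModule

open DGLeftTensor

variable {k : Type u} [Field k] {A : DGAlgebra k}

lemma ofElement_linComp {M N : DGModule A} {p q n : ℤ} (h : p + q = n) (x : M.V.X p)
    (f : linCochain M N q) :
    linComp A.diagonal.toDGModule M N h (M.ofElement p x) f =
      N.ofElement n ((f.1.v p n h).hom x) := by
  refine linCochain_ext fun i j hij a => ?_
  refine (linComp_v_hom h _ f (rfl : i + p = i + p) (by omega) a).trans ?_
  exact f.2 p n (i + p) j i h (by omega) (by omega) x a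

lemma ofElement_ract (N : DGModule A) {i j n : ℤ} (h : i + j = n) (x : N.V.X i) (a : A.V.X j) :
    N.ofElement n (N.ract h x a) =
      linComp A.diagonal.toDGModule A.diagonal.toDGModule N (by omega : j + i = n)
        (A.diagonal.toDGModule.ofElement j a) (N.ofElement i x) :=
  (ofElement_linComp (M := A.diagonal.toDGModule) (by omega) a (N.ofElement i x)).symm

lemma ofElement_one (A : DGAlgebra k) :
    A.diagonal.toDGModule.ofElement 0 A.one = A.diagonal.toDGModule.linId := by
  refine linCochain_ext_zero fun p a => ?_
  refine Eq.trans ?_ (linId_v_hom A.diagonal.toDGModule p a).symm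
  exact A.one_mul a

/-- The dual `L^∨ = Hom_A(L, A)` of a dg module. -/
noncomputable def vee (L : DGModule A) : DGLeftModule A where
  V := homComplex L A.diagonal.toDGModule
  lact {i j n} h :=
    (linComp L A.diagonal.toDGModule A.diagonal.toDGModule (by omega : j + i = n)).flip ∘ₗ
      A.diagonal.toDGModule.ofElement i
  one_lact {i} (x : linCochain L A.diagonal.toDGModule i) :=
    (congrArg (linComp L A.diagonal.toDGModule A.diagonal.toDGModule (add_zero i) x)
      (ofElement_one A)).trans (linComp_id x)
  mul_lact {i j l ij jl n} h₁ h₂ h₃ h₄ a b (x : linCochain L A.diagonal.toDGModule l) :=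
    (congrArg (linComp L A.diagonal.toDGModule A.diagonal.toDGModule (by omega) x)
      (A.diagonal.toDGModule.ofElement_ract h₁ a b)).trans
      (linComp_assoc (by omega) (by omega) (by omega) (by omega) x _ _).symm
  d_lact {i j n} h a (x : linCochain L A.diagonal.toDGModule j) :=
    (linδ_linComp (by omega : j + i = n) x (A.diagonal.toDGModule.ofElement i a)).trans
      (congrArg (fun w => linComp L A.diagonal.toDGModule A.diagonal.toDGModule _ x w + _)
        (A.diagonal.toDGModule.linδ_ofElement i a))

/-- The pure tensors in `M ⊗_A L^∨`. -/
noncomputable def veeTmul (M L : DGModule A) {i j n : ℤ} (h : i + j = n) :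
    M.V.X i →ₗ[k] linCochain L A.diagonal.toDGModule j →ₗ[k] T M L.vee n := tmul M L.vee h

lemma veeTmul_hom_ext {M L : DGModule A} {W : Type u} [AddCommGroup W] [Module k W] {n : ℤ}
    {f g : T M L.vee n →ₗ[k] W}
    (h : ∀ (i j : ℤ) (hij : i + j = n) (x : M.V.X i) (y : linCochain L A.diagonal.toDGModule j),
      f (veeTmul M L hij x y) = g (veeTmul M L hij x y)) : f = g :=
  hom_ext h

lemma dT_veeTmul (M L : DGModule A) {i j n : ℤ} (h : i + j = n) (x : M.V.X i)
    (y : linCochain L A.diagonal.toDGModule j) :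
    dT M L.vee n (veeTmul M L h x y) =
      veeTmul M L (by omega : i + 1 + j = n + 1) ((M.V.d i (i + 1)).hom x) y +
      i.negOnePow • veeTmul M L (by omega : i + (j + 1) = n + 1) x
        (linδ L A.diagonal.toDGModule j (j + 1) y) :=
  dT_tmul M L.vee h rfl rfl x y

/-- The maps `x ⊗ y ↦ (l ↦ x y(l))` from `M ⊗_A L^∨` to `Hom_A(L, M)`. -/
noncomputable def veeHomT (M L : DGModule A) (n : ℤ) : T M L.vee n →ₗ[k] linCochain L M n :=
  lift (X := L.vee) (W := linCochain L M n)
    (fun i j h => (linComp L A.diagonal.toDGModule M (by omega : j + i = n)).flip ∘ₗ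
      M.ofElement i)
    (by
      intro i j l ij jl h₁ h₂ h₃ h₄ x a (y : linCochain L A.diagonal.toDGModule l)
      change linComp L A.diagonal.toDGModule M (by omega : l + ij = n) y
          (M.ofElement ij (M.ract h₁ x a)) =
        linComp L A.diagonal.toDGModule M (by omega : jl + i = n)
          (linComp L A.diagonal.toDGModule A.diagonal.toDGModule (by omega : l + j = jl) y
            (A.diagonal.toDGModule.ofElement j a)) (M.ofElement i x)
      rw [ofElement_ract, linComp_assoc])

lemma veeHomT_veeTmul (M L : DGModule A) {i j n : ℤ} (h : i + j = n) (x : M.V.X i)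
    (y : linCochain L A.diagonal.toDGModule j) :
    veeHomT M L n (veeTmul M L h x y) =
      linComp L A.diagonal.toDGModule M (by omega : j + i = n) y (M.ofElement i x) :=
  lift_tmul (X := L.vee) _ _ h x y

lemma linδ_veeHomT (M L : DGModule A) (n : ℤ) (z : T M L.vee n) :
    veeHomT M L (n + 1) (dT M L.vee n z) = linδ L M n (n + 1) (veeHomT M L n z) := by
  refine LinearMap.congr_fun (f := veeHomT M L (n + 1) ∘ₗ dT M L.vee n)
    (g := linδ L M n (n + 1) ∘ₗ veeHomT M L n) (veeTmul_hom_ext fun i j h x y => ?_) z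
  rw [LinearMap.comp_apply, LinearMap.comp_apply, dT_veeTmul, map_add, Units.smul_def, map_zsmul,
    veeHomT_veeTmul, veeHomT_veeTmul, veeHomT_veeTmul, linδ_linComp, linδ_ofElement,
    Units.smul_def]

/-- The chain map `M ⊗_A L^∨ ⟶ Hom_A(L, M)`. -/
noncomputable def veeHom (M L : DGModule A) : M.ltensor L.vee ⟶ homComplex L M :=
  DGVect.mkHom (V := M.ltensor L.vee) (W := homComplex L M) (fun n => veeHomT M L n) (fun n z => by
    rw [ltensor_d]
    exact linδ_veeHomT M L n z)

lemma veeHomT_lactT {M M' : DGModule A} (L : DGModule A) {p q n : ℤ} (h : p + q = n)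
    (g : linCochain M M' p) (z : T M L.vee q) :
    veeHomT M' L n (lactT L.vee h g z) =
      linComp L M M' (by omega : q + p = n) (veeHomT M L q z) g := by
  refine LinearMap.congr_fun (f := veeHomT M' L n ∘ₗ lactT L.vee h g)
    (g := (linComp L M M' (by omega : q + p = n)).flip g ∘ₗ veeHomT M L q)
    (veeTmul_hom_ext fun i j hij x y => ?_) z
  refine (congrArg (veeHomT M' L n) (lactT_tmul L.vee h hij rfl g x y)).trans ?_
  refine (veeHomT_veeTmul M' L _ _ y).trans ?_
  rw [LinearMap.comp_apply, LinearMap.flip_apply, veeHomT_veeTmul,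
    linComp_assoc (by omega) (rfl : i + p = i + p) (by omega) (by omega),
    ofElement_linComp rfl x g]

lemma lactT_ltensorMapT {M M' : DGModule A} {X Y : DGLeftModule A} (e : DGLeftModule.Hom X Y)
    {p q n : ℤ} (h : p + q = n) (g : linCochain M M' p) (z : T M X q) :
    M'.ltensorMapT e n (lactT X h g z) = lactT Y h g (M.ltensorMapT e q z) := by
  refine LinearMap.congr_fun (f := M'.ltensorMapT e n ∘ₗ lactT X h g)
    (g := lactT Y h g ∘ₗ M.ltensorMapT e q) (hom_ext fun i j hij x y => ?_) z
  rw [LinearMap.comp_apply, LinearMap.comp_apply, lactT_tmul X h hij rfl, ltensorMapT_tmul,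
    ltensorMapT_tmul, lactT_tmul Y h hij rfl]

/-- The isomorphism `A ⊗_A N ⟶ N` in each degree. -/
noncomputable def diagTensorT (N : DGLeftModule A) (n : ℤ) :
    T A.diagonal.toDGModule N n →ₗ[k] N.V.X n :=
  lift (L := A.diagonal.toDGModule) (fun _ _ h => N.lact h)
    (fun _ _ _ _ _ h₁ h₂ h₃ h₄ x a y => N.mul_lact h₁ h₂ h₃ h₄ x a y)

lemma diagTensorT_tmul (N : DGLeftModule A) {i j n : ℤ} (h : i + j = n) (a : A.V.X i)
    (y : N.V.X j) : diagTensorT N n (tmul A.diagonal.toDGModule N h a y) = N.lact h a y :=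
  lift_tmul (L := A.diagonal.toDGModule) _ _ h a y

lemma diagTensorT_bijective (N : DGLeftModule A) (n : ℤ) :
    Function.Bijective (diagTensorT N n) := by
  refine Function.bijective_iff_has_inverse.2
    ⟨tmul A.diagonal.toDGModule N (zero_add n) A.one, fun z => ?_, fun y => ?_⟩
  · refine LinearMap.congr_fun (f := tmul A.diagonal.toDGModule N (zero_add n) A.one ∘ₗ
      diagTensorT N n) (g := LinearMap.id) (hom_ext fun i j h a y => ?_) z
    refine (congrArg (tmul A.diagonal.toDGModule N (zero_add n) A.one)
      (diagTensorT_tmul N h a y)).trans ?_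
    refine (tmul_balanced (L := A.diagonal.toDGModule) (zero_add i) h h (zero_add n)
      A.one a y).symm.trans ?_
    exact congrArg (fun w => tmul A.diagonal.toDGModule N h w y) (A.one_mul a)
  · exact (diagTensorT_tmul N (zero_add n) A.one y).trans (N.one_lact y)

/-- The isomorphism `A ⊗_A N ⟶ N`. -/
noncomputable def diagTensor (N : DGLeftModule A) : A.diagonal.toDGModule.ltensor N ⟶ N.V :=
  DGVect.mkHom (V := A.diagonal.toDGModule.ltensor N) (fun n => diagTensorT N n) (fun n z => by
    rw [ltensor_d]
    refine LinearMap.congr_fun (f := diagTensorT N (n + 1) ∘ₗ dT A.diagonal.toDGModule N n)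
      (g := (N.V.d n (n + 1)).hom ∘ₗ diagTensorT N n) (hom_ext fun i j h a y => ?_) z
    rw [LinearMap.comp_apply, LinearMap.comp_apply, dT_tmul _ _ h rfl rfl, map_add,
      Units.smul_def, map_zsmul]
    refine (congrArg₂ (fun u v => u + i.negOnePow.1 • v)
      (diagTensorT_tmul N (by omega : i + 1 + j = n + 1) ((A.V.d i (i + 1)).hom a) y)
      (diagTensorT_tmul N (by omega : i + (j + 1) = n + 1) a ((N.V.d j (j + 1)).hom y))).trans ?_
    refine (N.d_lact h a y).symm.trans ?_
    exact congrArg _ (diagTensorT_tmul N h a y).symm)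

lemma quasiIso_diagTensor (N : DGLeftModule A) : QuasiIso (diagTensor N) :=
  DGVect.quasiIso_of_bijective _ (diagTensorT_bijective N)

/-- For `M = A` the map is the canonical isomorphism `A ⊗_A L^∨ ≅ L^∨`. -/
lemma veeHomT_bijective_diagonal (L : DGModule A) (n : ℤ) :
    Function.Bijective (veeHomT A.diagonal.toDGModule L n) := by
  have h : veeHomT A.diagonal.toDGModule L n = diagTensorT L.vee n :=
    veeTmul_hom_ext fun i j h x y =>
      (veeHomT_veeTmul A.diagonal.toDGModule L h x y).trans
        (diagTensorT_tmul L.vee h x y).symm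
  rw [h]
  exact diagTensorT_bijective L.vee n

/-- `M ⊗_A L^∨ → Hom_A(L, M)` is a quasi-isomorphism for perfect `M`. -/
theorem quasiIso_veeHom {L M : DGModule A} (hL : L.IsKProjective) (hM : M.IsKProjective)
    (hM' : M.IsPerfect) : QuasiIso (veeHom M L) := by
  have hε := DGLeftModule.quasiIso_barAug L.vee
  -- Dévissage needs a source functor that preserves acyclicity, so `L^∨` is replaced by its bar
  -- resolution.
  let τ : GradedFunctor.Hom (GradedFunctor.tensorRight (DGLeftModule.barRes L.vee))
      (GradedFunctor.homLeft L) :=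
    { app := fun M => M.ltensorMap (DGLeftModule.barAug L.vee) ≫ veeHom M L
      naturality := fun {M N} q f z =>
        (congrArg (veeHomT N L q) (lactT_ltensorMapT (DGLeftModule.barAug L.vee) (zero_add q)
          f.toCochain z)).trans (veeHomT_lactT L (zero_add q) f.toCochain _) }
  have h1 : QuasiIso (τ.app M) := by
    refine GradedFunctor.quasiIso_of_isPerfect
      (DGLeftModule.preservesAcyclic_tensorRight_barRes L.vee)
      (GradedFunctor.preservesAcyclic_homLeft hL) τ ?_ hM'
    have h2 := (isKProjective_diagonal A).quasiIso_ltensorMap _ hε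
    have h3 : QuasiIso (veeHom A.diagonal.toDGModule L) :=
      DGVect.quasiIso_of_bijective _ (veeHomT_bijective_diagonal L)
    exact (DGVect.quasiIso_comp_iff_right _ _ h2).2 h3
  -- The given `M` is K-projective, hence K-flat, so the resolution can be removed.
  exact (DGVect.quasiIso_comp_iff_right _ _ (hM.quasiIso_ltensorMap _ hε)).1 h1

end DGModule

/-! ### Biduality of bimodules and evaluation on `A^*` -/

namespace DGBimodule

variable {k : Type u} [Field k] {A : DGAlgebra k}

lemma lact_castX (M : DGBimodule A) {i j j' n n' : ℤ} (hj : j = j') (hn : n = n') (h : i + j = n)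
    (a : A.V.X i) (x : M.V.X j) :
    M.lact (by omega : i + j' = n') a (M.V.castX hj x) = M.V.castX hn (M.lact h a x) := by
  subst hj hn
  rfl

/-- The canonical map of a bimodule to its double dual. -/
noncomputable def toBidual (X : DGBimodule A) : Hom X X.dual.dual where
  f := X.V.toBidual
  map_ract {i j n} h x a := by
    refine LinearMap.ext fun (φ : Module.Dual k (X.V.X (- -n))) => ?_
    change n.negOnePow • φ (X.V.castX _ (X.ract h x a)) =
      i.negOnePow • j.negOnePow • φ (X.ract (by omega : - -i + j = - -n) (X.V.castX _ x) a)
    rw [X.ract_castX (by omega : i = - -i) (by omega : n = - -n) h, smul_smul,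
      ← Int.negOnePow_add, h]
  map_lact {i j n} h a x := by
    refine LinearMap.ext fun (φ : Module.Dual k (X.V.X (- -n))) => ?_
    change n.negOnePow • φ (X.V.castX _ (X.lact h a x)) =
      i.negOnePow • j.negOnePow • φ (X.lact (by omega : i + - -j = - -n) a (X.V.castX _ x))
    rw [X.lact_castX (by omega : j = - -j) (by omega : n = - -n) h, smul_smul,
      ← Int.negOnePow_add, h]

end DGBimodule

namespace DGModule

open DGTensor

variable {k : Type u} [Field k] {A : DGAlgebra k}

lemma evalLin_apply {M N : DGModule A} {p i j : ℤ} (h : i + p = j) (x : M.V.X i)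
    (f : linCochain M N p) : evalLin N h x f = (f.1.v i j h).hom x := rfl

lemma linδ_v_hom' {M N : DGModule A} {n n' : ℤ} (hn : n + 1 = n') (f : linCochain M N n)
    {p q p' q' : ℤ} (hpq : p + n' = q) (hp : p + 1 = p') (hq : q' + 1 = q) (x : M.V.X p) :
    ((linδ M N n n' f).1.v p q hpq).hom x =
      (N.V.d q' q).hom ((f.1.v p q' (by omega)).hom x) +
      n'.negOnePow • (f.1.v p' q (by omega)).hom ((M.V.d p p').hom x) := by
  subst hn
  exact linδ_v_hom f hpq hp hq x

/-- The map `L ⊗_A X^* → Hom_A(L, X)^*`, `(l ⊗ φ)(h) = (-1)^{|l|} φ (h l)`. -/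
noncomputable def evT (L : DGModule A) (X : DGBimodule A) (n : ℤ) :
    T L X.dual n →ₗ[k] Module.Dual k (linCochain L X.toDGModule (-n)) :=
  lift (X := X.dual) (W := Module.Dual k (linCochain L X.toDGModule (-n)))
    (fun i j h => (LinearMap.mk₂ k
      (fun (x : L.V.X i) (φ : Module.Dual k (X.V.X (-j))) =>
        -- The sign `(-1)^{|x|}` compensates the `(-1)^{|a|}` in the left action on `X^*`; without
        -- it the map would not be balanced.
        i.negOnePow • φ ∘ₗ evalLin X.toDGModule (by omega : i + -n = -j) x)
      (fun _ _ _ => LinearMap.ext fun _ => by simp [evalLin_apply, Units.smul_def])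
      (fun _ _ _ => LinearMap.ext fun _ => by simp [evalLin_apply, Units.smul_def]; ring)
      (fun _ _ _ => LinearMap.ext fun _ => by simp [Units.smul_def])
      (fun _ _ _ => LinearMap.ext fun _ => by simp [Units.smul_def]; ring) :
        L.V.X i →ₗ[k] Module.Dual k (X.V.X (-j)) →ₗ[k] _))
    (by
      intro i j l ij jl h₁ h₂ h₃ h₄ x a (φ : Module.Dual k (X.V.X (-l)))
      refine LinearMap.ext fun f => ?_
      change ij.negOnePow • φ ((f.1.v ij (-l) (by omega)).hom (L.ract h₁ x a)) =
        i.negOnePow • j.negOnePow • φ (X.ract (by omega : -jl + j = -l)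
          ((f.1.v i (-jl) (by omega)).hom x) a)
      rw [f.2 i (-jl) ij (-l) j (by omega) (by omega) h₁, smul_smul, ← Int.negOnePow_add, h₁])

lemma evT_tmul (L : DGModule A) (X : DGBimodule A) {i j n : ℤ} (h : i + j = n) (x : L.V.X i)
    (φ : Module.Dual k (X.V.X (-j))) (f : linCochain L X.toDGModule (-n)) :
    evT L X n (tmul L X.dual h x φ) f =
      i.negOnePow • φ ((f.1.v i (-j) (by omega)).hom x) := by
  refine (LinearMap.congr_fun (lift_tmul (X := X.dual) _ _ h x φ) f).trans ?_
  rfl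

lemma evT_dT (L : DGModule A) (X : DGBimodule A) (n : ℤ) (z : T L X.dual n) :
    evT L X (n + 1) (dT L X.dual n z) =
      ((homComplex L X.toDGModule).dual.d n (n + 1)).hom (evT L X n z) := by
  refine LinearMap.congr_fun (f := evT L X (n + 1) ∘ₗ dT L X.dual n)
    (g := ((homComplex L X.toDGModule).dual.d n (n + 1)).hom ∘ₗ evT L X n)
    (hom_ext fun i j h x (φ : Module.Dual k (X.V.X (-j))) =>
      LinearMap.ext fun (f : linCochain L X.toDGModule (-(n + 1))) => ?_) z
  have h1 := evT_tmul L X (by omega : i + 1 + j = n + 1) ((L.V.d i (i + 1)).hom x) φ f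
  have h2 := evT_tmul L X (by omega : i + (j + 1) = n + 1) x ((X.dual.V.d j (j + 1)).hom φ) f
  have h3 := evT_tmul L X h x φ (linδ L X.toDGModule (-(n + 1)) (-n) f)
  have h4 := linδ_v_hom' (by omega : -(n + 1) + 1 = -n) f (by omega : i + -n = -j) rfl
    (by omega : -(j + 1) + 1 = -j) x
  have h5 : evT L X (n + 1) (dT L X.dual n (tmul L X.dual h x φ)) f =
      (i + 1).negOnePow • φ ((f.1.v (i + 1) (-j) (by omega)).hom ((L.V.d i (i + 1)).hom x)) +
      i.negOnePow • i.negOnePow • (j + 1).negOnePow • φ ((X.V.d (-(j + 1)) (-j)).hom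
        ((f.1.v i (-(j + 1)) (by omega)).hom x)) := by
    refine (congrArg (fun w => evT L X (n + 1) w f) (dT_tmul L X.dual h x φ)).trans ?_
    rw [map_add, LinearMap.add_apply, Units.smul_def i.negOnePow, map_zsmul]
    exact congrArg₂ (fun u v => u + i.negOnePow.1 • v) h1 h2
  refine h5.trans ?_
  change _ = (n + 1).negOnePow • evT L X n (tmul L X.dual h x φ)
    (linδ L X.toDGModule (-(n + 1)) (-n) f)
  rw [h3, h4, map_add, Units.smul_def (-n).negOnePow, map_zsmul, ← Units.smul_def, smul_add,
    smul_add, smul_smul, smul_smul, smul_smul, smul_smul, smul_smul, add_comm]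
  have hn : n.negOnePow = i.negOnePow * j.negOnePow := by rw [← h, Int.negOnePow_add]
  simp only [hn, Int.negOnePow_add, Int.negOnePow_neg, Int.negOnePow_one]
  rcases Int.even_or_odd i with hi | hi <;> rcases Int.even_or_odd j with hj | hj <;>
    simp [Int.negOnePow_even, Int.negOnePow_odd, hi, hj]

/-- The evaluation `L ⊗_A A^* → (L^∨)^*` as a chain map. -/
noncomputable def evChain (L : DGModule A) :
    L.ltensor A.diagonal.dual.toLeft ⟶ (homComplex L A.diagonal.toDGModule).dual :=
  DGVect.mkHom (V := (L.tensor A.diagonal.dual).V)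
    (W := (homComplex L A.diagonal.toDGModule).dual)
    (fun n => evT L A.diagonal n) (fun n z => by
      rw [tensor_d]
      exact evT_dT L A.diagonal n z)

lemma evT_ractT (L : DGModule A) {i j n : ℤ} (h : i + j = n) (z : T L A.diagonal.dual i)
    (a : A.V.X j) (f : linCochain L A.diagonal.toDGModule (-n)) :
    evT L A.diagonal n (ractT L A.diagonal.dual h z a) f =
      evT L A.diagonal i z (linComp L A.diagonal.toDGModule A.diagonal.toDGModule
        (by omega : -n + j = -i) f (A.diagonal.toDGModule.ofElement j a)) := by
  refine LinearMap.congr_fun (f := (evT L A.diagonal n ∘ₗ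
      (ractT L A.diagonal.dual h).flip a).flip f)
    (g := (evT L A.diagonal i).flip (linComp L A.diagonal.toDGModule A.diagonal.toDGModule
      (by omega : -n + j = -i) f (A.diagonal.toDGModule.ofElement j a)))
    (hom_ext fun p q hpq x (φ : Module.Dual k (A.V.X (-q))) => ?_) z
  have h1 := ractT_tmul L A.diagonal.dual hpq h rfl x φ a
  refine (congrArg (fun w => evT L A.diagonal n w f) h1).trans ?_
  refine (evT_tmul L A.diagonal _ x _ f).trans ?_
  refine Eq.trans ?_ (evT_tmul L A.diagonal hpq x φ _).symm
  refine congrArg (fun w => p.negOnePow • φ w) ?_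
  exact (linComp_v_hom (by omega : -n + j = -i) f (A.diagonal.toDGModule.ofElement j a)
    (by omega : p + -n = -(q + j)) (by omega) x).symm

/-- The evaluation `L ⊗_A A^* → (L^∨)^*`. -/
noncomputable def evHom (L : DGModule A) : Hom (L.tensor A.diagonal.dual) L.vee.dual where
  f := evChain L
  map_ract h z a := LinearMap.ext fun f => evT_ractT L h z a f

/-- Transport of cochains along an equality of degrees. -/
noncomputable def castLin (M N : DGModule A) {n n' : ℤ} (hn : n = n') :
    linCochain M N n →ₗ[k] linCochain M N n' :=
  (homComplex M N).castX hn

lemma castLin_v_hom (M N : DGModule A) {n n' p q q' : ℤ} (hn : n = n') (hq : q = q')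
    (h : p + n = q) (f : linCochain M N n) (x : M.V.X p) :
    ((castLin M N hn f).1.v p q' (by omega)).hom x = N.V.castX hq ((f.1.v p q h).hom x) := by
  subst hn hq
  rfl

/-- Tensor-Hom duality turns the dual of the evaluation `L ⊗_A A^* → (L^∨)^*`, precomposed with
biduality of `L^∨`, into `Hom_A(L, A → A^{**})`. The evaluation is thereby governed by biduality of
`A` and of `L^∨`. -/
lemma toBidual_evChain (L : DGModule A) :
    DGVect.toBidual (homComplex L A.diagonal.toDGModule) ≫ DGVect.dualMap L.evChain ≫
      curry L A.diagonal.dual.toLeft =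
      homMap L (N := A.diagonal.dual.toLeft.dual) A.diagonal.toBidual.toHom := by
  ext n (f : linCochain L A.diagonal.toDGModule n)
  refine linCochain_ext fun p q hpq x => ?_
  refine Eq.trans ?_ (homMap_f_v_hom L (N := A.diagonal.dual.toLeft.dual)
    A.diagonal.toBidual.toHom f hpq x).symm
  refine LinearMap.ext fun (φ : Module.Dual k (A.V.X (- -q))) => ?_
  change n.negOnePow • evT L A.diagonal (-n) (tmul L A.diagonal.dual (by omega : p + -q = -n) x φ)
      (castLin L A.diagonal.toDGModule (by omega : n = - -n) f) =
    q.negOnePow • φ (A.V.castX (by omega : q = - -q) ((f.1.v p q hpq).hom x))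
  refine (congrArg (n.negOnePow • ·) (evT_tmul L A.diagonal _ x φ _)).trans ?_
  rw [smul_smul, ← Int.negOnePow_add, (by omega : n + p = q)]
  refine congrArg (fun w => q.negOnePow • φ w) ?_
  exact castLin_v_hom L A.diagonal.toDGModule _ (by omega : q = - -q) hpq f x

/-- Dévissage in `L`, starting from `A ⊗_A N ≅ N`. The bar resolution of `N` supplies the
preservation of acyclicity, and K-flatness of `L` permits its removal. -/
lemma IsPerfect.hasFiniteCoh_ltensor {N : DGLeftModule A} (hN : N.V.HasFiniteCoh) {L : DGModule A}
    (hL : L.IsKProjective) (hL' : L.IsPerfect) : (L.ltensor N).HasFiniteCoh := by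
  have hε := DGLeftModule.quasiIso_barAug N
  refine DGVect.hasFiniteCoh_of_quasiIso (L.ltensorMap (DGLeftModule.barAug N))
    (hL.quasiIso_ltensorMap _ hε) ?_
  refine GradedFunctor.hasFiniteCoh_of_isPerfect
    (F := GradedFunctor.tensorRight (DGLeftModule.barRes N))
    (DGLeftModule.preservesAcyclic_tensorRight_barRes N) ?_ hL'
  refine DGVect.hasFiniteCoh_of_quasiIso' (diagTensor (DGLeftModule.barRes N))
    (quasiIso_diagTensor _) ?_
  exact DGVect.hasFiniteCoh_of_quasiIso' _ hε hN

lemma hasFiniteCoh_tensor_dual (hA : A.V.HasFiniteCoh) {L : DGModule A} (hL : L.IsKProjective)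
    (hL' : L.IsPerfect) : (L.ltensor A.diagonal.dual.toLeft).HasFiniteCoh :=
  IsPerfect.hasFiniteCoh_ltensor (N := A.diagonal.dual.toLeft)
    ((DGVect.hasFiniteCoh_dual_iff A.V).2 hA) hL hL'

lemma quasiIso_homMap_toBidual (hA : A.V.HasFiniteCoh) {L : DGModule A} (hL : L.IsKProjective) :
    QuasiIso (homMap L (N := A.diagonal.dual.toLeft.dual) A.diagonal.toBidual.toHom) :=
  hL.quasiIso_homMap (N := A.diagonal.dual.toLeft.dual) A.diagonal.toBidual.toHom
    (DGVect.quasiIso_toBidual hA)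

/-- As `L ↦ L^∨` is contravariant, dévissage does not apply to it directly. It is reached through
`L^∨ ≃ Hom_A(L, A^{**}) ≅ (L ⊗_A A^*)^*`, which is covered by dévissage for the tensor product. -/
lemma hasFiniteCoh_vee (hA : A.V.HasFiniteCoh) {L : DGModule A} (hL : L.IsKProjective)
    (hL' : L.IsPerfect) : L.vee.V.HasFiniteCoh := by
  refine DGVect.hasFiniteCoh_of_quasiIso' _ (quasiIso_homMap_toBidual hA hL) ?_
  refine DGVect.hasFiniteCoh_of_quasiIso _ (quasiIso_curry L A.diagonal.dual.toLeft) ?_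
  exact (DGVect.hasFiniteCoh_dual_iff _).2 (hasFiniteCoh_tensor_dual hA hL hL')

/-- Dévissage in `M`; the value at `M = A` is `L^∨`. -/
lemma hasFiniteCoh_homComplex (hA : A.V.HasFiniteCoh) {L M : DGModule A} (hL : L.IsKProjective)
    (hL' : L.IsPerfect) (hM : M.IsPerfect) : (homComplex L M).HasFiniteCoh :=
  GradedFunctor.hasFiniteCoh_of_isPerfect (GradedFunctor.preservesAcyclic_homLeft hL)
    (hasFiniteCoh_vee hA hL hL') hM

/-- Two out of three in `toBidual_evChain`: `A` and `L^∨` have degreewise finite cohomology, so both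
biduality maps are quasi-isomorphisms, as is currying. Duality reflects quasi-isomorphisms. -/
lemma quasiIso_evHom (hA : A.V.HasFiniteCoh) {L : DGModule A} (hL : L.IsKProjective)
    (hL' : L.IsPerfect) : QuasiIso L.evHom.f := by
  have hfin : (homComplex L A.diagonal.toDGModule).HasFiniteCoh := hasFiniteCoh_vee hA hL hL'
  have h1 := quasiIso_homMap_toBidual hA hL
  rw [← toBidual_evChain, DGVect.quasiIso_comp_iff_right _ _
    (DGVect.quasiIso_toBidual hfin),
    DGVect.quasiIso_comp_iff_left _ _ (quasiIso_curry L A.diagonal.dual.toLeft)] at h1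
  exact (DGVect.quasiIso_dualMap_iff L.evChain).1 h1

end DGModule

/-! ### The Serre map from `M ⊗_A L^∨` to `Hom_A(M, L ⊗_A A^*)^*` -/

namespace DGModule

open DGLeftTensor

variable {k : Type u} [Field k] {A : DGAlgebra k}

section uncurry

variable (M : DGModule A) (N : DGLeftModule A)

/-- Currying as a linear equivalence. -/
noncomputable def curryEquiv (n : ℤ) :
    Module.Dual k (T M N (-n)) ≃ₗ[k] linCochain M N.dual n :=
  LinearEquiv.ofBijective (curryLin M N n)
    ⟨curryLin_injective M N n, fun f => ⟨uncurry M N f, curryLin_uncurry M N f⟩⟩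

lemma curryEquiv_symm_tmul {n : ℤ} (f : linCochain M N.dual n) {p q : ℤ} (hpq : p + n = q)
    (x : M.V.X p) (y : N.V.X (-q)) :
    (curryEquiv M N n).symm f (tmul M N (by omega : p + -q = -n) x y) =
      (show Module.Dual k (N.V.X (-q)) from (f.1.v p q hpq).hom x) y := by
  obtain ⟨ψ, rfl⟩ := (curryEquiv M N n).surjective f
  rw [LinearEquiv.symm_apply_apply]
  rfl

/-- The isomorphism `Hom_A(M, N^*) ≅ (M ⊗_A N)^*`. -/
noncomputable def uncurryHom : homComplex M N.dual ⟶ (M.ltensor N).dual :=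
  DGVect.mkHom (V := homComplex M N.dual) (W := (M.ltensor N).dual)
    (fun n => (curryEquiv M N n).symm.toLinearMap) (fun n f => by
      obtain ⟨ψ, rfl⟩ := (curryEquiv M N n).surjective f
      refine (curryEquiv M N (n + 1)).injective ?_
      refine ((curryEquiv M N (n + 1)).apply_symm_apply _).trans ?_
      refine (linδ_curryLin M N n ψ).trans ?_
      exact congrArg (fun w => curryLin M N (n + 1) (((M.ltensor N).dual.d n (n + 1)).hom w))
        ((curryEquiv M N n).symm_apply_apply ψ).symm)

lemma quasiIso_uncurryHom : QuasiIso (uncurryHom M N) :=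
  DGVect.quasiIso_of_bijective _ fun n => (curryEquiv M N n).symm.bijective

end uncurry

variable (M L : DGModule A)

/-- The pairing of `M ⊗_A L^∨` with `Hom_A(M, L ⊗_A A^*)`, up to sign. -/
noncomputable def serrePairing :
    homComplex M (L.tensor A.diagonal.dual) ⟶ (M.ltensor L.vee).dual :=
  homMap M (M := L.tensor A.diagonal.dual) (N := L.vee.dual) L.evHom ≫ uncurryHom M L.vee

/-- The map `M ⊗_A L^∨ ⟶ Hom_A(M, L ⊗_A A^*)^*`. -/
noncomputable def serreHom :
    M.ltensor L.vee ⟶ (homComplex M (L.tensor A.diagonal.dual)).dual :=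
  (M.ltensor L.vee).toBidual ≫ DGVect.dualMap (serrePairing M L)

lemma serrePairing_veeTmul {n p q : ℤ} (h : p + n = q)
    (f : linCochain M (L.tensor A.diagonal.dual) n) (x : M.V.X p)
    (y : linCochain L A.diagonal.toDGModule (-q)) :
    (show Module.Dual k (T M L.vee (-n)) from ((serrePairing M L).f n).hom f)
        (veeTmul M L (by omega : p + -q = -n) x y) =
      evT L A.diagonal q ((f.1.v p q h).hom x) y := by
  refine (curryEquiv_symm_tmul M L.vee _ h x y).trans ?_
  exact LinearMap.congr_fun (f := show Module.Dual k (L.vee.V.X (-q)) from _)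
    (homMap_f_v_hom M (M := L.tensor A.diagonal.dual) (N := L.vee.dual) L.evHom f h x) y

lemma castX_veeTmul {p q n n' : ℤ} (h : p + q = n) (hn : n = n') (x : M.V.X p)
    (y : linCochain L A.diagonal.toDGModule q) :
    (M.ltensor L.vee).castX hn (veeTmul M L h x y) = veeTmul M L (h.trans hn) x y := by
  subst hn
  rfl

/-- The components of `serreHom`. -/
noncomputable def serreT (n : ℤ) :
    T M L.vee n →ₗ[k] Module.Dual k (linCochain M (L.tensor A.diagonal.dual) (-n)) :=
  ((serreHom M L).f n).hom

lemma serreT_veeTmul {p q n : ℤ} (h : p + -q = n) (x : M.V.X p)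
    (y : linCochain L A.diagonal.toDGModule (-q))
    (f : linCochain M (L.tensor A.diagonal.dual) (-n)) :
    serreT M L n (veeTmul M L h x y) f =
      n.negOnePow • evT L A.diagonal q ((f.1.v p q (by omega)).hom x) y := by
  change n.negOnePow • (show Module.Dual k (T M L.vee (- -n)) from
    ((serrePairing M L).f (-n)).hom f) ((M.ltensor L.vee).castX (by omega) (veeTmul M L h x y)) = _
  rw [castX_veeTmul]
  exact congrArg (n.negOnePow • ·) (serrePairing_veeTmul M L (by omega : p + -n = q) f x y)

variable {M L}

/-- `M ⊗_A L^∨ ≃ Hom_A(L, M)` has degreewise finite cohomology, so its biduality map is a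
quasi-isomorphism. The remaining factor is the dual of the pairing, made of the evaluation
quasi-isomorphism under `Hom_A(M, -)` and an isomorphism. -/
theorem quasiIso_serreHom (hA : A.V.HasFiniteCoh) (hL : L.IsKProjective) (hL' : L.IsPerfect)
    (hM : M.IsKProjective) (hM' : M.IsPerfect) : QuasiIso (serreHom M L) := by
  have h1 : (M.ltensor L.vee).HasFiniteCoh :=
    DGVect.hasFiniteCoh_of_quasiIso' _ (quasiIso_veeHom hL hM hM')
      (hasFiniteCoh_homComplex hA hL hL' hM')
  have h2 : QuasiIso (homMap M (M := L.tensor A.diagonal.dual) (N := L.vee.dual) L.evHom) :=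
    hM.quasiIso_homMap (M := L.tensor A.diagonal.dual) (N := L.vee.dual) L.evHom
      (quasiIso_evHom hA hL hL')
  have h3 : QuasiIso (serrePairing M L) :=
    (DGVect.quasiIso_comp_iff_right _ _ h2).2 (quasiIso_uncurryHom M L.vee)
  exact (DGVect.quasiIso_comp_iff_right _ _ (DGVect.quasiIso_toBidual h1)).2
    ((DGVect.quasiIso_dualMap_iff _).2 h3)

/-- Compatibility with the left action on a dual bifunctor, whose sign `(-1)^p` comes from the
factor `(-1)^n` of biduality as `n = p + q`. -/
lemma serreT_lactT {M' : DGModule A} {p q n : ℤ} (h : p + q = n) (g : linCochain M M' p)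
    (z : T M L.vee q) (f : linCochain M' (L.tensor A.diagonal.dual) (-n)) :
    serreT M' L n (lactT L.vee h g z) f = p.negOnePow • serreT M L q z
      (linComp M M' (L.tensor A.diagonal.dual) (by omega : p + -n = -q) g f) := by
  refine LinearMap.congr_fun (f := (serreT M' L n ∘ₗ lactT L.vee h g).flip f)
    (g := p.negOnePow • (serreT M L q).flip
      (linComp M M' (L.tensor A.diagonal.dual) (by omega : p + -n = -q) g f))
    (veeTmul_hom_ext fun i j hij x y => ?_) z
  obtain ⟨j, rfl⟩ := DGVect.exists_neg_eq j
  refine (congrArg (fun w => serreT M' L n w f) (lactT_tmul L.vee h hij rfl g x y)).trans ?_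
  refine (serreT_veeTmul M' L (by omega : i + p + -j = n) _ y f).trans ?_
  refine Eq.trans ?_ (congrArg (p.negOnePow • ·) (serreT_veeTmul M L hij x y _)).symm
  rw [smul_smul, ← Int.negOnePow_add, h,
    linComp_v_hom (by omega : p + -n = -q) g f (rfl : i + p = i + p) (by omega) x]

/-! ### Functoriality and naturality in `L` -/

section ractV

variable (M) {L' : DGModule A}

/-- The action `(x ⊗ y) f = x ⊗ (y ∘ f)` of cochains on `M ⊗_A L^∨`. -/
noncomputable def ractV {p q n : ℤ} (h : p + q = n) :
    T M L.vee p →ₗ[k] linCochain L' L q →ₗ[k] T M L'.vee n :=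
  lift (X := L.vee) (W := linCochain L' L q →ₗ[k] T M L'.vee n)
    (fun i j hij => LinearMap.mk₂ k
      (fun x (y : linCochain L A.diagonal.toDGModule j) =>
        (veeTmul M L' (by omega : i + (q + j) = n) x).comp
          ((linComp L' L A.diagonal.toDGModule rfl).flip y))
      (fun _ _ _ => LinearMap.ext fun _ => by simp) (fun _ _ _ => LinearMap.ext fun _ => by simp)
      (fun x y y' => LinearMap.ext fun f => map_add (veeTmul M L' _ x ∘ₗ
        linComp L' L A.diagonal.toDGModule rfl f) y y')
      (fun c x y => LinearMap.ext fun f => map_smul (veeTmul M L' _ x ∘ₗ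
        linComp L' L A.diagonal.toDGModule rfl f) c y))
    (by
      intro i j l ij jl h₁ h₂ h₃ h₄ x a (y : linCochain L A.diagonal.toDGModule l)
      refine LinearMap.ext fun f => ?_
      change veeTmul M L' _ (M.ract h₁ x a) (linComp L' L A.diagonal.toDGModule rfl f y) =
        veeTmul M L' _ x (linComp L' L A.diagonal.toDGModule rfl f
          (linComp L A.diagonal.toDGModule A.diagonal.toDGModule (by omega : l + j = jl) y
            (A.diagonal.toDGModule.ofElement j a)))
      refine (tmul_balanced (X := L'.vee) h₁ (by omega) (by omega : j + (q + l) = q + jl)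
        (by omega) x a _).trans ?_
      refine congrArg (veeTmul M L' _ x) ?_
      exact linComp_assoc (by omega) (by omega) (by omega) (by omega) f y _)

lemma ractV_veeTmul {p q n i j j' : ℤ} (h : p + q = n) (hij : i + j = p) (hj : q + j = j')
    (x : M.V.X i) (y : linCochain L A.diagonal.toDGModule j) (f : linCochain L' L q) :
    ractV M h (veeTmul M L hij x y) f =
      veeTmul M L' (by omega : i + j' = n) x (linComp L' L A.diagonal.toDGModule hj f y) := by
  subst hj
  exact LinearMap.congr_fun (lift_tmul (X := L.vee) _ _ hij x y) f

lemma ractV_id {p : ℤ} (z : T M L.vee p) : ractV M (add_zero p) z L.linId = z := by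
  refine LinearMap.congr_fun (f := (ractV M (add_zero p)).flip L.linId) (g := LinearMap.id)
    (veeTmul_hom_ext fun i j hij x y => ?_) z
  refine (ractV_veeTmul M (add_zero p) hij (zero_add j) x y L.linId).trans ?_
  rw [id_linComp]
  rfl

lemma ractV_comp {L'' : DGModule A} {p q r pq qr n : ℤ} (h₁ : p + q = pq) (h₂ : pq + r = n)
    (h₃ : r + q = qr) (h₄ : p + qr = n) (z : T M L.vee p) (f : linCochain L' L q)
    (f' : linCochain L'' L' r) :
    ractV M h₂ (ractV M h₁ z f) f' = ractV M h₄ z (linComp L'' L' L h₃ f' f) := by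
  refine LinearMap.congr_fun (f := (ractV M h₂).flip f' ∘ₗ (ractV M h₁).flip f)
    (g := (ractV M h₄).flip (linComp L'' L' L h₃ f' f))
    (veeTmul_hom_ext fun i j hij x y => ?_) z
  refine (congrArg (fun w => ractV M h₂ w f') (ractV_veeTmul M h₁ hij rfl x y f)).trans ?_
  refine (ractV_veeTmul M h₂ _ rfl x _ f').trans ?_
  refine Eq.trans ?_ (ractV_veeTmul M h₄ hij (by omega : qr + j = r + (q + j)) x y _).symm
  exact congrArg (veeTmul M L'' _ x) (linComp_assoc h₃ (rfl : q + j = q + j) (by omega)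
    (by omega) f' f y).symm

lemma lactT_ractV {M' : DGModule A} {p q r pq qr n : ℤ} (h₁ : p + q = pq) (h₂ : pq + r = n)
    (h₃ : q + r = qr) (h₄ : p + qr = n) (g : linCochain M M' p) (z : T M L.vee q)
    (f : linCochain L' L r) :
    ractV M' h₂ (lactT L.vee h₁ g z) f = lactT L'.vee h₄ g (ractV M h₃ z f) := by
  refine LinearMap.congr_fun (f := (ractV M' h₂).flip f ∘ₗ lactT L.vee h₁ g)
    (g := lactT L'.vee h₄ g ∘ₗ (ractV M h₃).flip f)
    (veeTmul_hom_ext fun i j hij x y => ?_) z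
  refine (congrArg (fun w => ractV M' h₂ w f) (lactT_tmul L.vee h₁ hij rfl g x y)).trans ?_
  refine (ractV_veeTmul M' h₂ (by omega : i + p + j = pq) rfl _ y f).trans ?_
  refine Eq.trans ?_ (congrArg (lactT L'.vee h₄ g) (ractV_veeTmul M h₃ hij rfl x y f)).symm
  exact (lactT_tmul L'.vee h₄ (by omega : i + (r + j) = qr) rfl g x _).symm

lemma ractV_units_smul {p q n : ℤ} (h : p + q = n) (ε : ℤˣ) (z : T M L.vee p)
    (f : linCochain L' L q) : ractV M h (ε • z) f = ε • ractV M h z f := by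
  rw [Units.smul_def, map_zsmul]
  rfl

lemma dT_ractV {p q n : ℤ} (h : p + q = n) (z : T M L.vee p) (f : linCochain L' L q) :
    dT M L'.vee n (ractV M h z f) =
      ractV M (by omega : p + 1 + q = n + 1) (dT M L.vee p z) f +
      p.negOnePow • ractV M (by omega : p + (q + 1) = n + 1) z (linδ L' L q (q + 1) f) := by
  refine LinearMap.congr_fun (f := dT M L'.vee n ∘ₗ (ractV M h).flip f)
    (g := (ractV M (by omega : p + 1 + q = n + 1)).flip f ∘ₗ dT M L.vee p +
      p.negOnePow • (ractV M (by omega : p + (q + 1) = n + 1)).flip (linδ L' L q (q + 1) f))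
    (veeTmul_hom_ext fun i j hij x y => ?_) z
  refine (congrArg (dT M L'.vee n) (ractV_veeTmul M h hij rfl x y f)).trans ?_
  refine (dT_veeTmul M L' _ x _).trans ?_
  change _ = ractV M (by omega : p + 1 + q = n + 1) (dT M L.vee p (veeTmul M L hij x y)) f +
    p.negOnePow • ractV M (by omega : p + (q + 1) = n + 1) (veeTmul M L hij x y)
      (linδ L' L q (q + 1) f)
  rw [dT_veeTmul, map_add, LinearMap.add_apply, ractV_units_smul, ractV_veeTmul M _ _ rfl,
    ractV_veeTmul M _ _ (by omega : _ = q + j + 1),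
    ractV_veeTmul M _ hij (by omega : _ = q + j + 1), linδ_linComp, map_add,
    Units.smul_def j.negOnePow, map_zsmul, ← Units.smul_def, smul_add, smul_smul,
    (by rw [← hij, Int.negOnePow_add] : p.negOnePow = i.negOnePow * j.negOnePow)]
  exact (add_assoc _ _ _).symm

lemma veeHomT_ractV {p q n : ℤ} (h : p + q = n) (z : T M L.vee p) (f : linCochain L' L q) :
    veeHomT M L' n (ractV M h z f) = linComp L' L M (by omega : q + p = n) f (veeHomT M L p z) := by
  refine LinearMap.congr_fun (f := veeHomT M L' n ∘ₗ (ractV M h).flip f)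
    (g := linComp L' L M (by omega : q + p = n) f ∘ₗ veeHomT M L p)
    (veeTmul_hom_ext fun i j hij x y => ?_) z
  refine (congrArg (veeHomT M L' n) (ractV_veeTmul M h hij rfl x y f)).trans ?_
  refine (veeHomT_veeTmul M L' _ x _).trans ?_
  rw [LinearMap.comp_apply, veeHomT_veeTmul, linComp_assoc]

end ractV

/-- Naturality of the evaluation in `L`. The cochain `f` raises the degree of the left factor by
`q`, which changes the sign `(-1)^{|l|}` in `evT` by `(-1)^q`. -/
lemma evT_tensorMapT {L' : DGModule A} {q r r' : ℤ} (h : r' + q = r) (f : linCochain L' L q)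
    (z : DGTensor.T L' A.diagonal.dual r') (y : linCochain L A.diagonal.toDGModule (-r)) :
    evT L A.diagonal r (tensorMapT A.diagonal.dual f h z) y =
      q.negOnePow • evT L' A.diagonal r' z
        (linComp L' L A.diagonal.toDGModule (by omega : q + -r = -r') f y) := by
  refine LinearMap.congr_fun (f := (evT L A.diagonal r ∘ₗ tensorMapT A.diagonal.dual f h).flip y)
    (g := q.negOnePow • (evT L' A.diagonal r').flip
      (linComp L' L A.diagonal.toDGModule (by omega : q + -r = -r') f y))
    (DGTensor.hom_ext fun i j hij x (φ : Module.Dual k (A.V.X (-j))) => ?_) z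
  refine (congrArg (fun w => evT L A.diagonal r w y)
    (tensorMapT_tmul A.diagonal.dual f h hij rfl x φ)).trans ?_
  refine (evT_tmul L A.diagonal (by omega : i + q + j = r) _ φ y).trans ?_
  refine Eq.trans ?_ (congrArg (q.negOnePow • ·) (evT_tmul L' A.diagonal hij x φ _)).symm
  rw [smul_smul, ← Int.negOnePow_add, add_comm q i]
  refine congrArg (fun w => (i + q).negOnePow • φ w) ?_
  exact (linComp_v_hom (by omega : q + -r = -r') f y rfl (by omega) x).symm

/-- Compatibility with the right action on a dual bifunctor, which has no sign: the `(-1)^q` from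
`evT_tensorMapT` accounts for the passage from `(-1)^n` to `(-1)^p`. -/
lemma serreT_ractV {L' : DGModule A} {p q n : ℤ} (h : p + q = n) (z : T M L.vee p)
    (f : linCochain L' L q) (w : linCochain M (L'.tensor A.diagonal.dual) (-n)) :
    serreT M L' n (ractV M h z f) w = serreT M L p z
      (linComp M (L'.tensor A.diagonal.dual) (L.tensor A.diagonal.dual) (by omega : -n + q = -p)
        w (tensorMapₗ A.diagonal.dual f)) := by
  refine LinearMap.congr_fun (f := (serreT M L' n ∘ₗ (ractV M h).flip f).flip w)
    (g := (serreT M L p).flip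
      (linComp M (L'.tensor A.diagonal.dual) (L.tensor A.diagonal.dual) (by omega : -n + q = -p)
        w (tensorMapₗ A.diagonal.dual f)))
    (veeTmul_hom_ext fun i j hij x y => ?_) z
  obtain ⟨j, rfl⟩ := DGVect.exists_neg_eq j
  refine (congrArg (fun u => serreT M L' n u w)
    (ractV_veeTmul M h hij (by omega : q + -j = -(j - q)) x y f)).trans ?_
  refine (serreT_veeTmul M L' (by omega : i + -(j - q) = n) x _ w).trans ?_
  refine Eq.trans ?_ (serreT_veeTmul M L hij x y _).symm
  have h1 := linComp_v_hom (by omega : -n + q = -p) w (tensorMapₗ A.diagonal.dual f)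
    (by omega : i + -n = j - q) (by omega : j - q + q = j) x
  have h2 := evT_tensorMapT (by omega : j - q + q = j) f ((w.1.v i (j - q) (by omega)).hom x) y
  refine Eq.trans ?_ (congrArg (fun u => p.negOnePow • evT L A.diagonal j u y) h1).symm
  refine Eq.trans ?_ (congrArg (p.negOnePow • ·) h2).symm
  rw [smul_smul, ← Int.negOnePow_add, h]

end DGModule

/-! ### Bifunctors and their natural quasi-isomorphisms -/

namespace DGModule

variable {k : Type u} [Field k] {A : DGAlgebra k}

lemma linComp_tensorMapₗ_toCochain {M M' : DGModule A} {X Y : DGBimodule A}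
    (g : DGBimodule.Hom X Y) {p : ℤ} (f : linCochain M M' p) :
    linComp (M.tensor X) (M'.tensor X) (M'.tensor Y) (add_zero p) (tensorMapₗ X f)
        (M'.tensorHom g).toCochain =
      linComp (M.tensor X) (M.tensor Y) (M'.tensor Y) (zero_add p) (M.tensorHom g).toCochain
        (tensorMapₗ Y f) := by
  refine linCochain_tensor_ext fun p q i j hpq hij x y => ?_
  refine (linComp_v_hom _ _ _ hpq (add_zero q) _).trans ?_
  refine Eq.trans ?_ (linComp_v_hom _ _ _ (add_zero p) hpq _).symm
  refine (Hom.toCochain_v_hom _ _ _).trans ?_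
  refine Eq.trans ?_ (congrArg ((tensorMapₗ Y f).1.v p q hpq).hom
    (Hom.toCochain_v_hom (M.tensorHom g) p _)).symm
  refine (congrArg _ (tensorMap_tmul X f hpq hij rfl x y)).trans ?_
  refine (tensorHom_tmul M' g _ _ y).trans ?_
  refine Eq.trans ?_ (congrArg ((tensorMap Y f).1.v p q hpq).hom
    (tensorHom_tmul M g hij x y)).symm
  exact (tensorMap_tmul Y f hpq hij rfl x _).symm

end DGModule

namespace DGBifunctor

open DGModule DGLeftTensor

variable {k : Type u} [Field k] {A : DGAlgebra k} {P Q : DGModule A → Prop}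

variable (P Q) in
/-- The bifunctor `(L, M) ↦ M ⊗_A L^∨`. -/
noncomputable def tensorVee : DGBifunctor P Q where
  obj L M := M.M.ltensor L.M.vee
  lact {L M M' p q n} h := lactT L.M.vee h
  ract {L L' M p q n} h := ractV M.M h
  lact_id {L M q} x := lactT_id L.M.vee x
  ract_id {L M q} x := ractV_id M.M x
  lact_comp {L M M' M'' p q r pq qr n} h₁ h₂ h₃ h₄ g' g x := lactT_comp L.M.vee h₁ h₂ h₃ h₄ g' g x
  ract_comp {L L' L'' M p q r pq qr n} h₁ h₂ h₃ h₄ x f f' := ractV_comp M.M h₁ h₂ h₃ h₄ x f f'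
  lact_ract {L L' M M' p q r pq qr n} h₁ h₂ h₃ h₄ g x f :=
    lactT_ractV M.M h₁ h₂ h₃ h₄ g x f
  d_lact {L M M' p q n} h g x := by
    rw [ltensor_d, ltensor_d]
    exact dT_lactT L.M.vee h g x
  d_ract {L L' M p q n} h x f := by
    rw [ltensor_d, ltensor_d]
    exact dT_ractV M.M h x f

/-- The natural transformation `M ⊗_A L^∨ → Hom_A(L, M)`. -/
noncomputable def veeHom : Hom (tensorVee P Q) (rhom P Q) where
  app L M := DGModule.veeHom M.M L.M
  map_lact {L _ _ _ _ _} h g x := veeHomT_lactT L.M h g x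
  map_ract {_ _ M _ _ _} h x f := veeHomT_ractV M.M h x f

/-- The natural transformation `M ⊗_A L^∨ → Hom_A(M, L ⊗_A A^*)^*`. -/
noncomputable def serreHom : Hom (tensorVee P Q) (rhomTwist Q P A.diagonal.dual).dual where
  app L M := DGModule.serreHom M.M L.M
  map_lact h g x := LinearMap.ext fun f => serreT_lactT h g x f
  map_ract h x f := LinearMap.ext fun w => serreT_ractV h x f w

/-- The dual of a natural transformation. -/
noncomputable def Hom.dual {E F : DGBifunctor P Q} (τ : Hom E F) : Hom F.dual E.dual where
  app L M := DGVect.dualMap (τ.app M L)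
  map_lact {_ _ _ p _ _} _ g φ := LinearMap.ext fun x =>
    congrArg (fun w => p.negOnePow • (show Module.Dual k _ from φ) w) (τ.map_ract _ x g).symm
  map_ract _ φ f := LinearMap.ext fun x =>
    congrArg (show Module.Dual k _ from φ) (τ.map_lact _ f x).symm

/-- The natural transformation of twisted `Hom`-bifunctors defined by a morphism of bimodules. -/
noncomputable def rhomTwistMap {X Y : DGBimodule A} (g : DGBimodule.Hom X Y) :
    Hom (rhomTwist P Q X) (rhomTwist P Q Y) where
  app L M := homMap L.M (tensorHom M.M g)
  map_lact {L M M' p q n} h f (x : linCochain L.M (M.M.tensor X) q) :=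
    (linComp_assoc _ (add_zero p) _ (by omega) x (tensorMapₗ X f) _).trans
      ((congrArg (linComp L.M (M.M.tensor X) (M'.M.tensor Y) (by omega) x)
        (linComp_tensorMapₗ_toCochain g f)).trans
      (linComp_assoc _ _ _ _ x _ (tensorMapₗ Y f)).symm)
  map_ract {L L' M p q n} h (x : linCochain L.M (M.M.tensor X) p) f :=
    linComp_assoc _ _ _ _ f x _

/-- K-projectivity is used twice: `M` is K-flat, so `M ⊗ g` is a quasi-isomorphism, and `Hom_A(L,
-)` preserves it. -/
lemma quasiIso_rhomTwistMap {X Y : DGBimodule A} (g : DGBimodule.Hom X Y) (hg : QuasiIso g.f)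
    (L : DGObj P) (M : DGObj Q) : QuasiIso ((rhomTwistMap (P := P) (Q := Q) g).app L M) :=
  L.kproj.quasiIso_homMap _ (M.kproj.quasiIso_tensorHom g hg)

lemma natQIso_dual_rhomTwist {X Y : DGBimodule A} (h : DGBimodule.QIso X Y) :
    NatQIso (rhomTwist P Q X).dual (rhomTwist P Q Y).dual := by
  induction h with
  | rel X Y h =>
    obtain ⟨g, hg⟩ := h
    exact .symm _ _ (.rel _ _ ⟨(rhomTwistMap g).dual, fun L M =>
      (DGVect.quasiIso_dualMap_iff _).2 (quasiIso_rhomTwistMap g hg M L)⟩)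
  | refl X => exact .refl _
  | symm X Y _ ih => exact .symm _ _ ih
  | trans X Y Z _ _ ih₁ ih₂ => exact .trans _ _ _ ih₁ ih₂

end DGBifunctor

/-! ### Existence of the structure twisted by `A^*` -/

section CalabiYau

variable {k : Type u} [Field k] {A : DGAlgebra k}

lemma HasTwistedCYBy.of_qIso {P Q : DGModule A → Prop} {X Y : DGBimodule A}
    (h : HasTwistedCYBy P Q X) (hXY : DGBimodule.QIso X Y) : HasTwistedCYBy P Q Y :=
  .trans _ _ _ (.symm _ _ (DGBifunctor.natQIso_dual_rhomTwist hXY)) h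

/-- The linear dual of `A` defines a relative Serre functor on perfect modules. -/
theorem hasTwistedCYBy_dual (hA : A.V.HasFiniteCoh) :
    HasTwistedCYBy (DGModule.IsPerfect (A := A)) DGModule.IsPerfect A.diagonal.dual :=
  -- The zigzag is the span with apex `M ⊗_A L^∨`.
  .trans _ _ _ (.symm _ _ (.rel _ _ ⟨DGBifunctor.serreHom, fun L M =>
      DGModule.quasiIso_serreHom hA L.kproj L.prop M.kproj M.prop⟩))
    (.rel _ _ ⟨DGBifunctor.veeHom, fun L M => DGModule.quasiIso_veeHom L.kproj M.kproj M.prop⟩)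

lemma DGAlgebra.IsProper.hasFiniteCoh (hA : A.IsProper) : A.V.HasFiniteCoh := by
  intro n
  have : Module.Finite k (DirectSum ℤ fun n => A.V.homology n) := hA
  exact Module.Finite.of_surjective (DirectSum.component k ℤ (fun n => A.V.homology n) n)
    (fun x => ⟨DirectSum.lof k ℤ _ n x,
      DirectSum.component.lof_self k (M := fun n => A.V.homology n) n x⟩)

end CalabiYau

/-! ### Invariance under isomorphism in `D(A^e)` -/

namespace DGBimodule

open DGModule

variable {k : Type u} [Field k] {A : DGAlgebra k}

/-- The dual of a morphism of bimodules. -/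
noncomputable def Hom.dual {X Y : DGBimodule A} (g : Hom X Y) : Hom Y.dual X.dual where
  f := DGVect.dualMap g.f
  map_ract {i j n} h φ a := LinearMap.ext fun x =>
    congrArg (show Module.Dual k (Y.V.X (-i)) from φ)
      (g.map_lact (by omega : j + -n = -i) a x).symm
  map_lact {i j n} h a φ := LinearMap.ext fun x =>
    congrArg (fun w => i.negOnePow • (show Module.Dual k (Y.V.X (-j)) from φ) w)
      (g.map_ract (by omega : -n + i = -j) x a).symm

lemma QIso.dual {X Y : DGBimodule A} (h : QIso X Y) : QIso X.dual Y.dual := by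
  induction h with
  | rel X Y h =>
    obtain ⟨g, hg⟩ := h
    exact .symm _ _ (.rel _ _ ⟨g.dual, (DGVect.quasiIso_dualMap_iff g.f).2 hg⟩)
  | refl X => exact .refl _
  | symm X Y _ ih => exact .symm _ _ ih
  | trans X Y Z _ _ ih₁ ih₂ => exact .trans _ _ _ ih₁ ih₂

lemma QIso.hasFiniteCoh_iff {X Y : DGBimodule A} (h : QIso X Y) :
    X.V.HasFiniteCoh ↔ Y.V.HasFiniteCoh := by
  induction h with
  | rel X Y h =>
    obtain ⟨g, hg⟩ := h
    exact ⟨DGVect.hasFiniteCoh_of_quasiIso g.f hg, DGVect.hasFiniteCoh_of_quasiIso' g.f hg⟩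
  | refl X => exact Iff.rfl
  | symm X Y _ ih => exact ih.symm
  | trans X Y Z _ _ ih₁ ih₂ => exact ih₁.trans ih₂

/-- The morphism `M ⊗_A g` of bimodules. -/
noncomputable def tensorHom (M : DGBimodule A) {X Y : DGBimodule A} (g : Hom X Y) :
    Hom (M.tensor X) (M.tensor Y) where
  toHom := M.toDGModule.tensorHom g
  map_lact {i j n} h a z := by
    refine LinearMap.congr_fun
      (f := ((M.toDGModule.tensorHom g).f.f n).hom ∘ₗ lactT M X h a)
      (g := lactT M Y h a ∘ₗ ((M.toDGModule.tensorHom g).f.f j).hom)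
      (DGTensor.hom_ext fun p q hpq x y => ?_) z
    refine (congrArg ((M.toDGModule.tensorHom g).f.f n).hom
      (lactT_tmul M X hpq h rfl a x y)).trans ?_
    refine (tensorHom_tmul M.toDGModule g (by omega : i + p + q = n) _ y).trans ?_
    refine Eq.trans ?_ (congrArg (lactT M Y h a)
      (tensorHom_tmul M.toDGModule g hpq x y)).symm
    exact (lactT_tmul M Y hpq h rfl a x _).symm

lemma QIso.tensor {M X Y : DGBimodule A} (hM : M.toDGModule.IsKProjective) (h : QIso X Y) :
    QIso (M.tensor X) (M.tensor Y) := by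
  induction h with
  | rel X Y h =>
    obtain ⟨g, hg⟩ := h
    exact .rel _ _ ⟨M.tensorHom g, hM.quasiIso_tensorHom g hg⟩
  | refl X => exact .refl _
  | symm X Y _ ih => exact .symm _ _ ih
  | trans X Y Z _ _ ih₁ ih₂ => exact .trans _ _ _ ih₁ ih₂

/-- Invertibility only depends on the isomorphism class in `D(A^e)`. -/
lemma IsInvertible.of_qIso {X X' : DGBimodule A} (hX : X.IsInvertible) (h : QIso X X') :
    X'.IsInvertible := by
  obtain ⟨Y, ⟨X₀, hX₀, h₁, h₂⟩, ⟨Y₀, hY₀, h₃, h₄⟩⟩ := hX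
  -- The resolution of `X` also resolves `X'`. In the product with `X` on the right, K-flatness of
  -- the resolution of `Y` lets `X` be exchanged for `X'`.
  exact ⟨Y, ⟨X₀, hX₀, .trans _ _ _ h₁ h, h₂⟩,
    ⟨Y₀, hY₀, h₃, .trans _ _ _ (.symm _ _ (h.tensor hY₀)) h₄⟩⟩

end DGBimodule

/-! ### Evaluating bifunctors at the pair `(A, A)` -/

namespace DGBifunctor

open DGModule

variable {k : Type u} [Field k] {A : DGAlgebra k}

variable (A) in
/-- The diagonal module as a perfect K-projective module. -/
def diagObj : DGObj (IsPerfect (A := A)) := ⟨A.diagonal.toDGModule, .self, isKProjective_diagonal A⟩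

/-- Identifies `A` with the endomorphism dg algebra of its diagonal module. `linComp` lists first
the map applied first, whence the reversed order; through this, a bifunctor evaluated at `(A, A)`
becomes a bimodule. -/
lemma ofElement_mul {i j n : ℤ} (h : i + j = n) (a : A.V.X i) (b : A.V.X j) :
    A.diagonal.toDGModule.ofElement n (A.mul h a b) =
      linComp A.diagonal.toDGModule A.diagonal.toDGModule A.diagonal.toDGModule
        (by omega : j + i = n) (A.diagonal.toDGModule.ofElement j b)
        (A.diagonal.toDGModule.ofElement i a) :=
  A.diagonal.toDGModule.ofElement_ract h a b

/-- The bimodule `E(A, A)` defined by a bifunctor `E`. -/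
noncomputable def evalDiag (E : DGBifunctor (IsPerfect (A := A)) (IsPerfect (A := A))) :
    DGBimodule A where
  V := E.obj (diagObj A) (diagObj A)
  ract {i j n} h := (E.ract (L := diagObj A) (L' := diagObj A) h).compl₂
    (A.diagonal.toDGModule.ofElement j)
  ract_one {i} x := (congrArg (E.ract (L := diagObj A) (L' := diagObj A) (add_zero i) x)
    (ofElement_one A)).trans (E.ract_id x)
  ract_mul {i j l ij jl n} h₁ h₂ h₃ h₄ x a b :=
    (E.ract_comp (L' := diagObj A) (L'' := diagObj A) h₁ h₂ (by omega : l + j = jl) h₄ x _ _).trans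
      (congrArg (E.ract (L' := diagObj A) h₄ x) (ofElement_mul h₃ a b).symm)
  d_ract {i j n} h x a := by
    refine (E.d_ract (L' := diagObj A) h x _).trans ?_
    exact congrArg (fun w => _ + i.negOnePow • E.ract (L' := diagObj A) _ x w)
      (A.diagonal.toDGModule.linδ_ofElement j a)
  lact {i j n} h := E.lact (M := diagObj A) (M' := diagObj A) h ∘ₗ
    A.diagonal.toDGModule.ofElement i
  one_lact {i} x := (congrArg (fun w => E.lact (M' := diagObj A) (zero_add i) w x)
    (ofElement_one A)).trans (E.lact_id x)
  mul_lact {i j l ij jl n} h₁ h₂ h₃ h₄ a b x :=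
    (congrArg (fun w => E.lact (M' := diagObj A) h₂ w x) (ofElement_mul h₁ a b)).trans
      (E.lact_comp (M' := diagObj A) (by omega : j + i = ij) h₂ h₃ h₄ _ _ x)
  d_lact {i j n} h a x := by
    refine (E.d_lact (M' := diagObj A) h _ x).trans ?_
    exact congrArg (fun w => E.lact (M' := diagObj A) _ w x + _)
      (A.diagonal.toDGModule.linδ_ofElement i a)
  lact_ract {i j l ij jl n} h₁ h₂ h₃ h₄ a x b :=
    E.lact_ract (L' := diagObj A) (M' := diagObj A) h₁ h₂ h₃ h₄ _ x _

/-- The morphism of bimodules defined by a natural transformation. -/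
noncomputable def Hom.evalDiag {E F : DGBifunctor (IsPerfect (A := A)) (IsPerfect (A := A))}
    (τ : Hom E F) : DGBimodule.Hom E.evalDiag F.evalDiag where
  f := τ.app (diagObj A) (diagObj A)
  map_ract h x _ := τ.map_ract (L' := diagObj A) h x _
  map_lact h _ x := τ.map_lact (M' := diagObj A) h _ x

lemma NatQIso.evalDiag {E F : DGBifunctor (IsPerfect (A := A)) (IsPerfect (A := A))}
    (h : NatQIso E F) : DGBimodule.QIso E.evalDiag F.evalDiag := by
  induction h with
  | rel E F h =>
    obtain ⟨τ, hτ⟩ := h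
    exact .rel _ _ ⟨τ.evalDiag, hτ _ _⟩
  | refl E => exact .refl _
  | symm E F _ ih => exact .symm _ _ ih
  | trans E F G _ _ ih₁ ih₂ => exact .trans _ _ _ ih₁ ih₂

/-- Evaluation at the diagonal commutes with duality. -/
noncomputable def dualEvalDiag (E : DGBifunctor (IsPerfect (A := A)) (IsPerfect (A := A))) :
    DGBimodule.Hom E.evalDiag.dual E.dual.evalDiag where
  -- The dual of a bimodule and the dual of a bifunctor use the same signs, so the identity is
  -- bilinear.
  f := 𝟙 _
  map_ract _ _ _ := rfl
  map_lact _ _ _ := rfl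

variable (A) in
/-- The isomorphism `A ≅ Hom_A(A, A)` of bimodules. -/
noncomputable def diagonalHom :
    DGBimodule.Hom A.diagonal (rhom (IsPerfect (A := A)) IsPerfect).evalDiag where
  f := A.diagonal.toDGModule.ofElementHom
  map_ract h x a := ofElement_mul h x a
  map_lact h a x := ofElement_mul h a x

lemma quasiIso_diagonalHom : QuasiIso (diagonalHom A).f :=
  A.diagonal.toDGModule.quasiIso_ofElementHom

/-- The isomorphism `X ≅ A ⊗_A X`, `x ↦ 1 ⊗ x`. -/
noncomputable def oneTensor (X : DGBimodule A) :
    DGModule.Hom X.toDGModule (A.diagonal.toDGModule.tensor X) where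
  f := DGVect.mkHom (V := X.V) (W := (A.diagonal.toDGModule.tensor X).V)
    (fun n => DGTensor.tmul A.diagonal.toDGModule X (zero_add n) A.one) (fun n x => by
      rw [tensor_d]
      refine Eq.symm ?_
      refine (DGTensor.dT_tmul' A.diagonal.toDGModule X (zero_add n) rfl rfl A.one x).trans ?_
      rw [Int.negOnePow_zero, one_smul]
      refine (congrArg (· + _) ?_).trans (zero_add _)
      refine (congrArg (fun w => DGTensor.tmul A.diagonal.toDGModule X _ w x)
        (d_one A (0 + 1))).trans ?_
      exact LinearMap.congr_fun (map_zero (DGTensor.tmul A.diagonal.toDGModule X _)) x)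
  map_ract {i j n} h x a :=
    (DGTensor.ractT_tmul A.diagonal.toDGModule X (zero_add i) h h A.one x a).symm

lemma quasiIso_oneTensor (X : DGBimodule A) : QuasiIso (oneTensor X).f :=
  DGVect.quasiIso_of_bijective _ fun n => by
    have h : diagTensorT X.toLeft n ∘
        (fun x => DGTensor.tmul A.diagonal.toDGModule X (zero_add n) A.one x) = id :=
      funext fun x => (diagTensorT_tmul X.toLeft (zero_add n) A.one x).trans (X.one_lact x)
    exact (Function.Bijective.of_comp_iff' (diagTensorT_bijective X.toLeft n) _).1
      (h ▸ Function.bijective_id)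

/-- The quasi-isomorphism `X → Hom_A(A, A ⊗_A X)` of bimodules. -/
noncomputable def twistHom (X : DGBimodule A) :
    DGBimodule.Hom X (rhomTwist (IsPerfect (A := A)) IsPerfect X).evalDiag where
  f := (oneTensor X).f ≫ (A.diagonal.toDGModule.tensor X).ofElementHom
  map_ract {i j n} h x a :=
    (congrArg ((A.diagonal.toDGModule.tensor X).ofElement n) ((oneTensor X).map_ract h x a)).trans
      ((A.diagonal.toDGModule.tensor X).ofElement_ract h _ a)
  map_lact {i j n} h a x := by
    -- Both sides are right multiplication into one element: left multiplication by `a` sends `1 ⊗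
    -- x` to `a ⊗ x`, and this equals `1 ⊗ a x`.
    refine Eq.trans ?_ (ofElement_linComp (by omega : j + i = n)
      (DGTensor.tmul A.diagonal.toDGModule X (zero_add j) A.one x)
      (tensorMapₗ X (A.diagonal.toDGModule.ofElement i a))).symm
    refine congrArg ((A.diagonal.toDGModule.tensor X).ofElement n) ?_
    refine Eq.trans ?_ (tensorMap_tmul X (A.diagonal.toDGModule.ofElement i a)
      (by omega : j + i = n) (zero_add j) (zero_add i) A.one x).symm
    refine Eq.trans ?_ (congrArg (fun w => DGTensor.tmul A.diagonal.toDGModule X h w x)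
      (A.mul_one a)).symm
    refine Eq.trans ?_ (congrArg (fun w => DGTensor.tmul A.diagonal.toDGModule X h w x)
      (A.one_mul a))
    exact (DGTensor.tmul_balanced (L := A.diagonal.toDGModule) (zero_add i) h h (zero_add n)
      A.one a x).symm

lemma quasiIso_twistHom (X : DGBimodule A) : QuasiIso (twistHom X).f :=
  (DGVect.quasiIso_comp_iff_right _ _ (quasiIso_oneTensor X)).2
    (quasiIso_ofElementHom (A.diagonal.toDGModule.tensor X))

end DGBifunctor

/-! ### Uniqueness of the twist and the main theorem -/

section CalabiYau

variable {k : Type u} [Field k] {A : DGAlgebra k}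

/-- A bimodule defining a twisted Calabi-Yau structure on perfect modules is the linear dual
of `A`. -/
theorem HasTwistedCYBy.qIso_dual (hA : A.V.HasFiniteCoh) {X : DGBimodule A}
    (h : HasTwistedCYBy (DGModule.IsPerfect (A := A)) DGModule.IsPerfect X) :
    DGBimodule.QIso X A.diagonal.dual := by
  -- At `L = M = A` the twisted side becomes the dual of `Hom_A(A, A ⊗_A X) ≃ X`, and the other side
  -- `Hom_A(A, A) ≅ A`.
  have h1 : DGBimodule.QIso X.dual A.diagonal :=
    .trans _ _ _ (.symm _ _ (.rel _ _ ⟨(DGBifunctor.twistHom X).dual,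
      (DGVect.quasiIso_dualMap_iff _).2 (DGBifunctor.quasiIso_twistHom X)⟩)) <|
    .trans _ _ _ (.rel _ _ ⟨DGBifunctor.dualEvalDiag _, inferInstanceAs (QuasiIso (𝟙 _))⟩) <|
    .trans _ _ _ h.evalDiag
      (.symm _ _ (.rel _ _ ⟨DGBifunctor.diagonalHom A, DGBifunctor.quasiIso_diagonalHom⟩))
  -- Finiteness passes from `A` to `X^*` and thence to `X`, so `X` is reflexive and `X^* ≃ A` can be
  -- dualized.
  have h2 : X.V.HasFiniteCoh :=
    (DGVect.hasFiniteCoh_dual_iff X.V).1 (h1.hasFiniteCoh_iff.2 hA)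
  exact .trans _ _ _ (.rel _ _ ⟨X.toBidual, DGVect.quasiIso_toBidual h2⟩) h1.dual

end CalabiYau

theorem mainTheorem9 {k : Type u} [Field k] (A : DGAlgebra k) (hA : A.IsProper) :
    (A.IsTwistedSymmetric ↔ HasTwistedCY (DGModule.IsPerfect (A := A))) ∧
    ∀ d : ℤ, A.IsSymmetric d ↔ HasCY (DGModule.IsPerfect (A := A)) d :=
  -- The twist is `A^*` itself, so twisted symmetry is precisely its invertibility.
  ⟨⟨fun h => ⟨_, h, hasTwistedCYBy_dual hA.hasFiniteCoh⟩,
    fun ⟨_, hX, h⟩ => hX.of_qIso (h.qIso_dual hA.hasFiniteCoh)⟩,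
    fun _ => ⟨fun h => (hasTwistedCYBy_dual hA.hasFiniteCoh).of_qIso h,
      fun h => .symm _ _ (HasTwistedCYBy.qIso_dual hA.hasFiniteCoh h)⟩⟩
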